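/- **Setting.** Fix $d,m\ge 0$, an integer $k\ge 1$, reals $\sigma>0$, $\lambda\in[0,1]$, $q\in[0,1]$, $\alpha>1$, a query embedding $\mathbf y\in\mathbb R^d$ and a fixed linear order on the unit vectors of $\mathbb R^d$, used only to break ties. A dataset is a finite multiset of Euclidean unit vectors of $\mathbb R^d$. For a dataset $S$, let $\mathrm{NN}_k(S)$ be the list of the first $k$ elements of $S$ (all of $S$ if $|S|<k$) when $S$ is sorted by decreasing inner product with $\mathbf y$, ties being broken by the fixed order. Let $U$ be a fixed public dataset and let $\phi:(\mathbb R^d)^k\times\mathbb R^m\to\mathcal O$ be a measurable map into a measurable space (the generative model). **Algorithm (DP-RDM, one query).** On a private dataset $D$: 1. form $D'$ by keeping each element of $D$ independently with probability $q$; 2. let $N_k=\mathrm{NN}_k(D')$ and $O_k=\mathrm{NN}_k(U)$, where $O_k$ is regarded as $k$ vectors, padded with zero vectors if $|U|<k$; 3. let $\mathbf z=\frac1k\sum_{j}N_k^{(j)}+Z$ with $Z\sim\mathcal N(0,\sigma^2 I_d)$ (missing neighbours contribute zero); 4. let $\mathbf e=(1-\lambda)\,O_k+\lambda\,[\mathbf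 z|\cdots|\mathbf z]$ and output $M(D)=\phi(\mathbf e,\xi)$ with $\xi\sim\mathcal N(0,I_m)$. The subsampling, $Z$ and $\xi$ are independent. **Definitions.** Two datasets are neighboring, $D\simeq D'$, if they differ by the addition, the removal or the replacement of a single element. For probability measures $P,Q$, the Rényi divergence is $\mathbb D_\alpha(P\|Q)=\frac1{\alpha-1}\log\mathbb E_{o\sim Q}\big[(\tfrac{dP}{dQ}(o))^\alpha\big]$ if $P\ll Q$, and $+\infty$ otherwise. A randomized mechanism $M$ is $(\alpha,\varepsilon)$-RDP if $\mathbb D_\alpha(M(D)\|M(D'))\le\varepsilon$ for all $D\simeq D'$ (the laws of the outputs being compared). **Theorem.** The quantity $$\varepsilon=\mathbb D_\alpha\big(q\,\mathcal N(2/k,\sigma^2)+(1-q)\,\mathcal N(0,\sigma^2)\ \big\|\ \mathcal N(0,\sigma^2)\big)$$ is finite and nonnegative, and the DP-RDM generation algorithm $M$ is $(\alpha,\varepsilon)$-RDP. -/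

import Mathlib

open MeasureTheory ProbabilityTheory

noncomputable section

/-- The embedding space `ℝ^d` with its Euclidean norm. -/
abbrev Emb (d : ℕ) : Type := EuclideanSpace ℝ (Fin d)

/-- Unit vectors of `ℝ^d`: the possible encoded images. -/
abbrev UnitEmb (d : ℕ) : Type := Metric.sphere (0 : Emb d) 1

/-! ### Rényi differential privacy -/

/-- The Rényi divergence of order `α`, namely `(α - 1)⁻¹ * log (E_{o ∼ Q} [(dP/dQ)(o) ^ α])`, and
`⊤` if `P` is not absolutely continuous with respect to `Q`. -/
def renyiDiv {Ω : Type*} [MeasurableSpace Ω] (α : ℝ) (P Q : Measure Ω) : EReal :=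
  open Classical in
  if P ≪ Q then
    (((α - 1)⁻¹ : ℝ) : EReal) * ENNReal.log (∫⁻ o, (P.rnDeriv Q o) ^ α ∂Q)
  else ⊤

/-- Two datasets (finite collections of records, repetitions allowed) are neighboring if they
differ by the addition, the removal or the replacement of one record. -/
def Neighboring {X : Type*} (D₁ D₂ : Multiset X) : Prop :=
  (∃ x, D₂ = x ::ₘ D₁) ∨ (∃ x, D₁ = x ::ₘ D₂) ∨
    ∃ (C : Multiset X) (x₁ x₂ : X), D₁ = x₁ ::ₘ C ∧ D₂ = x₂ ::ₘ C

/-- `(α, ε)`-Rényi differential privacy of a randomized mechanism, given by the law `M D` of its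
output on each dataset `D`. -/
def IsRDP {X Ω : Type*} [MeasurableSpace Ω] (M : Multiset X → Measure Ω) (α ε : ℝ) : Prop :=
  ∀ D₁ D₂ : Multiset X, Neighboring D₁ D₂ → renyiDiv α (M D₁) (M D₂) ≤ (ε : EReal)

/-! ### The generation algorithm -/

/-- The search order for the query `y`: larger inner product with `y` comes first, and the fixed
linear order `tie` decides between vectors with the same inner product. -/
abbrev searchOrder {d : ℕ} (tie : LinearOrder (UnitEmb d)) (y : Emb d) :
    LinearOrder (UnitEmb d) :=
  letI := tie
  LinearOrder.lift'
    (fun x : UnitEmb d => toLex (OrderDual.toDual (inner ℝ (x : Emb d) y), x))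
    (fun _ _ h => congrArg (fun p => (ofLex p).2) h)

/-- The (at most `k`) nearest neighbors of `y` in `S`, in search order. If `S` has fewer than `k`
elements, all of them are returned. -/
def nearestNeighbors {d : ℕ} (tie : LinearOrder (UnitEmb d)) (S : Multiset (UnitEmb d))
    (y : Emb d) (k : ℕ) : List (UnitEmb d) :=
  letI := searchOrder tie y
  (S.sort (· ≤ ·)).take k

/-- The aggregate `(1/k) * ∑ j, N_k^(j)` of the retrieved neighbors. Missing neighbors contribute
zero. -/
def aggregate {d : ℕ} (tie : LinearOrder (UnitEmb d)) (S : Multiset (UnitEmb d))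
    (y : Emb d) (k : ℕ) : Emb d :=
  (k : ℝ)⁻¹ • ((nearestNeighbors tie S y k).map (fun x => (x : Emb d))).sum

/-- The isotropic Gaussian `N(m, σ² I)`, the law of `m + σ Z` with `Z ∼ N(0, I)`. -/
def isoGaussian {d : ℕ} (m : Emb d) (σ : ℝ) : Measure (Emb d) :=
  (stdGaussian (Emb d)).map (fun z => m + σ • z)

/-- The mixture of the laws `K S` over the Poisson subsample `S` of `D`, in which every record of
`D` is kept independently with probability `q`. (`Multiset.powerset` lists every sub-collection
with its multiplicity.) -/
def poissonMixture {X Ω : Type*} [MeasurableSpace Ω] (q : ℝ) (D : Multiset X)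
    (K : Multiset X → Measure Ω) : Measure Ω :=
  (D.powerset.map fun S =>
    ENNReal.ofReal (q ^ S.card * (1 - q) ^ (D.card - S.card)) • K S).sum

/-- The law of the privatized embedding `z`: Poisson subsampling, retrieval, averaging, and
addition of `N(0, σ² I)`. -/
def noisyAggregation {d : ℕ} (tie : LinearOrder (UnitEmb d)) (y : Emb d) (k : ℕ) (σ q : ℝ)
    (D : Multiset (UnitEmb d)) : Measure (Emb d) :=
  poissonMixture q D (fun S => isoGaussian (aggregate tie S y k) σ)

/-- The conditioning `e = (1 - lam) • O_k + lam • [z | ⋯ | z]`, where `O_k` are the nearest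
neighbors of `y` in the public dataset `U` (zero columns if `U` has fewer than `k` elements). -/
def interpolate {d : ℕ} (tie : LinearOrder (UnitEmb d)) (U : Multiset (UnitEmb d)) (y : Emb d)
    (k : ℕ) (lam : ℝ) (z : Emb d) : Fin k → Emb d :=
  fun j =>
    (1 - lam) • (((nearestNeighbors tie U y k)[(j : ℕ)]?).elim 0 (fun x => (x : Emb d))) + lam • z

/-- The law of the output `φ (e, ξ)` of the generation algorithm on the private dataset `D` for
one query `y`, where the prior `ξ ∼ N(0, I)` on `ℝ^m` is independent of the embedding `z`. -/
def dpRDM {d m k : ℕ} {Ω : Type*} [MeasurableSpace Ω] (tie : LinearOrder (UnitEmb d))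
    (φ : (Fin k → Emb d) × Emb m → Ω) (U : Multiset (UnitEmb d)) (y : Emb d)
    (σ lam q : ℝ) (D : Multiset (UnitEmb d)) : Measure Ω :=
  ((noisyAggregation tie y k σ q D).prod (stdGaussian (Emb m))).map
    (fun p => φ (interpolate tie U y k lam p.1, p.2))

/-- The one-dimensional mixture `q N(μ, σ²) + (1 - q) N(0, σ²)`. -/
def gaussianMixture (q μ σ : ℝ) : Measure ℝ :=
  ENNReal.ofReal q • gaussianReal μ (σ ^ 2).toNNReal
    + ENNReal.ofReal (1 - q) • gaussianReal 0 (σ ^ 2).toNNReal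

end

open scoped ENNReal NNReal

/-! The power divergence `∫ P ^ α Q ^ (1 - α)` is a supremum of affine functionals of `(P, Q)`.
`PowerBound` states an upper bound on it in that dual form, so the bound passes directly to mixtures
with common weights (joint convexity), to images and to products with independent noise. It is
turned into a Rényi divergence only at the end.

Conditioning on the subsample `S` of the records common to both datasets leaves two mixtures `q
N(a₁) + (1 - q) N(a₀)` and `q N(a₂) + (1 - q) N(a₀)` with a shared component. Here `a₀` is the
aggregate of `S`, and `a₁`, `a₂` are the aggregates after inserting the differing record; for an
addition or a removal one of them equals `a₀`. An insertion keeps the `k - 1` nearest neighbors and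
changes at most one further vector, so the three means lie in one ball of radius `1 / k`
(`exists_ball_aggregate`).

What remains is geometric: among triples of means in a ball of radius `ρ` (in units of `σ`), the
worst has `a₂ = a₀` with `a₁` antipodal, and its value is `gaussianPower α q (2 * ρ)`. Isotropic
Gaussians are images of planar ones under a contraction followed by independent Gaussian noise
(`PowerBound.isoGaussian_of_planar`), so only triangles `x₁, x₂, w` in the plane matter, and these
may be enlarged. A right angle at `x₂` is bounded by the one-sided divergence along the hypotenuse
(`planarPower_rightAngle_le`). Reflecting `w` to the side of `x₂` can only increase the divergence
(`planarPower_swap`). If the angle at `x₁` or `x₂` is obtuse, the triangle is a contraction of a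
right one. Otherwise an obtuse angle at `w` is first opened up to a right angle, and then `w` slides
along the circumscribed circle until the angle at `x₂` is right (`planarPower_flow`). The hypotenuse
is then a diameter, and the circumradius is at most `ρ`.

Monotonicity along the circle is the hard step. Convexity gives a smooth lower tangent
(`planarPower_first_variation`). Its derivative has a lower bound in which `α` enters only through a
positive factor, and the Gaussian integrals left are averages of the logistic function and of its
derivative. `logisticNormal_inequality` settles their sign by Gaussian integration by parts. -/

/-- Dual form of the bound `∫ (dP/dQ) ^ α ∂Q ≤ B`, tested against bounded nonnegative functions. -/
def PowerBound {Ω : Type*} [MeasurableSpace Ω] (α B : ℝ) (P Q : Measure Ω) : Prop :=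
  ∀ h : Ω → ℝ, Measurable h → (∀ x, 0 ≤ h x) → (∃ c, ∀ x, h x ≤ c) →
    α * ∫ x, h x ^ (α - 1) ∂P ≤ B + (α - 1) * ∫ x, h x ^ α ∂Q

/-! ### Stability of the dual power bound and passage to the Rényi divergence. -/

section PowerBound

variable {Ω Ω' : Type*} [MeasurableSpace Ω] [MeasurableSpace Ω']

lemma integrable_rpow_of_bounded {μ : Measure Ω} [IsFiniteMeasure μ] {h : Ω → ℝ}
    (hm : Measurable h) (h0 : ∀ x, 0 ≤ h x) (hb : ∃ c, ∀ x, h x ≤ c) {β : ℝ} (hβ : 0 ≤ β) :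
    Integrable (fun x => h x ^ β) μ := by
  obtain ⟨c, hc⟩ := hb
  refine Integrable.of_bound (hm.pow_const β).aestronglyMeasurable (c ^ β) (.of_forall fun x => ?_)
  rw [Real.norm_of_nonneg (Real.rpow_nonneg (h0 x) _)]
  exact Real.rpow_le_rpow (h0 x) (hc x) hβ

lemma PowerBound.map {α B : ℝ} {P Q : Measure Ω} (hPQ : PowerBound α B P Q) {f : Ω → Ω'}
    (hf : Measurable f) : PowerBound α B (P.map f) (Q.map f) := by
  intro h hm h0 ⟨c, hc⟩
  rw [integral_map hf.aemeasurable (hm.pow_const _).aestronglyMeasurable,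
    integral_map hf.aemeasurable (hm.pow_const _).aestronglyMeasurable]
  exact hPQ (fun x => h (f x)) (hm.comp hf) (fun x => h0 _) ⟨c, fun x => hc _⟩

/-- The bound holds on each slice with the second coordinate frozen; integrating over `ν` keeps the
constant `B` because `ν` has mass one. -/
lemma PowerBound.prod {α B : ℝ} (hα : 1 < α) {P Q : Measure Ω} [IsFiniteMeasure P]
    [IsFiniteMeasure Q] (hPQ : PowerBound α B P Q) (ν : Measure Ω') [IsProbabilityMeasure ν] :
    PowerBound α B (P.prod ν) (Q.prod ν) := by
  intro h hm h0 hb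
  have i1 := integrable_rpow_of_bounded (μ := P.prod ν) hm h0 hb (sub_nonneg.2 hα.le)
  have i2 := integrable_rpow_of_bounded (μ := Q.prod ν) hm h0 hb (zero_le_one.trans hα.le)
  obtain ⟨c, hc⟩ := hb
  rw [integral_prod_symm _ i1, integral_prod_symm _ i2, ← integral_const_mul,
    ← integral_const_mul]
  have key : ∀ y, α * ∫ x, h (x, y) ^ (α - 1) ∂P ≤ B + (α - 1) * ∫ x, h (x, y) ^ α ∂Q :=
    fun y => hPQ (fun x => h (x, y)) (hm.comp (by fun_prop)) (fun x => h0 _) ⟨c, fun x => hc _⟩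
  have j2 := i2.integral_prod_right.const_mul (α - 1)
  calc ∫ y, α * ∫ x, h (x, y) ^ (α - 1) ∂P ∂ν
      ≤ ∫ y, (B + (α - 1) * ∫ x, h (x, y) ^ α ∂Q) ∂ν :=
        integral_mono (i1.integral_prod_right.const_mul α) ((integrable_const B).add j2) key
    _ = B + ∫ y, (α - 1) * ∫ x, h (x, y) ^ α ∂Q ∂ν := by
        rw [integral_add (integrable_const B) j2]; simp

/-- Young's inequality with first factor `1` gives `α h ^ (α - 1) ≤ 1 + (α - 1) h ^ α` pointwise. -/
lemma PowerBound.self {α B : ℝ} (hα : 1 < α) (hB : 1 ≤ B) (P : Measure Ω)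
    [IsProbabilityMeasure P] : PowerBound α B P P := by
  intro h hm h0 hb
  have i1 := integrable_rpow_of_bounded (μ := P) hm h0 hb (sub_nonneg.2 hα.le)
  have i2 := integrable_rpow_of_bounded (μ := P) hm h0 hb (zero_le_one.trans hα.le)
  have : ∫ x, α * h x ^ (α - 1) ∂P ≤ ∫ x, (1 + (α - 1) * h x ^ α) ∂P := by
    refine integral_mono (i1.const_mul _) ((integrable_const _).add (i2.const_mul _)) fun x => ?_
    have := Real.young_inequality_of_nonneg (zero_le_one) (Real.rpow_nonneg (h0 x) (α - 1))
      (Real.HolderConjugate.conjExponent hα)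
    rw [Real.one_rpow, one_mul, ← Real.rpow_mul (h0 x), Real.conjExponent,
      mul_div_cancel₀ _ (sub_ne_zero.2 hα.ne')] at this
    have h1 : α * h x ^ (α - 1) ≤ α * (1 / α + h x ^ α / (α / (α - 1))) :=
      mul_le_mul_of_nonneg_left this (by linarith)
    refine h1.trans_eq ?_
    have : α ≠ 0 := by linarith
    field_simp
  rw [integral_const_mul, integral_add (integrable_const _) (i2.const_mul _),
    integral_const_mul] at this
  simp only [integral_const, probReal_univ, smul_eq_mul, mul_one] at this
  linarith

/-- Mixing with common weights preserves a power bound. -/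
lemma PowerBound.mixture {ι : Type*} {α B : ℝ} (hα : 1 < α) (s : Multiset ι) (w : ι → ℝ)
    (hw : ∀ i ∈ s, 0 ≤ w i) (hsum : (s.map w).sum = 1) (P Q : ι → Measure Ω)
    [∀ i, IsFiniteMeasure (P i)] [∀ i, IsFiniteMeasure (Q i)]
    (hPQ : ∀ i ∈ s, PowerBound α B (P i) (Q i)) :
    PowerBound α B (s.map fun i => ENNReal.ofReal (w i) • P i).sum
      (s.map fun i => ENNReal.ofReal (w i) • Q i).sum := by
  intro h hm h0 hb
  -- Integration against a finite weighted sum of measures is the weighted sum of the integrals; the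
  -- two sides then combine term by term, and the constant `B` survives since the weights add up to
  -- one.
  have key : ∀ (R : ι → Measure Ω) [∀ i, IsFiniteMeasure (R i)] (f : Ω → ℝ),
      (∀ μ : Measure Ω, IsFiniteMeasure μ → Integrable f μ) → ∀ t : Multiset ι,
      (∀ i ∈ t, 0 ≤ w i) →
      IsFiniteMeasure (t.map fun i => ENNReal.ofReal (w i) • R i).sum ∧
      ∫ x, f x ∂(t.map fun i => ENNReal.ofReal (w i) • R i).sum
        = (t.map fun i => w i * ∫ x, f x ∂(R i)).sum := by
    intro R _ f hf t
    induction t using Multiset.induction_on with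
    | empty => intro _; simpa using (inferInstance : IsFiniteMeasure (0 : Measure Ω))
    | cons a t ih =>
      intro ht
      obtain ⟨h1, h2⟩ := ih fun i hi => ht i (Multiset.mem_cons_of_mem hi)
      have h3 : IsFiniteMeasure (ENNReal.ofReal (w a) • R a) :=
        Measure.smul_finite _ ENNReal.ofReal_ne_top
      simp only [Multiset.map_cons, Multiset.sum_cons]
      refine ⟨inferInstance, ?_⟩
      rw [integral_add_measure (hf _ h3) (hf _ h1), h2, integral_smul_measure,
        ENNReal.toReal_ofReal (ht a (Multiset.mem_cons_self a t)), smul_eq_mul]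
  rw [(key P _ (fun μ _ => integrable_rpow_of_bounded hm h0 hb (sub_nonneg.2 hα.le)) s hw).2,
    (key Q _ (fun μ _ => integrable_rpow_of_bounded hm h0 hb (zero_le_one.trans hα.le)) s hw).2]
  have : (s.map fun i => w i * (α * ∫ x, h x ^ (α - 1) ∂(P i))).sum
      ≤ (s.map fun i => w i * (B + (α - 1) * ∫ x, h x ^ α ∂(Q i))).sum :=
    Multiset.sum_map_le_sum_map _ _ fun i hi =>
      mul_le_mul_of_nonneg_left (hPQ i hi h hm h0 hb) (hw i hi)
  have e1 : (s.map fun i => w i * (α * ∫ x, h x ^ (α - 1) ∂(P i))).sum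
      = α * (s.map fun i => w i * ∫ x, h x ^ (α - 1) ∂(P i)).sum := by
    rw [← Multiset.sum_map_mul_left]; congr 1; refine Multiset.map_congr rfl fun i _ => by ring
  have e2 : (s.map fun i => w i * (B + (α - 1) * ∫ x, h x ^ α ∂(Q i))).sum
      = B * (s.map w).sum + (α - 1) * (s.map fun i => w i * ∫ x, h x ^ α ∂(Q i)).sum := by
    rw [← Multiset.sum_map_mul_left, ← Multiset.sum_map_mul_left, ← Multiset.sum_map_add]
    congr 1; refine Multiset.map_congr rfl fun i _ => by ring
  rw [e1, e2, hsum, mul_one] at this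
  exact this

/-- Testing with `c` times the indicator of a `Q`-null set kills the `Q` term, and letting `c → ∞`
forces the `P`-measure of the set to vanish. -/
lemma PowerBound.absolutelyContinuous {α B : ℝ} (hα : 1 < α) {P Q : Measure Ω}
    [IsFiniteMeasure P] (hPQ : PowerBound α B P Q) : P ≪ Q := by
  refine Measure.AbsolutelyContinuous.mk fun s hs hQ => ?_
  by_contra hP
  have hpos : 0 < P.real s := ENNReal.toReal_pos hP (measure_ne_top _ _)
  have key : ∀ c : ℝ, 0 ≤ c → α * (c ^ (α - 1) * P.real s) ≤ B := by
    intro c hc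
    have := hPQ (s.indicator fun _ => c) (measurable_const.indicator hs)
      (fun x => Set.indicator_nonneg (fun _ _ => hc) x)
      ⟨c, fun x => Set.indicator_le_self' (fun _ _ => hc) x⟩
    have e : ∀ β : ℝ, 0 < β → (fun x => (s.indicator (fun _ => c) x) ^ β)
        = s.indicator fun _ => c ^ β := by
      intro β hβ
      ext x
      by_cases hx : x ∈ s <;> simp [hx, Real.zero_rpow hβ.ne']
    rw [e _ (sub_pos.2 hα), e _ (zero_lt_one.trans hα), integral_indicator_const _ hs,
      integral_indicator_const _ hs, measureReal_def Q, hQ] at this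
    simp only [smul_eq_mul, ENNReal.toReal_zero, zero_mul, mul_zero, add_zero] at this
    linarith
  have hα0 : 0 < α := by linarith
  have hlim : Filter.Tendsto (fun c : ℝ => α * (c ^ (α - 1) * P.real s)) Filter.atTop
      Filter.atTop :=
    ((tendsto_rpow_atTop (sub_pos.2 hα)).atTop_mul_const hpos).const_mul_atTop hα0
  obtain ⟨c, hc, hc'⟩ :=
    ((hlim.eventually_gt_atTop B).and (Filter.eventually_ge_atTop 0)).exists
  exact absurd (key c hc') (not_le.2 hc)

/-- The optimal test function is the density `f` itself. It is truncated at level `n` to be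
admissible, and since `min f n ≤ f` the bound gives `α ∫ h ^ α ≤ B + (α - 1) ∫ h ^ α`. Monotone
convergence removes the truncation. -/
lemma PowerBound.lintegral_rnDeriv_le {α B : ℝ} (hα : 1 < α) {P Q : Measure Ω}
    [IsFiniteMeasure P] [IsFiniteMeasure Q] (hPQ : PowerBound α B P Q) :
    ∫⁻ x, P.rnDeriv Q x ^ α ∂Q ≤ ENNReal.ofReal B := by
  have hac := hPQ.absolutelyContinuous hα
  set f := P.rnDeriv Q with hf
  have hfm : Measurable f := Measure.measurable_rnDeriv P Q
  have hα0 : 0 < α := by linarith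
  let h : ℕ → Ω → ℝ := fun n x => (min (f x) n).toReal
  have hne : ∀ (n : ℕ) x, min (f x) (n : ℝ≥0∞) ≠ ∞ := fun n x =>
    ne_top_of_le_ne_top (ENNReal.natCast_ne_top n) (min_le_right _ _)
  have hm : ∀ n, Measurable (h n) := fun n => (hfm.min measurable_const).ennreal_toReal
  have h0 : ∀ n x, 0 ≤ h n x := fun n x => ENNReal.toReal_nonneg
  have hb : ∀ n, ∃ c, ∀ x, h n x ≤ c := fun n => ⟨n, fun x => by
    have := ENNReal.toReal_mono (ENNReal.natCast_ne_top n) (min_le_right (f x) (n : ℝ≥0∞))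
    simpa using this⟩
  have step : ∀ n : ℕ, ∫⁻ x, (min (f x) n) ^ α ∂Q ≤ ENNReal.ofReal B := by
    intro n
    have i1 := integrable_rpow_of_bounded (μ := P) (hm n) (h0 n) (hb n) (sub_nonneg.2 hα.le)
    have i2 := integrable_rpow_of_bounded (μ := Q) (hm n) (h0 n) (hb n) hα0.le
    have hconv : ∀ x (β : ℝ), 0 ≤ β → ENNReal.ofReal (h n x ^ β) = (min (f x) n) ^ β := by
      intro x β hβ
      rw [← ENNReal.ofReal_rpow_of_nonneg (h0 n x) hβ, ENNReal.ofReal_toReal (hne n x)]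
    have e2 : ENNReal.ofReal (∫ x, h n x ^ α ∂Q) = ∫⁻ x, (min (f x) n) ^ α ∂Q := by
      rw [ofReal_integral_eq_lintegral_ofReal i2 (.of_forall fun x => Real.rpow_nonneg (h0 n x) _)]
      exact lintegral_congr fun x => hconv x α hα0.le
    have e1 : ∫⁻ x, (min (f x) n) ^ α ∂Q ≤ ENNReal.ofReal (∫ x, h n x ^ (α - 1) ∂P) := by
      rw [ofReal_integral_eq_lintegral_ofReal i1 (.of_forall fun x => Real.rpow_nonneg (h0 n x) _),
        ← lintegral_rnDeriv_mul hac (((hm n).pow_const _).ennreal_ofReal.aemeasurable)]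
      refine lintegral_mono fun x => ?_
      simp only
      rw [hconv x _ (sub_nonneg.2 hα.le)]
      calc (min (f x) n) ^ α = min (f x) n * (min (f x) n) ^ (α - 1) := by
            nth_rewrite 2 [← ENNReal.rpow_one (min (f x) (n : ℝ≥0∞))]
            rw [← ENNReal.rpow_add_of_nonneg _ _ zero_le_one (sub_nonneg.2 hα.le)]
            congr 1; ring
        _ ≤ f x * (min (f x) n) ^ (α - 1) := by gcongr; exact min_le_left _ _
    rw [← e2] at e1 ⊢
    have hnn : 0 ≤ ∫ x, h n x ^ (α - 1) ∂P :=
      integral_nonneg fun x => Real.rpow_nonneg (h0 n x) _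
    have e3 := (ENNReal.ofReal_le_ofReal_iff hnn).1 e1
    have := hPQ (h n) (hm n) (h0 n) (hb n)
    refine ENNReal.ofReal_le_ofReal ?_
    nlinarith [mul_le_mul_of_nonneg_left e3 hα0.le]
  have hsup : ∀ x, f x ^ α = ⨆ n : ℕ, (min (f x) n) ^ α := by
    intro x
    have h1 : (⨆ n : ℕ, min (f x) (n : ℝ≥0∞)) = f x := by
      rw [← inf_iSup_eq, ENNReal.iSup_natCast, inf_top_eq]
    have := (ENNReal.orderIsoRpow α hα0).map_iSup fun n : ℕ => min (f x) (n : ℝ≥0∞)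
    rw [h1] at this
    exact this
  simp_rw [hsup]
  rw [lintegral_iSup (fun n => (hfm.min measurable_const).pow_const α)]
  · exact iSup_le step
  · intro n m hnm x
    dsimp only
    gcongr

lemma PowerBound.renyiDiv_le {α B : ℝ} (hα : 1 < α) {P Q : Measure Ω}
    [IsFiniteMeasure P] [IsFiniteMeasure Q] (hPQ : PowerBound α B P Q) :
    renyiDiv α P Q ≤ (((α - 1)⁻¹ : ℝ) : EReal) * ENNReal.log (ENNReal.ofReal B) := by
  rw [renyiDiv, if_pos (hPQ.absolutelyContinuous hα)]
  refine mul_le_mul_of_nonneg_left ?_ ?_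
  · exact ENNReal.log_monotone (hPQ.lintegral_rnDeriv_le hα)
  · exact_mod_cast inv_nonneg.2 (sub_nonneg.2 hα.le)

end PowerBound

/-! ### The retrieval step and the Poisson mixture -/

/-- Either `x` enters among the first `n + 1` elements and pushes out the last of them, or nothing
changes there; in both cases the first `n` old elements survive and one vector `v` is free. -/
lemma List.exists_take_orderedInsert_perm {β : Type*} (r : β → β → Prop) [DecidableRel r] (x : β)
    (l : List β) (n : ℕ) :
    ∃ v, ((l.orderedInsert r x).take (n + 1)).Perm (v :: l.take n) := by
  induction l generalizing n with
  | nil => exact ⟨x, by simp⟩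
  | cons b t ih =>
    by_cases h : r x b
    · exact ⟨x, by simp [List.orderedInsert_cons, h]⟩
    · rw [List.orderedInsert_cons, if_neg h]
      cases n with
      | zero => exact ⟨b, by simp⟩
      | succ m =>
        obtain ⟨v, hv⟩ := ih m
        refine ⟨v, ?_⟩
        rw [List.take_succ_cons, List.take_succ_cons]
        exact (hv.cons b).trans (List.Perm.swap _ _ _)

lemma Multiset.sort_cons_eq_orderedInsert {β : Type*} [LinearOrder β] (x : β) (s : Multiset β) :
    (x ::ₘ s).sort (· ≤ ·) = (s.sort (· ≤ ·)).orderedInsert (· ≤ ·) x := by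
  refine Quot.inductionOn s fun l => ?_
  simp [List.mergeSort_eq_insertionSort]

/-- Adding one record moves the average of the retrieved neighbors inside a fixed ball of radius
`1 / k`. -/
lemma exists_ball_aggregate {d : ℕ} (tie : LinearOrder (UnitEmb d)) (S : Multiset (UnitEmb d))
    (y : Emb d) {k : ℕ} (hk : 1 ≤ k) :
    ∃ o : Emb d, ‖aggregate tie S y k - o‖ ≤ (k : ℝ)⁻¹ ∧
      ∀ x, ‖aggregate tie (x ::ₘ S) y k - o‖ ≤ (k : ℝ)⁻¹ := by
  obtain ⟨n, rfl⟩ : ∃ n, k = n + 1 := ⟨k - 1, by omega⟩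
  let _ := searchOrder tie y
  set l := S.sort (· ≤ ·) with hl
  set c : ℝ := ((n + 1 : ℕ) : ℝ)⁻¹ with hc
  have hc0 : 0 ≤ c := by positivity
  have hnorm : ∀ v : UnitEmb d, ‖(v : Emb d)‖ = 1 := fun v => by simp
  -- The center is built from the `k - 1 = n` nearest neighbors only; each aggregate differs from it
  -- by at most one unit vector divided by `k`.
  refine ⟨c • ((l.take n).map (fun x => (x : Emb d))).sum, ?_, fun x => ?_⟩
  · rw [aggregate, nearestNeighbors, ← hl, ← smul_sub, norm_smul, Real.norm_of_nonneg hc0]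
    refine mul_le_of_le_one_right hc0 ?_
    rw [List.take_add_one]
    cases l[n]? with
    | none => simp
    | some v => simp [hnorm]
  · rw [aggregate, nearestNeighbors, Multiset.sort_cons_eq_orderedInsert, ← hl, ← smul_sub,
      norm_smul, Real.norm_of_nonneg hc0]
    refine mul_le_of_le_one_right hc0 ?_
    obtain ⟨v, hv⟩ := List.exists_take_orderedInsert_perm (· ≤ ·) x l n
    have hs := (hv.map (Subtype.val : UnitEmb d → Emb d)).sum_eq
    simp only [bind_pure_comp, List.map_eq_map, List.map_id'] at hs ⊢
    rw [hs]
    simp [hnorm]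

/-- The weight of a subsample `S` of `D`. -/
noncomputable def poissonWeight {X : Type*} (q : ℝ) (D S : Multiset X) : ℝ :=
  q ^ S.card * (1 - q) ^ (D.card - S.card)

lemma poissonWeight_nonneg {X : Type*} {q : ℝ} (hq : q ∈ Set.Icc (0 : ℝ) 1) (D S : Multiset X) :
    0 ≤ poissonWeight q D S :=
  mul_nonneg (pow_nonneg hq.1 _) (pow_nonneg (sub_nonneg.2 hq.2) _)

lemma poissonWeight_cons {X : Type*} (q : ℝ) (x : X) {D S : Multiset X} (hS : S ≤ D) :
    poissonWeight q (x ::ₘ D) S = (1 - q) * poissonWeight q D S := by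
  have := Multiset.card_le_card hS
  rw [poissonWeight, poissonWeight, Multiset.card_cons,
    show D.card + 1 - S.card = (D.card - S.card) + 1 by omega]
  ring

lemma poissonWeight_cons_cons {X : Type*} (q : ℝ) (x : X) (D S : Multiset X) :
    poissonWeight q (x ::ₘ D) (x ::ₘ S) = q * poissonWeight q D S := by
  rw [poissonWeight, poissonWeight, Multiset.card_cons, Multiset.card_cons, Nat.add_sub_add_right]
  ring

lemma sum_poissonWeight {X : Type*} (q : ℝ) (D : Multiset X) :
    (D.powerset.map (poissonWeight q D)).sum = 1 := by
  induction D using Multiset.induction_on with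
  | empty => simp [poissonWeight]
  | cons x D ih =>
    rw [Multiset.powerset_cons, Multiset.map_add, Multiset.sum_add, Multiset.map_map]
    have h1 : D.powerset.map (poissonWeight q (x ::ₘ D))
        = D.powerset.map fun S => (1 - q) * poissonWeight q D S :=
      Multiset.map_congr rfl fun S hS => poissonWeight_cons q x (Multiset.mem_powerset.1 hS)
    have h2 : D.powerset.map (poissonWeight q (x ::ₘ D) ∘ Multiset.cons x)
        = D.powerset.map fun S => q * poissonWeight q D S :=
      Multiset.map_congr rfl fun S _ => poissonWeight_cons_cons q x D S
    rw [h1, h2, Multiset.sum_map_mul_left, Multiset.sum_map_mul_left, ih]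
    ring

section

variable {X Ω : Type*} [MeasurableSpace Ω]

/-- The law of the output when one designated record is kept with probability `q`. -/
noncomputable def twoPoint (q : ℝ) (μ ν : Measure Ω) : Measure Ω :=
  ENNReal.ofReal q • μ + ENNReal.ofReal (1 - q) • ν

instance (q : ℝ) (μ ν : Measure Ω) [IsFiniteMeasure μ] [IsFiniteMeasure ν] :
    IsFiniteMeasure (twoPoint q μ ν) := by
  have := Measure.smul_finite μ (c := ENNReal.ofReal q) ENNReal.ofReal_ne_top
  have := Measure.smul_finite ν (c := ENNReal.ofReal (1 - q)) ENNReal.ofReal_ne_top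
  unfold twoPoint
  infer_instance

lemma twoPoint_self {q : ℝ} (hq : q ∈ Set.Icc (0 : ℝ) 1) (μ : Measure Ω) :
    twoPoint q μ μ = μ := by
  rw [twoPoint, ← add_smul, ← ENNReal.ofReal_add hq.1 (sub_nonneg.2 hq.2)]
  simp

/-- The sub-collections of `x ::ₘ D` come in pairs `S`, `x ::ₘ S` with `S` drawn from `D`, which
isolates the coin deciding on `x`. -/
lemma poissonMixture_cons {q : ℝ} (hq : q ∈ Set.Icc (0 : ℝ) 1) (x : X) (D : Multiset X)
    (K : Multiset X → Measure Ω) :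
    poissonMixture q (x ::ₘ D) K = (D.powerset.map fun S =>
      ENNReal.ofReal (poissonWeight q D S) • twoPoint q (K (x ::ₘ S)) (K S)).sum := by
  rw [poissonMixture, Multiset.powerset_cons, Multiset.map_add, Multiset.sum_add,
    Multiset.map_map, ← Multiset.sum_map_add]
  congr 1
  refine Multiset.map_congr rfl fun S hS => ?_
  have h1 := poissonWeight_cons q x (Multiset.mem_powerset.1 hS)
  have h2 := poissonWeight_cons_cons q x D S
  rw [poissonWeight] at h1 h2
  rw [h1, Function.comp, h2, twoPoint, smul_add, smul_smul, smul_smul,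
    ← ENNReal.ofReal_mul (poissonWeight_nonneg hq D S),
    ← ENNReal.ofReal_mul (poissonWeight_nonneg hq D S), add_comm, mul_comm q, mul_comm (1 - q)]

/-- Writing the untouched dataset with degenerate two-point mixtures lets addition and removal share
the argument for replacement. -/
lemma poissonMixture_eq {q : ℝ} (hq : q ∈ Set.Icc (0 : ℝ) 1) (D : Multiset X)
    (K : Multiset X → Measure Ω) :
    poissonMixture q D K = (D.powerset.map fun S =>
      ENNReal.ofReal (poissonWeight q D S) • twoPoint q (K S) (K S)).sum := by
  rw [poissonMixture]
  congr 1
  refine Multiset.map_congr rfl fun S _ => ?_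
  rw [twoPoint_self hq, poissonWeight]

end

instance {d : ℕ} (m : Emb d) (σ : ℝ) : IsProbabilityMeasure (isoGaussian m σ) := by
  unfold isoGaussian
  exact Measure.isProbabilityMeasure_map (by fun_prop)

/-- Neighboring datasets give laws of the privatized embedding that satisfy every power bound valid
for Gaussian mixtures whose means lie in a common ball of radius `1 / k`. -/
lemma powerBound_noisyAggregation {d k : ℕ} (hk : 1 ≤ k) (tie : LinearOrder (UnitEmb d))
    (y : Emb d) (σ : ℝ) {q : ℝ} (hq : q ∈ Set.Icc (0 : ℝ) 1) {α B : ℝ} (hα : 1 < α)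
    (core : ∀ o a₀ a₁ a₂ : Emb d, ‖a₀ - o‖ ≤ (k : ℝ)⁻¹ → ‖a₁ - o‖ ≤ (k : ℝ)⁻¹ →
      ‖a₂ - o‖ ≤ (k : ℝ)⁻¹ → PowerBound α B (twoPoint q (isoGaussian a₁ σ) (isoGaussian a₀ σ))
        (twoPoint q (isoGaussian a₂ σ) (isoGaussian a₀ σ)))
    {D₁ D₂ : Multiset (UnitEmb d)} (h : Neighboring D₁ D₂) :
    PowerBound α B (noisyAggregation tie y k σ q D₁) (noisyAggregation tie y k σ q D₂) := by
  have mix : ∀ (C : Multiset (UnitEmb d)) (f g : Multiset (UnitEmb d) → Multiset (UnitEmb d)),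
      (∀ S, f S = S ∨ ∃ x, f S = x ::ₘ S) → (∀ S, g S = S ∨ ∃ x, g S = x ::ₘ S) →
      PowerBound α B
        (C.powerset.map fun S => ENNReal.ofReal (poissonWeight q C S) •
          twoPoint q (isoGaussian (aggregate tie (f S) y k) σ)
            (isoGaussian (aggregate tie S y k) σ)).sum
        (C.powerset.map fun S => ENNReal.ofReal (poissonWeight q C S) •
          twoPoint q (isoGaussian (aggregate tie (g S) y k) σ)
            (isoGaussian (aggregate tie S y k) σ)).sum := by
    intro C f g hf hg
    refine PowerBound.mixture hα _ _ (fun S _ => poissonWeight_nonneg hq C S)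
      (sum_poissonWeight q C) _ _ fun S _ => ?_
    obtain ⟨o, h0, h1⟩ := exists_ball_aggregate tie S y hk
    refine core o _ _ _ h0 ?_ ?_
    · rcases hf S with h | ⟨x, h⟩ <;> rw [h]
      exacts [h0, h1 x]
    · rcases hg S with h | ⟨x, h⟩ <;> rw [h]
      exacts [h0, h1 x]
  unfold noisyAggregation
  rcases h with ⟨x, rfl⟩ | ⟨x, rfl⟩ | ⟨C, x₁, x₂, rfl, rfl⟩
  · rw [poissonMixture_cons hq, poissonMixture_eq hq]
    exact mix D₁ id (Multiset.cons x) (fun S => .inl rfl) (fun S => .inr ⟨x, rfl⟩)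
  · rw [poissonMixture_cons hq, poissonMixture_eq hq]
    exact mix D₂ (Multiset.cons x) id (fun S => .inr ⟨x, rfl⟩) (fun S => .inl rfl)
  · rw [poissonMixture_cons hq, poissonMixture_cons hq]
    exact mix C (Multiset.cons x₁) (Multiset.cons x₂) (fun S => .inr ⟨x₁, rfl⟩)
      (fun S => .inr ⟨x₂, rfl⟩)

instance {d k : ℕ} (tie : LinearOrder (UnitEmb d)) (y : Emb d) (σ q : ℝ)
    (D : Multiset (UnitEmb d)) : IsFiniteMeasure (noisyAggregation tie y k σ q D) := by
  unfold noisyAggregation poissonMixture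
  induction D.powerset using Multiset.induction_on with
  | empty => simpa using (inferInstance : IsFiniteMeasure (0 : Measure (Emb d)))
  | cons S t ih =>
    rw [Multiset.map_cons, Multiset.sum_cons]
    have := Measure.smul_finite (isoGaussian (aggregate tie S y k) σ)
      (c := ENNReal.ofReal (q ^ S.card * (1 - q) ^ (D.card - S.card))) ENNReal.ofReal_ne_top
    infer_instance

lemma measurable_interpolate {d : ℕ} (tie : LinearOrder (UnitEmb d)) (U : Multiset (UnitEmb d))
    (y : Emb d) (k : ℕ) (lam : ℝ) : Measurable (interpolate tie U y k lam) := by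
  unfold interpolate
  fun_prop

lemma powerBound_dpRDM {d m k : ℕ} {Ω : Type*} [MeasurableSpace Ω] (hk : 1 ≤ k)
    (tie : LinearOrder (UnitEmb d)) {φ : (Fin k → Emb d) × Emb m → Ω} (hφ : Measurable φ)
    (U : Multiset (UnitEmb d)) (y : Emb d) (σ lam : ℝ) {q : ℝ} (hq : q ∈ Set.Icc (0 : ℝ) 1)
    {α B : ℝ} (hα : 1 < α)
    (core : ∀ o a₀ a₁ a₂ : Emb d, ‖a₀ - o‖ ≤ (k : ℝ)⁻¹ → ‖a₁ - o‖ ≤ (k : ℝ)⁻¹ →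
      ‖a₂ - o‖ ≤ (k : ℝ)⁻¹ → PowerBound α B (twoPoint q (isoGaussian a₁ σ) (isoGaussian a₀ σ))
        (twoPoint q (isoGaussian a₂ σ) (isoGaussian a₀ σ)))
    {D₁ D₂ : Multiset (UnitEmb d)} (h : Neighboring D₁ D₂) :
    PowerBound α B (dpRDM tie φ U y σ lam q D₁) (dpRDM tie φ U y σ lam q D₂) :=
  ((powerBound_noisyAggregation hk tie y σ hq hα core h).prod hα _).map
    (hφ.comp (((measurable_interpolate tie U y k lam).comp measurable_fst).prodMk measurable_snd))

/-! ### Tangent inequalities for powers and the bound for measures with densities. -/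

section Young

lemma young_rpow {α t h : ℝ} (hα : 1 < α) (ht : 0 ≤ t) (hh : 0 ≤ h) :
    α * h ^ (α - 1) * t ≤ t ^ α + (α - 1) * h ^ α := by
  have := Real.young_inequality_of_nonneg ht (Real.rpow_nonneg hh (α - 1))
    (Real.HolderConjugate.conjExponent hα)
  rw [← Real.rpow_mul hh, Real.conjExponent, mul_div_cancel₀ _ (sub_ne_zero.2 hα.ne')] at this
  have hα0 : 0 < α := by linarith
  have h1 := mul_le_mul_of_nonneg_left this hα0.le
  have h2 : α * (t ^ α / α + h ^ α / (α / (α - 1))) = t ^ α + (α - 1) * h ^ α := by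
    have : α - 1 ≠ 0 := sub_ne_zero.2 hα.ne'
    field_simp
  linarith

lemma div_rpow_mul_self {x y : ℝ} (hx : 0 ≤ x) (hy : 0 < y) (α : ℝ) :
    (x / y) ^ α * y = x ^ α * y ^ (1 - α) := by
  rw [Real.div_rpow hx hy.le, Real.rpow_sub hy, Real.rpow_one]
  field_simp

/-- The tangent inequality for the perspective `x ^ α * y ^ (1 - α)` of the power function. -/
lemma tangent_perspective {α x y t : ℝ} (hα : 1 < α) (hx : 0 ≤ x) (hy : 0 < y) (ht : 0 ≤ t) :
    α * t ^ (α - 1) * x - (α - 1) * t ^ α * y ≤ x ^ α * y ^ (1 - α) := by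
  have := mul_le_mul_of_nonneg_right (young_rpow hα (div_nonneg hx hy.le) ht) hy.le
  rw [add_mul, div_rpow_mul_self hx hy] at this
  have e : α * t ^ (α - 1) * (x / y) * y = α * t ^ (α - 1) * x := by field_simp
  linarith

/-- Integrating the tangent inequality of the perspective at slope parameter `h x` yields the dual
bound from the primal integral. -/
lemma powerBound_withDensity {Ω : Type*} [MeasurableSpace Ω] {μ : Measure Ω} {α B : ℝ}
    (hα : 1 < α) {p r : Ω → ℝ} (hp : Measurable p) (hr : Measurable r) (hp0 : ∀ x, 0 ≤ p x)
    (hr0 : ∀ x, 0 < r x) (ip : Integrable p μ) (ir : Integrable r μ)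
    (hi : Integrable (fun x => p x ^ α * r x ^ (1 - α)) μ)
    (hB : ∫ x, p x ^ α * r x ^ (1 - α) ∂μ ≤ B) :
    PowerBound α B (μ.withDensity fun x => ENNReal.ofReal (p x))
      (μ.withDensity fun x => ENNReal.ofReal (r x)) := by
  intro h hm h0 ⟨c, hc⟩
  have hα0 : 0 < α := by linarith
  rw [integral_withDensity_eq_integral_toReal_smul hp.ennreal_ofReal
      (.of_forall fun _ => ENNReal.ofReal_lt_top),
    integral_withDensity_eq_integral_toReal_smul hr.ennreal_ofReal
      (.of_forall fun _ => ENNReal.ofReal_lt_top)]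
  simp only [ENNReal.toReal_ofReal (hp0 _), ENNReal.toReal_ofReal (hr0 _).le, smul_eq_mul]
  have j : ∀ {f : Ω → ℝ} {β : ℝ}, Integrable f μ → 0 ≤ β →
      Integrable (fun x => f x * h x ^ β) μ := by
    intro f β hf hβ
    refine hf.mul_bdd (c := c ^ β) (hm.pow_const β).aestronglyMeasurable (.of_forall fun x => ?_)
    rw [Real.norm_of_nonneg (Real.rpow_nonneg (h0 x) _)]
    exact Real.rpow_le_rpow (h0 x) (hc x) hβ
  have j1 := j ip (sub_nonneg.2 hα.le)
  have j2 := j ir hα0.le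
  rw [← integral_const_mul, ← integral_const_mul]
  refine (integral_mono (j1.const_mul α) (hi.add (j2.const_mul (α - 1))) fun x => ?_).trans
    ((integral_add hi (j2.const_mul (α - 1))).trans_le (by linarith))
  have := tangent_perspective hα (hp0 x) (hr0 x) (h0 x)
  simp only [Pi.add_apply]
  linarith

end Young

/-! ### Gaussian shifts on the line and in the plane. -/

section PlanarGaussian

/-- The standard normal law on the line. -/
noncomputable abbrev stdNormal : Measure ℝ := gaussianReal 0 1

/-- The standard normal law in the plane. -/
noncomputable abbrev stdPlanar : Measure (ℝ × ℝ) := stdNormal.prod stdNormal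

/-- The density of `N(p, 1)` with respect to `N(0, 1)`. -/
noncomputable def shiftDensity (p x : ℝ) : ℝ := Real.exp (p * x - p ^ 2 / 2)

@[fun_prop]
lemma continuous_shiftDensity : Continuous fun z : ℝ × ℝ => shiftDensity z.1 z.2 := by
  unfold shiftDensity; fun_prop

@[fun_prop]
lemma Continuous.shiftDensity {X : Type*} [TopologicalSpace X] {f g : X → ℝ} (hf : Continuous f)
    (hg : Continuous g) : Continuous fun x => _root_.shiftDensity (f x) (g x) :=
  continuous_shiftDensity.comp (hf.prodMk hg)

@[fun_prop]
lemma Measurable.shiftDensity {X : Type*} [MeasurableSpace X] {f g : X → ℝ} (hf : Measurable f)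
    (hg : Measurable g) : Measurable fun x => _root_.shiftDensity (f x) (g x) :=
  continuous_shiftDensity.measurable.comp (hf.prodMk hg)

lemma shiftDensity_pos (p x : ℝ) : 0 < shiftDensity p x := Real.exp_pos _

@[simp] lemma shiftDensity_zero (x : ℝ) : shiftDensity 0 x = 1 := by simp [shiftDensity]

lemma gaussianReal_eq_withDensity_shiftDensity (p : ℝ) :
    gaussianReal p 1 = stdNormal.withDensity fun x => ENNReal.ofReal (shiftDensity p x) := by
  rw [stdNormal, gaussianReal_of_var_ne_zero _ one_ne_zero, gaussianReal_of_var_ne_zero _ one_ne_zero,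
    ← withDensity_mul _ (by fun_prop) (by fun_prop)]
  congr 1
  ext x
  rw [Pi.mul_apply, gaussianPDF, gaussianPDF, ← ENNReal.ofReal_mul (gaussianPDFReal_nonneg _ _ _)]
  congr 1
  simp only [gaussianPDFReal, shiftDensity, NNReal.coe_one, mul_one]
  rw [mul_assoc, ← Real.exp_add]
  congr 2
  ring

lemma integral_comp_add_stdNormal (p : ℝ) (f : ℝ → ℝ) :
    ∫ x, f (x + p) ∂stdNormal = ∫ x, shiftDensity p x * f x ∂stdNormal := by
  have h := gaussianReal_map_add_const (μ := 0) (v := 1) p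
  rw [zero_add] at h
  have e : ∫ x, f x ∂(gaussianReal p 1) = ∫ x, f (x + p) ∂stdNormal := by
    rw [← h, (measurableEmbedding_addRight p).integral_map]
  rw [← e, gaussianReal_eq_withDensity_shiftDensity,
    integral_withDensity_eq_integral_toReal_smul (by fun_prop)
      (.of_forall fun _ => ENNReal.ofReal_lt_top)]
  simp only [ENNReal.toReal_ofReal (shiftDensity_pos _ _).le, smul_eq_mul]

lemma integral_comp_neg_stdNormal (f : ℝ → ℝ) :
    ∫ x, f (-x) ∂stdNormal = ∫ x, f x ∂stdNormal := by
  have h := gaussianReal_map_neg (μ := 0) (v := 1)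
  rw [neg_zero] at h
  conv_rhs => rw [stdNormal, ← h]
  exact ((MeasurableEquiv.neg ℝ).measurableEmbedding.integral_map f).symm

/-- The law `N(p, I)` in the plane. -/
noncomputable def planarGaussian (p : ℝ × ℝ) : Measure (ℝ × ℝ) :=
  (gaussianReal p.1 1).prod (gaussianReal p.2 1)

instance (p : ℝ × ℝ) : IsProbabilityMeasure (planarGaussian p) := by
  unfold planarGaussian; infer_instance

/-- The density of `N(p, I)` with respect to `N(0, I)` in the plane. -/
noncomputable def planarDensity (p z : ℝ × ℝ) : ℝ := shiftDensity p.1 z.1 * shiftDensity p.2 z.2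

@[fun_prop]
lemma Continuous.planarDensity {X : Type*} [TopologicalSpace X] {f g : X → ℝ × ℝ}
    (hf : Continuous f) (hg : Continuous g) :
    Continuous fun x => _root_.planarDensity (f x) (g x) := by
  unfold _root_.planarDensity; fun_prop

lemma planarDensity_pos (p z : ℝ × ℝ) : 0 < planarDensity p z :=
  mul_pos (shiftDensity_pos _ _) (shiftDensity_pos _ _)

lemma planarGaussian_eq_withDensity (p : ℝ × ℝ) :
    planarGaussian p = stdPlanar.withDensity fun z => ENNReal.ofReal (planarDensity p z) := by
  rw [planarGaussian, gaussianReal_eq_withDensity_shiftDensity p.1,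
    gaussianReal_eq_withDensity_shiftDensity p.2, prod_withDensity (by fun_prop) (by fun_prop)]
  congr 1
  ext z
  rw [planarDensity, ENNReal.ofReal_mul (shiftDensity_pos _ _).le]

lemma integral_comp_add_stdPlanar (p : ℝ × ℝ) (f : ℝ × ℝ → ℝ) :
    ∫ z, f (z + p) ∂stdPlanar = ∫ z, planarDensity p z * f z ∂stdPlanar := by
  have h1 := gaussianReal_map_add_const (μ := 0) (v := 1) p.1
  have h2 := gaussianReal_map_add_const (μ := 0) (v := 1) p.2
  rw [zero_add] at h1 h2
  have e : ∫ z, f z ∂(planarGaussian p) = ∫ z, f (z + p) ∂stdPlanar := by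
    rw [planarGaussian, ← h1, ← h2, Measure.map_prod_map _ _ (by fun_prop) (by fun_prop)]
    exact (measurableEmbedding_addRight p).integral_map _
  rw [← e, planarGaussian_eq_withDensity,
    integral_withDensity_eq_integral_toReal_smul (by fun_prop)
      (.of_forall fun _ => ENNReal.ofReal_lt_top)]
  simp only [ENNReal.toReal_ofReal (planarDensity_pos _ _).le, smul_eq_mul]

lemma integral_comp_neg_fst_stdPlanar (f : ℝ × ℝ → ℝ) :
    ∫ z, f (-z.1, z.2) ∂stdPlanar = ∫ z, f z ∂stdPlanar := by
  have h := gaussianReal_map_neg (μ := 0) (v := 1)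
  rw [neg_zero] at h
  have e : stdPlanar = stdPlanar.map (Prod.map (fun x => -x) id) := by
    rw [stdPlanar, ← Measure.map_prod_map _ _ (by fun_prop) (by fun_prop), Measure.map_id, stdNormal, h]
  conv_rhs => rw [e]
  exact (MeasurableEmbedding.integral_map (((MeasurableEquiv.neg ℝ).prodCongr
    (MeasurableEquiv.refl ℝ)).measurableEmbedding) f).symm

lemma integrable_exp_abs_stdNormal (K : ℝ) : Integrable (fun x => Real.exp (K * |x|)) stdNormal := by
  have h1 := integrable_exp_mul_gaussianReal (μ := 0) (v := 1) K
  have h2 := integrable_exp_mul_gaussianReal (μ := 0) (v := 1) (-K)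
  refine (h1.add h2).mono' (by fun_prop) (.of_forall fun x => ?_)
  rw [Real.norm_of_nonneg (Real.exp_pos _).le]
  simp only [Pi.add_apply]
  rcases abs_cases x with ⟨h, _⟩ | ⟨h, _⟩ <;> rw [h]
  · have := Real.exp_pos (-K * x); linarith
  · have := Real.exp_pos (K * x); simp only [mul_neg, neg_mul]; linarith

lemma integrable_exp_abs_stdPlanar (C K : ℝ) :
    Integrable (fun z : ℝ × ℝ => C * Real.exp (K * (|z.1| + |z.2|))) stdPlanar := by
  simp_rw [mul_add, Real.exp_add]
  exact ((integrable_exp_abs_stdNormal K).mul_prod (integrable_exp_abs_stdNormal K)).const_mul C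

end PlanarGaussian

/-! ### From planar Gaussians to isotropic Gaussians through contractions. -/

section Channel

variable {d : ℕ}

/-- The adjoint of a contraction is a contraction: Cauchy-Schwarz is applied to `t` and the image of
its own coordinates. -/
lemma inner_sq_add_inner_sq_le {T₁ T₂ : Emb d}
    (hT : ∀ a b : ℝ, ‖a • T₁ + b • T₂‖ ^ 2 ≤ a ^ 2 + b ^ 2) (t : Emb d) :
    inner ℝ T₁ t ^ 2 + inner ℝ T₂ t ^ 2 ≤ ‖t‖ ^ 2 := by
  set a : ℝ := inner ℝ T₁ t
  set b : ℝ := inner ℝ T₂ t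
  have h1 : inner ℝ (a • T₁ + b • T₂) t = a ^ 2 + b ^ 2 := by
    rw [inner_add_left, real_inner_smul_left, real_inner_smul_left]; ring
  have h2 := abs_le.1 (abs_real_inner_le_norm (a • T₁ + b • T₂) t)
  have h3 := hT a b
  rw [h1] at h2
  nlinarith [norm_nonneg t, norm_nonneg (a • T₁ + b • T₂), sq_nonneg (‖a • T₁ + b • T₂‖ - ‖t‖)]

/-- The covariance `I - T Tᵀ` left over by the linear map with columns `T₁, T₂`. -/
noncomputable def residualCov (T₁ T₂ : Emb d) : Matrix (Fin d) (Fin d) ℝ :=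
  1 - Matrix.vecMulVec T₁ T₁ - Matrix.vecMulVec T₂ T₂

lemma dotProduct_residualCov (T₁ T₂ t : Emb d) :
    dotProduct (t : Fin d → ℝ) ((residualCov T₁ T₂).mulVec t)
      = ‖t‖ ^ 2 - inner ℝ T₁ t ^ 2 - inner ℝ T₂ t ^ 2 := by
  have h : ∀ T : Emb d, dotProduct (T : Fin d → ℝ) (t : Fin d → ℝ) = inner ℝ T t := by
    intro T
    rw [PiLp.inner_apply, dotProduct]
    exact Finset.sum_congr rfl fun i _ => by simp [mul_comm]
  rw [residualCov, Matrix.sub_mulVec, Matrix.sub_mulVec, Matrix.one_mulVec, dotProduct_sub,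
    dotProduct_sub, Matrix.vecMulVec_mulVec, Matrix.vecMulVec_mulVec]
  simp only [op_smul_eq_smul, dotProduct_smul, smul_eq_mul, h,
    dotProduct_comm (t : Fin d → ℝ) (T₁ : Fin d → ℝ), dotProduct_comm (t : Fin d → ℝ) (T₂ : Fin d → ℝ),
    real_inner_self_eq_norm_sq]
  ring

lemma posSemidef_residualCov {T₁ T₂ : Emb d}
    (hT : ∀ a b : ℝ, ‖a • T₁ + b • T₂‖ ^ 2 ≤ a ^ 2 + b ^ 2) : (residualCov T₁ T₂).PosSemidef := by
  refine Matrix.PosSemidef.of_dotProduct_mulVec_nonneg ?_ fun x => ?_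
  · rw [residualCov]
    refine ((Matrix.isHermitian_one).sub ?_).sub ?_ <;>
    · ext i j; simp [Matrix.vecMulVec_apply, mul_comm]
  · have := dotProduct_residualCov T₁ T₂ (WithLp.toLp 2 x)
    have h2 := inner_sq_add_inner_sq_le hT (WithLp.toLp 2 x)
    simp only [star_trivial]
    simp only at this
    rw [this]
    linarith

/-- With `T` the map of columns `T₁, T₂`, the noise `N(0, T Tᵀ)` coming from the plane and the
independent `N(0, I - T Tᵀ)` add up to `N(0, I)`; this is read off characteristic functions. -/
lemma map_planarGaussian_prod_multivariateGaussian {T₁ T₂ : Emb d}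
    (hT : ∀ a b : ℝ, ‖a • T₁ + b • T₂‖ ^ 2 ≤ a ^ 2 + b ^ 2) (p : ℝ × ℝ) :
    ((planarGaussian p).prod (multivariateGaussian 0 (residualCov T₁ T₂))).map
        (fun w => w.1.1 • T₁ + w.1.2 • T₂ + w.2)
      = (stdGaussian (Emb d)).map (fun z => (p.1 • T₁ + p.2 • T₂) + z) := by
  have : IsFiniteMeasure ((stdGaussian (Emb d)).map (fun z => (p.1 • T₁ + p.2 • T₂) + z)) :=
    Measure.isFiniteMeasure_map _ _
  refine Measure.ext_of_charFun ?_
  ext t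
  rw [charFun_map_const_add, charFun_stdGaussian, charFun_apply,
    integral_map (by fun_prop) (by fun_prop)]
  have e : ∀ w : (ℝ × ℝ) × Emb d,
      Complex.exp (inner ℝ (w.1.1 • T₁ + w.1.2 • T₂ + w.2) t * Complex.I)
        = (Complex.exp ((inner ℝ T₁ t : ℝ) * w.1.1 * Complex.I)
          * Complex.exp ((inner ℝ T₂ t : ℝ) * w.1.2 * Complex.I))
          * Complex.exp (inner ℝ w.2 t * Complex.I) := by
    intro w
    rw [inner_add_left, inner_add_left, real_inner_smul_left, real_inner_smul_left,
      ← Complex.exp_add, ← Complex.exp_add]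
    congr 1
    push_cast
    ring
  simp_rw [e]
  rw [integral_prod_mul (f := fun z : ℝ × ℝ => Complex.exp ((inner ℝ T₁ t : ℝ) * z.1 * Complex.I)
          * Complex.exp ((inner ℝ T₂ t : ℝ) * z.2 * Complex.I))
      (g := fun z : Emb d => Complex.exp (inner ℝ z t * Complex.I)),
    planarGaussian, integral_prod_mul (f := fun z : ℝ => Complex.exp ((inner ℝ T₁ t : ℝ) * z * Complex.I))
      (g := fun z : ℝ => Complex.exp ((inner ℝ T₂ t : ℝ) * z * Complex.I)),
    ← charFun_apply_real, ← charFun_apply_real, ← charFun_apply,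
    charFun_gaussianReal, charFun_gaussianReal, charFun_multivariateGaussian
      (posSemidef_residualCov hT), ← Complex.exp_add, ← Complex.exp_add, ← Complex.exp_add]
  congr 1
  have := dotProduct_residualCov T₁ T₂ t
  rw [this, inner_add_left, real_inner_smul_left, real_inner_smul_left, inner_zero_right]
  push_cast
  ring

lemma map_planarGaussian_eq_isoGaussian {T₁ T₂ : Emb d}
    (hT : ∀ a b : ℝ, ‖a • T₁ + b • T₂‖ ^ 2 ≤ a ^ 2 + b ^ 2) (o : Emb d) (σ : ℝ) (p : ℝ × ℝ) :
    ((planarGaussian p).prod (multivariateGaussian 0 (residualCov T₁ T₂))).map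
        (fun w => o + σ • (w.1.1 • T₁ + w.1.2 • T₂ + w.2))
      = isoGaussian (o + σ • (p.1 • T₁ + p.2 • T₂)) σ := by
  have h := congrArg (Measure.map fun z : Emb d => o + σ • z)
    (map_planarGaussian_prod_multivariateGaussian hT p)
  rw [Measure.map_map (by fun_prop) (by fun_prop), Measure.map_map (by fun_prop) (by fun_prop)] at h
  refine h.trans ?_
  rw [isoGaussian]
  congr 1
  ext1 z
  simp [smul_add, add_assoc]

lemma twoPoint_prod {Ω Ω' : Type*} [MeasurableSpace Ω] [MeasurableSpace Ω'] (q : ℝ)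
    (μ ν : Measure Ω) [SFinite μ] [SFinite ν] (ρ : Measure Ω') [SFinite ρ] :
    (twoPoint q μ ν).prod ρ = twoPoint q (μ.prod ρ) (ν.prod ρ) := by
  simp only [twoPoint]
  rw [Measure.add_prod, Measure.prod_smul_left, Measure.prod_smul_left]

lemma map_twoPoint {Ω Ω' : Type*} [MeasurableSpace Ω] [MeasurableSpace Ω'] (q : ℝ)
    (μ ν : Measure Ω) {f : Ω → Ω'} (hf : Measurable f) :
    (twoPoint q μ ν).map f = twoPoint q (μ.map f) (ν.map f) := by
  simp only [twoPoint]
  rw [Measure.map_add _ _ hf, Measure.map_smul, Measure.map_smul]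

/-- A power bound in the plane carries over to isotropic Gaussians whose means are the images of
the planar means under an affine map with linear part `σ T`, `T` a contraction. -/
lemma PowerBound.isoGaussian_of_planar {α B : ℝ} (hα : 1 < α) {q : ℝ} {x₁ x₂ w : ℝ × ℝ}
    (h : PowerBound α B (twoPoint q (planarGaussian x₁) (planarGaussian w))
      (twoPoint q (planarGaussian x₂) (planarGaussian w))) {T₁ T₂ : Emb d}
    (hT : ∀ a b : ℝ, ‖a • T₁ + b • T₂‖ ^ 2 ≤ a ^ 2 + b ^ 2) {o a₀ a₁ a₂ : Emb d} {σ : ℝ}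
    (h1 : a₁ = o + σ • (x₁.1 • T₁ + x₁.2 • T₂)) (h2 : a₂ = o + σ • (x₂.1 • T₁ + x₂.2 • T₂))
    (h0 : a₀ = o + σ • (w.1 • T₁ + w.2 • T₂)) :
    PowerBound α B (twoPoint q (isoGaussian a₁ σ) (isoGaussian a₀ σ))
      (twoPoint q (isoGaussian a₂ σ) (isoGaussian a₀ σ)) := by
  have hm : Measurable fun w : (ℝ × ℝ) × Emb d => o + σ • (w.1.1 • T₁ + w.1.2 • T₂ + w.2) := by
    fun_prop
  have := (h.prod hα (multivariateGaussian 0 (residualCov T₁ T₂))).map hm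
  rwa [twoPoint_prod, twoPoint_prod, map_twoPoint _ _ _ hm, map_twoPoint _ _ _ hm,
    map_planarGaussian_eq_isoGaussian hT, map_planarGaussian_eq_isoGaussian hT,
    map_planarGaussian_eq_isoGaussian hT, ← h1, ← h2, ← h0] at this

end Channel

/-! ### Exponential growth control, the source of integrability. -/

section ExpControlled

variable {X : Type*} [NormedAddCommGroup X]

/-- Two-sided exponential growth bound: `exp (-L (1 + ‖x‖)) ≤ f x ≤ exp (L (1 + ‖x‖))`. -/
def ExpControlled (L : ℝ) (f : X → ℝ) : Prop :=
  ∀ x, Real.exp (-(L * (1 + ‖x‖))) ≤ f x ∧ f x ≤ Real.exp (L * (1 + ‖x‖))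

/-- All exponential moments of the norm are finite. -/
def HasExpMoments [MeasurableSpace X] (μ : Measure X) : Prop :=
  ∀ K : ℝ, Integrable (fun x => Real.exp (K * ‖x‖)) μ

lemma hasExpMoments_stdNormal : HasExpMoments stdNormal := integrable_exp_abs_stdNormal

lemma hasExpMoments_stdPlanar : HasExpMoments stdPlanar := by
  intro K
  refine (integrable_exp_abs_stdPlanar 1 |K|).mono' (by fun_prop) (.of_forall fun z => ?_)
  rw [Real.norm_of_nonneg (Real.exp_pos _).le, one_mul, Real.exp_le_exp]
  have h1 : ‖z‖ ≤ |z.1| + |z.2| := by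
    rw [Prod.norm_def, Real.norm_eq_abs, Real.norm_eq_abs]
    exact max_le (by linarith [abs_nonneg z.2]) (by linarith [abs_nonneg z.1])
  calc K * ‖z‖ ≤ |K| * ‖z‖ := mul_le_mul_of_nonneg_right (le_abs_self K) (norm_nonneg z)
    _ ≤ _ := mul_le_mul_of_nonneg_left h1 (abs_nonneg K)

namespace ExpControlled

variable {L L' : ℝ} {f g : X → ℝ}

lemma pos (hf : ExpControlled L f) (x : X) : 0 < f x := (Real.exp_pos _).trans_le (hf x).1

lemma nonneg (hf : ExpControlled L f) : 0 ≤ L := by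
  have := Real.exp_le_exp.1 ((hf 0).1.trans (hf 0).2)
  simp only [norm_zero, add_zero, mul_one] at this
  linarith

lemma mono (hf : ExpControlled L f) (h : L ≤ L') : ExpControlled L' f := by
  intro x
  have : L * (1 + ‖x‖) ≤ L' * (1 + ‖x‖) := by gcongr
  exact ⟨(Real.exp_le_exp.2 (by linarith)).trans (hf x).1,
    (hf x).2.trans (Real.exp_le_exp.2 this)⟩

lemma mul (hf : ExpControlled L f) (hg : ExpControlled L' g) :
    ExpControlled (L + L') fun x => f x * g x := by
  intro x
  have h1 := hf.pos x
  have h2 := hg.pos x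
  rw [add_mul, neg_add, Real.exp_add, Real.exp_add]
  exact ⟨mul_le_mul (hf x).1 (hg x).1 (Real.exp_pos _).le h1.le,
    mul_le_mul (hf x).2 (hg x).2 h2.le (Real.exp_pos _).le⟩

/-- The lower bound in the definition is what makes negative exponents harmless: the two sides bound
`|log f|`, which scales by `|β|`. -/
lemma rpow (hf : ExpControlled L f) (β : ℝ) : ExpControlled (|β| * L) fun x => f x ^ β := by
  intro x
  have h1 := hf.pos x
  have hl : |Real.log (f x)| ≤ L * (1 + ‖x‖) := by
    rw [abs_le]
    exact ⟨(Real.le_log_iff_exp_le h1).2 (hf x).1, (Real.log_le_iff_le_exp h1).2 (hf x).2⟩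
  have h2 : |Real.log (f x) * β| ≤ |β| * L * (1 + ‖x‖) := by
    rw [abs_mul, mul_comm, mul_assoc]
    exact mul_le_mul_of_nonneg_left hl (abs_nonneg β)
  simp only [Real.rpow_def_of_pos h1]
  exact ⟨Real.exp_le_exp.2 (abs_le.1 h2).1, Real.exp_le_exp.2 (abs_le.1 h2).2⟩

lemma mix {q : ℝ} (hq : q ∈ Set.Icc (0 : ℝ) 1) (hf : ExpControlled L f) (hg : ExpControlled L g) :
    ExpControlled L fun x => q * f x + (1 - q) * g x := by
  intro x
  have h0 := hq.1
  have h1 := sub_nonneg.2 hq.2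
  constructor
  · nlinarith [mul_le_mul_of_nonneg_left (hf x).1 h0, mul_le_mul_of_nonneg_left (hg x).1 h1]
  · nlinarith [mul_le_mul_of_nonneg_left (hf x).2 h0, mul_le_mul_of_nonneg_left (hg x).2 h1]

lemma const {c : ℝ} (hc : 0 < c) : ExpControlled |Real.log c| fun _ : X => c := by
  intro x
  have h := abs_le.1 (le_refl |Real.log c|)
  have h2 : |Real.log c| ≤ |Real.log c| * (1 + ‖x‖) :=
    le_mul_of_one_le_right (abs_nonneg _) (by linarith [norm_nonneg x])
  refine ⟨(Real.le_log_iff_exp_le hc).1 (by linarith), (Real.log_le_iff_le_exp hc).1 (by linarith)⟩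

lemma comp {Y : Type*} [NormedAddCommGroup Y] (hf : ExpControlled L f) {φ : Y → X}
    (hφ : ∀ y, ‖φ y‖ ≤ ‖y‖) : ExpControlled L fun y => f (φ y) := by
  intro y
  have : L * (1 + ‖φ y‖) ≤ L * (1 + ‖y‖) :=
    mul_le_mul_of_nonneg_left (by linarith [hφ y]) hf.nonneg
  exact ⟨(Real.exp_le_exp.2 (by linarith)).trans (hf _).1,
    (hf _).2.trans (Real.exp_le_exp.2 this)⟩

lemma abs_le (hf : ExpControlled L f) (x : X) :
    ‖f x‖ ≤ Real.exp L * Real.exp (L * ‖x‖) := by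
  rw [Real.norm_of_nonneg (hf.pos x).le, ← Real.exp_add]
  exact (hf x).2.trans_eq (by ring_nf)

lemma integrable [MeasurableSpace X] {μ : Measure X} (hμ : HasExpMoments μ)
    (hf : ExpControlled L f) (hm : AEStronglyMeasurable f μ) : Integrable f μ :=
  ((hμ L).const_mul (Real.exp L)).mono' hm (.of_forall hf.abs_le)

end ExpControlled

lemma expControlled_shiftDensity {L a : ℝ} (ha : |a| ≤ L) :
    ExpControlled (L + L ^ 2) (shiftDensity a) := by
  intro x
  have hL : 0 ≤ L := (abs_nonneg a).trans ha
  have h1 : |a * x| ≤ L * |x| := by rw [abs_mul]; gcongr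
  have h2 : a ^ 2 ≤ L ^ 2 := by rw [← sq_abs]; gcongr
  have h3 := abs_le.1 h1
  rw [Real.norm_eq_abs]
  have h4 : 0 ≤ L ^ 2 * |x| := by positivity
  refine ⟨Real.exp_le_exp.2 ?_, Real.exp_le_exp.2 ?_⟩ <;> nlinarith

lemma expControlled_planarDensity {L : ℝ} {p : ℝ × ℝ} (h1 : |p.1| ≤ L) (h2 : |p.2| ≤ L) :
    ExpControlled (L + L ^ 2 + (L + L ^ 2)) (planarDensity p) :=
  ((expControlled_shiftDensity h1).comp norm_fst_le).mul
    ((expControlled_shiftDensity h2).comp norm_snd_le)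

end ExpControlled

/-! ### The power divergence between two planar mixtures with a common component. -/

section PlanarPower

lemma integral_shiftDensity (p : ℝ) : ∫ x, shiftDensity p x ∂stdNormal = 1 := by
  have := integral_comp_add_stdNormal p fun _ => 1
  simpa using this.symm

lemma integrable_shiftDensity (p : ℝ) : Integrable (shiftDensity p) stdNormal :=
  (expControlled_shiftDensity le_rfl).integrable hasExpMoments_stdNormal
    (by fun_prop)

/-- The density of `q N(x, I) + (1 - q) N(w, I)` with respect to `N(0, I)` in the plane. -/
noncomputable def mixDensity (q : ℝ) (x w z : ℝ × ℝ) : ℝ :=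
  q * planarDensity x z + (1 - q) * planarDensity w z

@[fun_prop]
lemma Continuous.mixDensity {X : Type*} [TopologicalSpace X] {q : ℝ} {f g h : X → ℝ × ℝ}
    (hf : Continuous f) (hg : Continuous g) (hh : Continuous h) :
    Continuous fun x => _root_.mixDensity q (f x) (g x) (h x) := by
  unfold _root_.mixDensity; fun_prop

lemma expControlled_mixDensity {q : ℝ} (hq : q ∈ Set.Icc (0 : ℝ) 1) {L : ℝ} {x w : ℝ × ℝ}
    (hx1 : |x.1| ≤ L) (hx2 : |x.2| ≤ L) (hw1 : |w.1| ≤ L) (hw2 : |w.2| ≤ L) :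
    ExpControlled (L + L ^ 2 + (L + L ^ 2)) (mixDensity q x w) :=
  (expControlled_planarDensity hx1 hx2).mix hq (expControlled_planarDensity hw1 hw2)

lemma mixDensity_pos {q : ℝ} (hq : q ∈ Set.Icc (0 : ℝ) 1) (x w z : ℝ × ℝ) :
    0 < mixDensity q x w z :=
  (expControlled_mixDensity hq (L := |x.1| + |x.2| + |w.1| + |w.2|)
    (by linarith [abs_nonneg x.1, abs_nonneg x.2, abs_nonneg w.1, abs_nonneg w.2])
    (by linarith [abs_nonneg x.1, abs_nonneg x.2, abs_nonneg w.1, abs_nonneg w.2])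
    (by linarith [abs_nonneg x.1, abs_nonneg x.2, abs_nonneg w.1, abs_nonneg w.2])
    (by linarith [abs_nonneg x.1, abs_nonneg x.2, abs_nonneg w.1, abs_nonneg w.2])).pos z

/-- The integrand of the power divergence between two planar mixtures. -/
noncomputable def powerIntegrand (α q : ℝ) (x₁ x₂ w z : ℝ × ℝ) : ℝ :=
  mixDensity q x₁ w z ^ α * mixDensity q x₂ w z ^ (1 - α)

lemma expControlled_powerIntegrand (α : ℝ) {q : ℝ} (hq : q ∈ Set.Icc (0 : ℝ) 1) {L : ℝ}
    {x₁ x₂ w : ℝ × ℝ} (hx : ‖x₁‖ ≤ L) (hx' : ‖x₂‖ ≤ L) (hw : ‖w‖ ≤ L) :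
    ExpControlled (|α| * (L + L ^ 2 + (L + L ^ 2)) + |1 - α| * (L + L ^ 2 + (L + L ^ 2)))
      (powerIntegrand α q x₁ x₂ w) :=
  ((expControlled_mixDensity hq ((norm_fst_le _).trans hx) ((norm_snd_le _).trans hx)
      ((norm_fst_le _).trans hw) ((norm_snd_le _).trans hw)).rpow α).mul
    ((expControlled_mixDensity hq ((norm_fst_le _).trans hx') ((norm_snd_le _).trans hx')
      ((norm_fst_le _).trans hw) ((norm_snd_le _).trans hw)).rpow (1 - α))

lemma Continuous.powerIntegrand {X : Type*} [TopologicalSpace X] (α : ℝ) {q : ℝ}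
    (hq : q ∈ Set.Icc (0 : ℝ) 1) {f g h k : X → ℝ × ℝ} (hf : Continuous f) (hg : Continuous g)
    (hh : Continuous h) (hk : Continuous k) :
    Continuous fun x => _root_.powerIntegrand α q (f x) (g x) (h x) (k x) := by
  unfold _root_.powerIntegrand
  exact ((hf.mixDensity hh hk).rpow_const fun x => .inl (mixDensity_pos hq _ _ _).ne').mul
    ((hg.mixDensity hh hk).rpow_const fun x => .inl (mixDensity_pos hq _ _ _).ne')

lemma integrable_powerIntegrand (α : ℝ) {q : ℝ} (hq : q ∈ Set.Icc (0 : ℝ) 1)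
    (x₁ x₂ w : ℝ × ℝ) : Integrable (powerIntegrand α q x₁ x₂ w) stdPlanar :=
  (expControlled_powerIntegrand α hq (L := ‖x₁‖ + ‖x₂‖ + ‖w‖)
    (by linarith [norm_nonneg x₁, norm_nonneg x₂, norm_nonneg w])
    (by linarith [norm_nonneg x₁, norm_nonneg x₂, norm_nonneg w])
    (by linarith [norm_nonneg x₁, norm_nonneg x₂, norm_nonneg w])).integrable
    hasExpMoments_stdPlanar
    (continuous_const.powerIntegrand α hq continuous_const continuous_const
      continuous_id).aestronglyMeasurable

/-- `∫ P ^ α Q ^ (1 - α)` for `P = q N(x₁, I) + (1 - q) N(w, I)` and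
`Q = q N(x₂, I) + (1 - q) N(w, I)`. -/
noncomputable def planarPower (α q : ℝ) (x₁ x₂ w : ℝ × ℝ) : ℝ :=
  ∫ z, powerIntegrand α q x₁ x₂ w z ∂stdPlanar

lemma twoPoint_planarGaussian {q : ℝ} (hq : q ∈ Set.Icc (0 : ℝ) 1) (x w : ℝ × ℝ) :
    twoPoint q (planarGaussian x) (planarGaussian w)
      = stdPlanar.withDensity fun z => ENNReal.ofReal (mixDensity q x w z) := by
  rw [twoPoint, planarGaussian_eq_withDensity, planarGaussian_eq_withDensity,
    ← withDensity_smul _ (by fun_prop), ← withDensity_smul _ (by fun_prop),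
    ← withDensity_add_left (by fun_prop)]
  congr 1
  ext z
  simp only [Pi.add_apply, Pi.smul_apply, smul_eq_mul, mixDensity]
  rw [ENNReal.ofReal_add (mul_nonneg hq.1 (planarDensity_pos _ _).le)
    (mul_nonneg (sub_nonneg.2 hq.2) (planarDensity_pos _ _).le), ENNReal.ofReal_mul hq.1,
    ENNReal.ofReal_mul (sub_nonneg.2 hq.2)]

lemma integrable_mixDensity {q : ℝ} (hq : q ∈ Set.Icc (0 : ℝ) 1) (x w : ℝ × ℝ) :
    Integrable (mixDensity q x w) stdPlanar := by
  have := integrable_powerIntegrand 1 hq x x w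
  refine this.congr (.of_forall fun z => ?_)
  simp [powerIntegrand]

lemma powerBound_planar {α B q : ℝ} (hα : 1 < α) (hq : q ∈ Set.Icc (0 : ℝ) 1)
    {x₁ x₂ w : ℝ × ℝ} (hB : planarPower α q x₁ x₂ w ≤ B) :
    PowerBound α B (twoPoint q (planarGaussian x₁) (planarGaussian w))
      (twoPoint q (planarGaussian x₂) (planarGaussian w)) := by
  rw [twoPoint_planarGaussian hq, twoPoint_planarGaussian hq]
  exact powerBound_withDensity hα (by fun_prop) (by fun_prop)
    (fun z => (mixDensity_pos hq _ _ z).le) (mixDensity_pos hq _ _) (integrable_mixDensity hq _ _)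
    (integrable_mixDensity hq _ _) (integrable_powerIntegrand α hq _ _ _) hB

lemma shiftDensity_add (a p s : ℝ) :
    shiftDensity (a + p) s = shiftDensity p s * shiftDensity a (s - p) := by
  simp only [shiftDensity, ← Real.exp_add]
  congr 1
  ring

lemma planarDensity_add (a p z : ℝ × ℝ) :
    planarDensity (a + p) z = planarDensity p z * planarDensity a (z - p) := by
  simp only [planarDensity, Prod.fst_add, Prod.snd_add, Prod.fst_sub, Prod.snd_sub,
    shiftDensity_add]
  ring

lemma mul_rpow_mul_rpow_one_sub {c x y : ℝ} (hc : 0 < c) (hx : 0 ≤ x) (hy : 0 ≤ y) (α : ℝ) :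
    (c * x) ^ α * (c * y) ^ (1 - α) = c * (x ^ α * y ^ (1 - α)) := by
  rw [Real.mul_rpow hc.le hx, Real.mul_rpow hc.le hy]
  have : c ^ α * c ^ (1 - α) = c := by rw [← Real.rpow_add hc]; simp
  calc _ = (c ^ α * c ^ (1 - α)) * (x ^ α * y ^ (1 - α)) := by ring
    _ = _ := by rw [this]

lemma powerIntegrand_add (α : ℝ) {q : ℝ} (hq : q ∈ Set.Icc (0 : ℝ) 1) (x₁ x₂ w p z : ℝ × ℝ) :
    powerIntegrand α q (x₁ + p) (x₂ + p) (w + p) z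
      = planarDensity p z * powerIntegrand α q x₁ x₂ w (z - p) := by
  have h : ∀ x, mixDensity q (x + p) (w + p) z = planarDensity p z * mixDensity q x w (z - p) := by
    intro x
    simp only [mixDensity, planarDensity_add]
    ring
  rw [powerIntegrand, h, h, mul_rpow_mul_rpow_one_sub (planarDensity_pos _ _)
    (mixDensity_pos hq _ _ _).le (mixDensity_pos hq _ _ _).le, powerIntegrand]

/-- Translating all means multiplies both densities by one factor, which the homogeneity of the
perspective pulls out and the shift of the reference Gaussian absorbs. -/
lemma planarPower_add (α : ℝ) {q : ℝ} (hq : q ∈ Set.Icc (0 : ℝ) 1) (x₁ x₂ w p : ℝ × ℝ) :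
    planarPower α q (x₁ + p) (x₂ + p) (w + p) = planarPower α q x₁ x₂ w := by
  have := integral_comp_add_stdPlanar p fun z => powerIntegrand α q x₁ x₂ w (z - p)
  simp only [add_sub_cancel_right] at this
  simp only [planarPower, powerIntegrand_add α hq]
  exact this.symm

end PlanarPower

/-! ### Reflection of the common component. -/

section Swap

/-- Both sides vanish at `1`, and the derivative of the difference is `α (α - 1) (x - 1) (x ^ (α -
2) - x ^ (-α - 1))`. -/
lemma rpow_sub_rpow_neg_mono {α t : ℝ} (hα : 1 < α) (ht : 1 ≤ t) :
    α * (t ^ (α - 1) - t ^ (1 - α)) ≤ (α - 1) * (t ^ α - t ^ (-α)) := by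
  let k : ℝ → ℝ := fun t => (α - 1) * (t ^ α - t ^ (-α)) - α * (t ^ (α - 1) - t ^ (1 - α))
  have hd : ∀ x : ℝ, 0 < x → HasDerivAt k
      ((α - 1) * (α * x ^ (α - 1) - -α * x ^ (-α - 1))
        - α * ((α - 1) * x ^ (α - 1 - 1) - (1 - α) * x ^ (1 - α - 1))) x := by
    intro x hx
    have h : ∀ β : ℝ, HasDerivAt (fun t : ℝ => t ^ β) (β * x ^ (β - 1)) x := fun β =>
      Real.hasDerivAt_rpow_const (.inl hx.ne')
    exact (((h α).sub (h (-α))).const_mul _).sub (((h (α - 1)).sub (h (1 - α))).const_mul _)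
  have hmono : MonotoneOn k (Set.Ici 1) := by
    refine monotoneOn_of_deriv_nonneg (convex_Ici 1) ?_ ?_ ?_
    · exact fun x hx => (hd x (zero_lt_one.trans_le hx)).continuousAt.continuousWithinAt
    · rw [interior_Ici]
      exact fun x hx => (hd x (zero_lt_one.trans hx)).differentiableAt.differentiableWithinAt
    · rw [interior_Ici]
      intro x hx
      have hx1 : 1 < x := hx
      have hx0 : 0 < x := zero_lt_one.trans hx1
      rw [(hd x hx0).deriv]
      have e1 : x ^ (α - 1) = x ^ (α - 2) * x := by
        rw [← Real.rpow_add_one hx0.ne']; ring_nf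
      have e2 : x ^ (1 - α - 1) = x ^ (-α - 1) * x := by
        rw [← Real.rpow_add_one hx0.ne']; ring_nf
      have e3 : x ^ (α - 1 - 1) = x ^ (α - 2) := by ring_nf
      have h1 : x ^ (-α - 1) ≤ x ^ (α - 2) :=
        Real.rpow_le_rpow_of_exponent_le hx1.le (by linarith)
      rw [e1, e2, e3]
      have : 0 ≤ α * (α - 1) * ((x - 1) * (x ^ (α - 2) - x ^ (-α - 1))) :=
        mul_nonneg (mul_nonneg (by linarith) (by linarith))
          (mul_nonneg (by linarith) (by linarith))
      linarith
  have := hmono (Set.self_mem_Ici) ht ht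
  simp only [k, Real.one_rpow] at this
  linarith

/-- The excess of the perspective of the power function over its swap decreases when a common
amount is added to both arguments. -/
lemma antitone_perspective_sub_swap {α A B : ℝ} (hα : 1 < α) (hB : 0 < B) (hAB : B ≤ A) :
    AntitoneOn (fun c : ℝ => (A + c) ^ α * (B + c) ^ (1 - α) - (B + c) ^ α * (A + c) ^ (1 - α))
      (Set.Ici 0) := by
  have hA : 0 < A := hB.trans_le hAB
  have hd : ∀ c : ℝ, 0 ≤ c → HasDerivAt
      (fun c : ℝ => (A + c) ^ α * (B + c) ^ (1 - α) - (B + c) ^ α * (A + c) ^ (1 - α))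
      ((1 * α * (A + c) ^ (α - 1) * (B + c) ^ (1 - α)
          + (A + c) ^ α * (1 * (1 - α) * (B + c) ^ (1 - α - 1)))
        - (1 * α * (B + c) ^ (α - 1) * (A + c) ^ (1 - α)
          + (B + c) ^ α * (1 * (1 - α) * (A + c) ^ (1 - α - 1)))) c := by
    intro c hc
    have h : ∀ D β : ℝ, 0 < D →
        HasDerivAt (fun c : ℝ => (D + c) ^ β) (1 * β * (D + c) ^ (β - 1)) c := fun D β hD =>
      ((hasDerivAt_id c).const_add D).rpow_const (.inl (by simp only [id]; positivity))
    exact ((h A α hA).mul (h B (1 - α) hB)).sub ((h B α hB).mul (h A (1 - α) hA))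
  refine antitoneOn_of_deriv_nonpos (convex_Ici 0)
    (fun c hc => (hd c hc).continuousAt.continuousWithinAt) ?_ ?_
  · rw [interior_Ici]
    exact fun c hc => (hd c (le_of_lt hc)).differentiableAt.differentiableWithinAt
  · rw [interior_Ici]
    intro c hc
    have hc0 : 0 < c := hc
    rw [(hd c hc0.le).deriv]
    set x := A + c
    set y := B + c
    have hy : 0 < y := by positivity
    have hx : 0 < x := by positivity
    have ht : 1 ≤ x / y := (one_le_div hy).2 (by simp only [x, y]; linarith)
    -- The derivative is homogeneous of degree zero in `x` and `y`, so its sign depends only on `x /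
    -- y`.
    have key := rpow_sub_rpow_neg_mono hα ht
    have e : ∀ β : ℝ, (x / y) ^ β = x ^ β * y ^ (-β) := fun β => by
      rw [Real.div_rpow hx.le hy.le, Real.rpow_neg hy.le, div_eq_mul_inv]
    rw [e, e, e, e] at key
    ring_nf at key ⊢
    linarith

/-- Reflecting the common component away from the first mean decreases the power divergence. -/
lemma planarPower_swap {α q h κ τ : ℝ} (hα : 1 < α) (hq : q ∈ Set.Ioo (0 : ℝ) 1) (hh : 0 ≤ h)
    (hκ : 0 ≤ κ) :
    planarPower α q (h, 0) (-h, 0) (κ, τ) ≤ planarPower α q (h, 0) (-h, 0) (-κ, τ) := by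
  have hq' : q ∈ Set.Icc (0 : ℝ) 1 := ⟨hq.1.le, hq.2.le⟩
  have hq1 : 0 < 1 - q := sub_pos.2 hq.2
  -- Folding the plane along the reflection of the first coordinate pairs the integrand with its
  -- swapped version, so that the comparison becomes pointwise: at each `z` the larger of the two
  -- common densities goes with the smaller excess.
  have sym : ∀ κ : ℝ, 2 * planarPower α q (h, 0) (-h, 0) (κ, τ)
      = ∫ z, (powerIntegrand α q (h, 0) (-h, 0) (κ, τ) z
        + powerIntegrand α q (-h, 0) (h, 0) (-κ, τ) z) ∂stdPlanar := by
    intro κ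
    have e : ∀ z : ℝ × ℝ, powerIntegrand α q (-h, 0) (h, 0) (-κ, τ) z
        = powerIntegrand α q (h, 0) (-h, 0) (κ, τ) (-z.1, z.2) := by
      intro z
      simp [powerIntegrand, mixDensity, planarDensity, shiftDensity]
    rw [integral_add (integrable_powerIntegrand α hq' _ _ _)
      (integrable_powerIntegrand α hq' _ _ _)]
    simp_rw [e]
    rw [integral_comp_neg_fst_stdPlanar, planarPower]
    ring
  have key : 2 * planarPower α q (h, 0) (-h, 0) (κ, τ)
      ≤ 2 * planarPower α q (h, 0) (-h, 0) (-κ, τ) := by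
    rw [sym, sym, neg_neg]
    refine integral_mono ((integrable_powerIntegrand α hq' _ _ _).add
      (integrable_powerIntegrand α hq' _ _ _)) ((integrable_powerIntegrand α hq' _ _ _).add
      (integrable_powerIntegrand α hq' _ _ _)) fun z => ?_
    simp only [powerIntegrand, mixDensity]
    have pos := planarDensity_pos
    have cmp : ∀ a b c d : ℝ, a * z.1 ≤ b * z.1 → a ^ 2 = b ^ 2 → c = d →
        planarDensity (a, c) z ≤ planarDensity (b, d) z := by
      intro a b c d h1 h2 h3
      subst h3
      refine mul_le_mul_of_nonneg_right (Real.exp_le_exp.2 ?_) (shiftDensity_pos _ _).le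
      simp only
      linarith
    have mem : ∀ p : ℝ × ℝ, (1 - q) * planarDensity p z ∈ Set.Ici (0 : ℝ) := fun p =>
      (mul_pos hq1 (pos p z)).le
    rcases le_total 0 z.1 with hz | hz
    · have := antitone_perspective_sub_swap hα (mul_pos hq.1 (pos (-h, 0) z))
        (mul_le_mul_of_nonneg_left (cmp (-h) h 0 0 (by nlinarith) (by ring) rfl) hq.1.le)
        (mem (-κ, τ)) (mem (κ, τ))
        (mul_le_mul_of_nonneg_left (cmp (-κ) κ τ τ (by nlinarith) (by ring) rfl) hq1.le)
      simp only at this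
      linarith
    · have := antitone_perspective_sub_swap hα (mul_pos hq.1 (pos (h, 0) z))
        (mul_le_mul_of_nonneg_left (cmp h (-h) 0 0 (by nlinarith) (by ring) rfl) hq.1.le)
        (mem (κ, τ)) (mem (-κ, τ))
        (mul_le_mul_of_nonneg_left (cmp κ (-κ) τ τ (by nlinarith) (by ring) rfl) hq1.le)
      simp only at this
      linarith
  linarith

end Swap

/-! ### The one-sided power divergence as a function of weight and distance. -/

section GaussianPower

/-- Both laws are centered Gaussians of variance `r ^ 2`. Hence a product of two likelihood ratios
depends in law only on the length of the planar shift. -/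
lemma map_linear_stdPlanar (a b : ℝ) {r : ℝ} (h : a ^ 2 + b ^ 2 = r ^ 2) :
    stdPlanar.map (fun z => a * z.1 + b * z.2) = stdNormal.map (fun x => r * x) := by
  have h1 := gaussianReal_map_const_mul (μ := 0) (v := 1) a
  have h2 := gaussianReal_map_const_mul (μ := 0) (v := 1) b
  have h3 := gaussianReal_map_const_mul (μ := 0) (v := 1) r
  rw [mul_zero, mul_one] at h1 h2 h3
  rw [h3]
  have h4 : (stdPlanar.map (Prod.map (fun x => a * x) (fun x => b * x))).map
      (fun z => z.1 + z.2) = stdPlanar.map (fun z => a * z.1 + b * z.2) := by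
    rw [Measure.map_map (by fun_prop) (by fun_prop)]
    rfl
  rw [← h4, stdPlanar, ← Measure.map_prod_map _ _ (by fun_prop) (by fun_prop), h1, h2]
  have h5 := gaussianReal_conv_gaussianReal (m₁ := 0) (m₂ := 0) (v₁ := .mk (a ^ 2) (sq_nonneg _))
    (v₂ := .mk (b ^ 2) (sq_nonneg _))
  rw [Measure.conv, add_zero] at h5
  rw [h5]
  congr 1
  exact NNReal.eq h

lemma integral_shiftDensity_mul_shiftDensity {f : ℝ → ℝ} (hf : Measurable f) {a b r : ℝ}
    (h : a ^ 2 + b ^ 2 = r ^ 2) :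
    ∫ z, f (shiftDensity a z.1 * shiftDensity b z.2) ∂stdPlanar
      = ∫ x, f (shiftDensity r x) ∂stdNormal := by
  have hm : Measurable fun x => f (Real.exp (x - r ^ 2 / 2)) := by fun_prop
  have e := congrArg (fun μ => ∫ x, f (Real.exp (x - r ^ 2 / 2)) ∂μ) (map_linear_stdPlanar a b h)
  rw [integral_map (by fun_prop) hm.aestronglyMeasurable,
    integral_map (by fun_prop) hm.aestronglyMeasurable] at e
  refine Eq.trans (integral_congr_ae (.of_forall fun z => ?_)) e
  simp only [shiftDensity, ← Real.exp_add, ← h]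
  ring_nf

/-- `∫ (q dN(r, 1)/dN(0, 1) + 1 - q) ^ α ∂N(0, 1)`. -/
noncomputable def gaussianPower (α q r : ℝ) : ℝ :=
  ∫ x, (q * shiftDensity r x + (1 - q)) ^ α ∂stdNormal

lemma expControlled_one {X : Type*} [NormedAddCommGroup X] {L : ℝ} (hL : 0 ≤ L) :
    ExpControlled L fun _ : X => (1 : ℝ) :=
  (ExpControlled.const one_pos).mono (by simpa)

lemma expControlled_mix_one {q : ℝ} (hq : q ∈ Set.Icc (0 : ℝ) 1) (r : ℝ) :
    ExpControlled (|r| + |r| ^ 2) fun x => q * shiftDensity r x + (1 - q) := by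
  have := (expControlled_shiftDensity (le_refl |r|)).mix hq
    (expControlled_one (X := ℝ) (L := |r| + |r| ^ 2) (by positivity))
  simpa using this

lemma integrable_gaussianPower (α : ℝ) {q : ℝ} (hq : q ∈ Set.Icc (0 : ℝ) 1) (r : ℝ) :
    Integrable (fun x => (q * shiftDensity r x + (1 - q)) ^ α) stdNormal :=
  ((expControlled_mix_one hq r).rpow α).integrable hasExpMoments_stdNormal
    (Measurable.aestronglyMeasurable (by fun_prop))

/-- Tangent line inequality for the convex function `x ^ α`. -/
lemma tangent_rpow {α x t : ℝ} (hα : 1 < α) (hx : 0 ≤ x) (ht : 0 < t) :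
    t ^ α + α * t ^ (α - 1) * (x - t) ≤ x ^ α := by
  have := tangent_perspective hα hx one_pos ht.le
  rw [Real.one_rpow, mul_one] at this
  have e : t ^ (α - 1) * t = t ^ α := by rw [← Real.rpow_add_one ht.ne']; ring_nf
  linear_combination this - α * e

/-- `gaussianPower` increases with the weight of the shifted component. -/
lemma gaussianPower_mono_weight {α q q' : ℝ} (hα : 1 < α) (hq : 0 ≤ q) (hqq : q ≤ q')
    (hq' : q' ≤ 1) (r : ℝ) : gaussianPower α q r ≤ gaussianPower α q' r := by
  have m : q ∈ Set.Icc (0 : ℝ) 1 := ⟨hq, hqq.trans hq'⟩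
  have m' : q' ∈ Set.Icc (0 : ℝ) 1 := ⟨hq.trans hqq, hq'⟩
  have i1 := integrable_gaussianPower α m r
  have i2 := integrable_gaussianPower α m' r
  have i3 : Integrable (fun x => α * (q' - q) * (shiftDensity r x - 1)) stdNormal :=
    ((integrable_shiftDensity r).sub (integrable_const 1)).const_mul _
  have h3 : ∫ x, α * (q' - q) * (shiftDensity r x - 1) ∂stdNormal = 0 := by
    rw [integral_const_mul, integral_sub (integrable_shiftDensity r) (integrable_const 1),
      integral_shiftDensity]
    simp
  have : ∫ x, ((q * shiftDensity r x + (1 - q)) ^ α + α * (q' - q) * (shiftDensity r x - 1))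
      ∂stdNormal ≤ ∫ x, (q' * shiftDensity r x + (1 - q')) ^ α ∂stdNormal := by
    refine integral_mono (i1.add i3) i2 fun x => ?_
    have p1 := (expControlled_mix_one m r).pos x
    have p2 := (expControlled_mix_one m' r).pos x
    have key := tangent_rpow hα p2.le p1
    set X := shiftDensity r x
    refine le_trans ?_ key
    -- The slope of the tangent increases with `X`, hence is positively correlated with `X - 1`,
    -- which has mean zero.
    have h1 : X - 1 ≤ (q * X + (1 - q)) ^ (α - 1) * (X - 1) := by
      rcases le_total 1 X with h | h
      · have : 1 ≤ (q * X + (1 - q)) ^ (α - 1) :=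
          Real.one_le_rpow (by nlinarith) (by linarith)
        nlinarith
      · have : (q * X + (1 - q)) ^ (α - 1) ≤ 1 :=
          Real.rpow_le_one p1.le (by nlinarith) (by linarith)
        nlinarith
    have h2 := mul_le_mul_of_nonneg_left h1
      (mul_nonneg (by linarith : (0 : ℝ) ≤ α) (sub_nonneg.2 hqq))
    nlinarith
  rw [integral_add i1 i3, h3, add_zero] at this
  exact this

lemma gaussianPower_nonneg (α : ℝ) {q : ℝ} (hq : q ∈ Set.Icc (0 : ℝ) 1) (r : ℝ) :
    0 ≤ gaussianPower α q r :=
  integral_nonneg fun x => Real.rpow_nonneg ((expControlled_mix_one hq r).pos x).le _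

lemma one_le_gaussianPower {α q : ℝ} (hα : 1 < α) (hq : q ∈ Set.Icc (0 : ℝ) 1) (r : ℝ) :
    1 ≤ gaussianPower α q r := by
  have := gaussianPower_mono_weight hα le_rfl hq.1 hq.2 r
  simpa [gaussianPower] using this

/-- The ratio at distance `r'` has the law of the ratio at distance `r` times an independent ratio
of mean one at distance `√(r' ^ 2 - r ^ 2)`; Jensen's inequality in the second factor, in tangent
form, gives the comparison. -/
lemma gaussianPower_mono {α q r r' : ℝ} (hα : 1 < α) (hq : q ∈ Set.Icc (0 : ℝ) 1) (hr : 0 ≤ r)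
    (hrr : r ≤ r') : gaussianPower α q r ≤ gaussianPower α q r' := by
  have hd : r ^ 2 + √(r' ^ 2 - r ^ 2) ^ 2 = r' ^ 2 := by
    rw [Real.sq_sqrt (by nlinarith)]; ring
  set b := √(r' ^ 2 - r ^ 2)
  have e := integral_shiftDensity_mul_shiftDensity (f := fun t => (q * t + (1 - q)) ^ α)
    (by fun_prop) hd
  have c : ExpControlled (|r| + |r| ^ 2 + (|b| + |b| ^ 2))
      fun z : ℝ × ℝ => q * (shiftDensity r z.1 * shiftDensity b z.2) + (1 - q) := by
    have h1 := ((expControlled_shiftDensity (le_refl |r|)).comp (Y := ℝ × ℝ) norm_fst_le).mul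
      ((expControlled_shiftDensity (le_refl |b|)).comp (Y := ℝ × ℝ) norm_snd_le)
    simpa using h1.mix hq (expControlled_one (X := ℝ × ℝ)
      (L := |r| + |r| ^ 2 + (|b| + |b| ^ 2)) (by positivity))
  have i := (c.rpow α).integrable hasExpMoments_stdPlanar
    (Measurable.aestronglyMeasurable (by fun_prop))
  rw [gaussianPower, gaussianPower, ← e, integral_prod _ i]
  refine integral_mono (integrable_gaussianPower α hq r) i.integral_prod_left fun x => ?_
  simp only
  set t := q * shiftDensity r x + (1 - q)
  have ht : 0 < t := (expControlled_mix_one hq r).pos x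
  have hb := integrable_shiftDensity b
  have ib : Integrable (fun y => α * t ^ (α - 1) * (q * shiftDensity r x * (shiftDensity b y - 1)))
      stdNormal := ((hb.sub (integrable_const 1)).const_mul _).const_mul _
  have hi : ∫ y, (t ^ α + α * t ^ (α - 1) * (q * shiftDensity r x * (shiftDensity b y - 1)))
      ∂stdNormal = t ^ α := by
    rw [integral_add (integrable_const _) ib,
      integral_const_mul, integral_const_mul, integral_sub hb (integrable_const 1),
      integral_shiftDensity]
    simp
  rw [← hi]
  have hci : Integrable (fun y => (q * (shiftDensity r x * shiftDensity b y) + (1 - q)) ^ α)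
      stdNormal := by
    have h1 := (ExpControlled.const (X := ℝ) (shiftDensity_pos r x)).mul
      (expControlled_shiftDensity (le_refl |b|))
    have h2 := h1.mix hq (expControlled_one (X := ℝ) h1.nonneg)
    simp only [mul_one] at h2
    exact (h2.rpow α).integrable hasExpMoments_stdNormal
      (Measurable.aestronglyMeasurable (by fun_prop))
  refine integral_mono ((integrable_const _).add ib) hci fun y => ?_
  have := tangent_rpow hα (c.pos (x, y)).le ht
  refine le_trans (le_of_eq ?_) this
  simp only [t]
  ring

end GaussianPower

/-! ### Right angle at the second mean. -/

section RightAngle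

/-- In a right-angled configuration the power divergence is at most the one-sided power divergence
at distance the length of the hypotenuse. -/
lemma planarPower_rightAngle_le {α q h τ r : ℝ} (hα : 1 < α) (hq : q ∈ Set.Ioo (0 : ℝ) 1)
    (hr : (2 * h) ^ 2 + τ ^ 2 = r ^ 2) :
    planarPower α q (h, 0) (-h, 0) (-h, τ) ≤ gaussianPower α q r := by
  have hq' : q ∈ Set.Icc (0 : ℝ) 1 := ⟨hq.1.le, hq.2.le⟩
  have hq1 : 0 < 1 - q := sub_pos.2 hq.2
  have htrans : planarPower α q (h, 0) (-h, 0) (-h, τ)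
      = planarPower α q (2 * h, 0) (0, 0) (0, τ) := by
    rw [← planarPower_add α hq' (2 * h, 0) (0, 0) (0, τ) (-h, 0)]
    simp only [Prod.mk_add_mk, add_zero, zero_add]
    ring_nf
  rw [htrans]
  set P : ℝ × ℝ → ℝ := mixDensity q (2 * h, 0) (0, τ) with hP
  let C : ℝ → ℝ := shiftDensity τ
  let Q : ℝ → ℝ := fun y => q + (1 - q) * C y
  have hPe : ∀ z, P z = q * shiftDensity (2 * h) z.1 + (1 - q) * C z.2 := by
    intro z; simp [hP, mixDensity, planarDensity, C]
  have hPpos : ∀ z, 0 < P z := mixDensity_pos hq' _ _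
  have hCpos : ∀ y, 0 < C y := shiftDensity_pos τ
  have hQpos : ∀ y, 0 < Q y := fun y => add_pos hq.1 (mul_pos hq1 (hCpos y))
  have hQe : ∀ z : ℝ × ℝ, mixDensity q (0, 0) (0, τ) z = Q z.2 := by
    intro z; simp [mixDensity, planarDensity, Q, C]
  -- the one-sided functional
  have iPC : Integrable (fun z : ℝ × ℝ => P z ^ α * C z.2 ^ (1 - α)) stdPlanar := by
    refine Integrable.congr ?_ (.of_forall fun z => rfl)
    refine (((expControlled_mixDensity hq' (L := |2 * h| + |τ|) ?_ ?_ ?_ ?_).rpow α).mul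
      (((expControlled_shiftDensity (le_refl |τ|)).comp (Y := ℝ × ℝ) norm_snd_le).rpow
        (1 - α))).integrable hasExpMoments_stdPlanar ?_
    any_goals simp
    any_goals positivity
    refine Measurable.aestronglyMeasurable ?_
    have : Measurable P := by rw [hP]; fun_prop
    simp only [C]
    fun_prop
  -- Here `C` is the density of the common component. Seen from its mean, `P / C` is `1 - q` plus
  -- `q` times the likelihood ratio of a shift of length `r`.
  have hG : ∫ z : ℝ × ℝ, P z ^ α * C z.2 ^ (1 - α) ∂stdPlanar = gaussianPower α q r := by
    have h1 := integral_comp_add_stdPlanar (0, τ) fun z => (P z / C z.2) ^ α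
    have h2 := integral_shiftDensity_mul_shiftDensity (f := fun t => (q * t + (1 - q)) ^ α)
      (by fun_prop) (a := 2 * h) (b := -τ) (r := r) (by rw [neg_sq, hr])
    rw [gaussianPower, ← h2]
    refine Eq.trans (integral_congr_ae (.of_forall fun z => ?_)) (h1.symm.trans
      (integral_congr_ae (.of_forall fun z => ?_)))
    · simp only [planarDensity, shiftDensity_zero, one_mul]
      rw [← div_rpow_mul_self (hPpos z).le (hCpos z.2)]
      simp only [C]
      ring
    · simp only
      congr 1
      rw [hPe]
      have : C (z + (0, τ)).2 * shiftDensity (-τ) z.2 = 1 := by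
        simp only [C, shiftDensity, ← Real.exp_add, Prod.snd_add]
        rw [Real.exp_eq_one_iff]
        ring
      have h0 := (hCpos (z + (0, τ)).2).ne'
      rw [eq_comm, eq_div_iff h0]
      simp only [Prod.fst_add, add_zero]
      linear_combination (q * shiftDensity (2 * h) z.1) * this
  rw [← hG, planarPower]
  have iPQ := integrable_powerIntegrand α hq' (2 * h, 0) (0, 0) (0, τ)
  have iD : Integrable (fun z : ℝ × ℝ => P z ^ α * C z.2 ^ (1 - α)
    - powerIntegrand α q (2 * h, 0) (0, 0) (0, τ) z) stdPlanar := iPC.sub iPQ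
  rw [← sub_nonneg, ← integral_sub iPC iPQ, integral_prod_symm _ iD]
  -- Thanks to the right angle `Q` depends on `y` alone, so on each slice `P / Q` is a
  -- one-dimensional mixture with weight `q / Q y`.
  have inner : ∀ y, ∫ s, (P (s, y) ^ α * C y ^ (1 - α)
      - powerIntegrand α q (2 * h, 0) (0, 0) (0, τ) (s, y)) ∂stdNormal
      = (Q y ^ α * C y ^ (1 - α) - Q y) * gaussianPower α (q / Q y) (2 * h) := by
    intro y
    rw [gaussianPower, ← integral_const_mul]
    refine integral_congr_ae (.of_forall fun s => ?_)
    have e : P (s, y) = Q y * (q / Q y * shiftDensity (2 * h) s + (1 - q / Q y)) := by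
      rw [hPe]
      have := (hQpos y).ne'
      field_simp
      simp only [Q]
      ring
    have hb : 0 ≤ q / Q y * shiftDensity (2 * h) s + (1 - q / Q y) := by
      have := hPpos (s, y)
      rw [e] at this
      exact (pos_of_mul_pos_right this (hQpos y).le).le
    have h1 : Q y ^ α * Q y ^ (1 - α) = Q y := by
      rw [← Real.rpow_add (hQpos y)]; simp
    simp only [powerIntegrand, hQe]
    rw [← hP, e, Real.mul_rpow (hQpos y).le hb]
    linear_combination (-(q / Q y * shiftDensity (2 * h) s + (1 - q / Q y)) ^ α) * h1
  have iout := iD.integral_prod_right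
  have cC := expControlled_shiftDensity (le_refl |τ|)
  have cQ : ExpControlled (|τ| + |τ| ^ 2) Q := by
    have := (expControlled_one (X := ℝ) cC.nonneg).mix hq' cC
    simpa only [mul_one] using this
  have hQm : Measurable Q := by simp only [Q, C]; fun_prop
  have iQC : Integrable (fun y => Q y ^ α * C y ^ (1 - α)) stdNormal :=
    ((cQ.rpow α).mul (cC.rpow (1 - α))).integrable hasExpMoments_stdNormal
      (Measurable.aestronglyMeasurable (by simp only [C]; fun_prop))
  have iQ : Integrable Q stdNormal := cQ.integrable hasExpMoments_stdNormal hQm.aestronglyMeasurable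
  have iC : Integrable C stdNormal := integrable_shiftDensity τ
  have hEQ : ∫ y, (α - 1) * (Q y - C y) ∂stdNormal = 0 := by
    have : ∀ y, (α - 1) * (Q y - C y) = (α - 1) * (q * (1 - C y)) := fun y => by
      simp only [Q]; ring
    simp_rw [this]
    rw [integral_const_mul, integral_const_mul, integral_sub (integrable_const 1) iC,
      integral_shiftDensity]
    simp
  set J := gaussianPower α q (2 * h) with hJ
  have hJ0 : 0 ≤ J := gaussianPower_nonneg α hq' _
  -- The slice integral is bounded below by a function of mean zero, since `Q` and `C` both
  -- integrate to one.
  have low : 0 = ∫ y, J * ((α - 1) * (Q y - C y)) ∂stdNormal := by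
    rw [integral_const_mul, hEQ, mul_zero]
  refine low.trans_le (integral_mono (((iQ.sub iC).const_mul _).const_mul J) iout fun y => ?_)
  refine le_of_le_of_eq ?_ (inner y).symm
  have tan := tangent_perspective hα (hQpos y).le (hCpos y) zero_le_one
  simp only [Real.one_rpow, mul_one] at tan
  have h1 : J * ((α - 1) * (Q y - C y)) ≤ J * (Q y ^ α * C y ^ (1 - α) - Q y) :=
    mul_le_mul_of_nonneg_left (by linarith) hJ0
  refine h1.trans ?_
  have fac : Q y ^ α * C y ^ (1 - α) - Q y = Q y * ((Q y / C y) ^ (α - 1) - 1) := by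
    rw [Real.div_rpow (hQpos y).le (hCpos y).le, Real.rpow_sub (hQpos y), Real.rpow_one,
      show 1 - α = -(α - 1) by ring, Real.rpow_neg (hCpos y).le]
    have := (hQpos y).ne'
    field_simp
  rw [fac, mul_comm J]
  -- The bracket is nonnegative when `C ≤ 1`, where `q / Q ≥ q`, and nonpositive when `C ≥ 1`, where
  -- `q / Q ≤ q`; monotonicity in the weight allows replacing `q / Q` by `q` in either case.
  rcases le_total (C y) 1 with hc | hc
  · have hQ1 : Q y ≤ 1 := by simp only [Q]; nlinarith
    have h2 : J ≤ gaussianPower α (q / Q y) (2 * h) := by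
      refine gaussianPower_mono_weight hα hq'.1 ?_ ?_ _
      · rw [le_div_iff₀ (hQpos y)]; nlinarith [hq.1]
      · rw [div_le_one (hQpos y)]; simp only [Q]; nlinarith [mul_pos hq1 (hCpos y)]
    refine mul_le_mul_of_nonneg_left h2 (mul_nonneg (hQpos y).le (sub_nonneg.2 ?_))
    refine Real.one_le_rpow ?_ (by linarith)
    rw [one_le_div (hCpos y)]
    simp only [Q]; nlinarith [hq.1]
  · have hQ1 : 1 ≤ Q y := by simp only [Q]; nlinarith
    have h2 : gaussianPower α (q / Q y) (2 * h) ≤ J := by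
      refine gaussianPower_mono_weight hα (div_nonneg hq'.1 (hQpos y).le) ?_ hq'.2 _
      rw [div_le_iff₀ (hQpos y)]; nlinarith [hq.1]
    refine mul_le_mul_of_nonpos_left h2 (mul_nonpos_of_nonneg_of_nonpos (hQpos y).le
      (sub_nonpos.2 ?_))
    refine Real.rpow_le_one (div_pos (hQpos y) (hCpos y)).le ?_ (by linarith)
    rw [div_le_one (hCpos y)]
    simp only [Q]; nlinarith [hq.1]

end RightAngle

/-! ### Gaussian integration by parts and differentiation of Gaussian averages. -/

section ExpGrowth

/-- At most exponential growth on the line. -/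
def ExpGrowth (f : ℝ → ℝ) : Prop := ∃ A K : ℝ, 0 ≤ K ∧ ∀ x, |f x| ≤ A * Real.exp (K * |x|)

namespace ExpGrowth

variable {f g : ℝ → ℝ}

lemma of_bound {A : ℝ} (h : ∀ x, |f x| ≤ A) : ExpGrowth f :=
  ⟨A, 0, le_rfl, fun x => by simpa using h x⟩

lemma const (c : ℝ) : ExpGrowth fun _ => c := of_bound fun _ => le_rfl

lemma id : ExpGrowth fun x => x :=
  ⟨1, 1, zero_le_one, fun x => by
    have := Real.add_one_le_exp |x|
    rw [one_mul, one_mul]; linarith⟩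

lemma mul (hf : ExpGrowth f) (hg : ExpGrowth g) : ExpGrowth fun x => f x * g x := by
  obtain ⟨A, K, hK, hA⟩ := hf
  obtain ⟨B, K', hK', hB⟩ := hg
  refine ⟨A * B, K + K', by positivity, fun x => ?_⟩
  rw [abs_mul, add_mul, Real.exp_add]
  calc |f x| * |g x| ≤ (A * Real.exp (K * |x|)) * (B * Real.exp (K' * |x|)) :=
        mul_le_mul (hA x) (hB x) (abs_nonneg _) ((abs_nonneg _).trans (hA x))
    _ = _ := by ring

lemma add (hf : ExpGrowth f) (hg : ExpGrowth g) : ExpGrowth fun x => f x + g x := by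
  obtain ⟨A, K, hK, hA⟩ := hf
  obtain ⟨B, K', hK', hB⟩ := hg
  have hA0 : 0 ≤ A := by simpa using (abs_nonneg _).trans (hA 0)
  have hB0 : 0 ≤ B := by simpa using (abs_nonneg _).trans (hB 0)
  refine ⟨A + B, K + K', by positivity, fun x => ?_⟩
  have h1 : A * Real.exp (K * |x|) ≤ A * Real.exp ((K + K') * |x|) := by
    gcongr; linarith
  have h2 : B * Real.exp (K' * |x|) ≤ B * Real.exp ((K + K') * |x|) := by
    gcongr; linarith
  linarith [abs_add_le (f x) (g x), hA x, hB x]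

lemma neg (hf : ExpGrowth f) : ExpGrowth fun x => -f x := by
  simpa only [neg_one_mul] using (const (-1)).mul hf

lemma sub (hf : ExpGrowth f) (hg : ExpGrowth g) : ExpGrowth fun x => f x - g x := by
  simpa only [sub_eq_add_neg] using hf.add hg.neg

lemma comp_affine (hf : ExpGrowth f) (s y : ℝ) : ExpGrowth fun x => f (s * x + y) := by
  obtain ⟨A, K, hK, hA⟩ := hf
  have hA0 : 0 ≤ A := by simpa using (abs_nonneg _).trans (hA 0)
  refine ⟨A * Real.exp (K * |y|), K * |s|, by positivity, fun x => (hA _).trans ?_⟩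
  rw [mul_assoc, ← Real.exp_add]
  have h1 : |s * x + y| ≤ |s| * |x| + |y| := (abs_add_le _ _).trans_eq (by rw [abs_mul])
  have h2 := mul_le_mul_of_nonneg_left h1 hK
  gcongr
  linarith

lemma integrable (hf : ExpGrowth f) (hc : Continuous f) : Integrable f stdNormal := by
  obtain ⟨A, K, hK, hA⟩ := hf
  exact ((integrable_exp_abs_stdNormal K).const_mul A).mono' hc.aestronglyMeasurable
    (.of_forall hA)

end ExpGrowth

/-- Gaussian integration by parts. -/
lemma integral_deriv_stdNormal {g g' : ℝ → ℝ} (hd : ∀ x, HasDerivAt g (g' x) x)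
    (hc : Continuous g') (hg : ExpGrowth g) (hg' : ExpGrowth g') :
    ∫ x, g' x ∂stdNormal = ∫ x, x * g x ∂stdNormal := by
  have hgc : Continuous g := continuous_iff_continuousAt.2 fun x => (hd x).continuousAt
  let p : ℝ → ℝ := gaussianPDFReal 0 1
  have hp : ∀ x, HasDerivAt p (-(x * p x)) x := by
    intro x
    have h1 : HasDerivAt (fun x : ℝ => -(x - 0) ^ 2 / (2 * (1 : ℝ))) (-x) x := by
      have := (((hasDerivAt_id x).sub_const 0).pow 2).neg.div_const (2 * (1 : ℝ))
      refine this.congr_deriv ?_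
      simp
      ring
    have h2 := (h1.exp).const_mul ((√(2 * Real.pi * (1 : ℝ)))⁻¹)
    refine h2.congr_deriv ?_
    simp only [p, gaussianPDFReal, NNReal.coe_one]
    ring
  have tr : ∀ f : ℝ → ℝ, ∫ x, f x ∂stdNormal = ∫ x, f x * p x := by
    intro f
    rw [stdNormal, integral_gaussianReal_eq_integral_smul one_ne_zero]
    exact integral_congr_ae (.of_forall fun x => mul_comm _ _)
  have ti : ∀ f : ℝ → ℝ, Continuous f → ExpGrowth f → Integrable fun x => f x * p x := by
    intro f hf hf'
    have := hf'.integrable hf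
    rw [stdNormal, gaussianReal_of_var_ne_zero _ one_ne_zero,
      integrable_withDensity_iff (measurable_gaussianPDF _ _)
        (.of_forall fun _ => gaussianPDF_lt_top)] at this
    simpa only [toReal_gaussianPDF] using this
  have key := integral_mul_deriv_eq_deriv_mul_of_integrable (u := g) (u' := g') (v := p)
    (v' := fun x => -(x * p x)) (fun x _ => hd x) (fun x _ => hp x)
    ((ti (fun x => -(x * g x)) (by fun_prop) (ExpGrowth.id.mul hg).neg).congr
      (.of_forall fun x => by simp only [Pi.mul_apply]; ring)) (ti g' hc hg') (ti g hgc hg)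
  rw [tr, tr]
  have e : ∫ x, g x * -(x * p x) = -∫ x, x * g x * p x := by
    rw [← integral_neg]
    exact integral_congr_ae (.of_forall fun x => by simp only; ring)
  linarith

/-- Differentiation in the location parameter of a Gaussian average. -/
lemma hasDerivAt_integral_location {f f' w : ℝ → ℝ} (hd : ∀ x, HasDerivAt f (f' x) x)
    (hc : Continuous f') {C : ℝ} (hf : ∀ x, |f x| ≤ C) (hf' : ∀ x, |f' x| ≤ C)
    (hw : Continuous w) (hwg : ExpGrowth w) (s y : ℝ) :
    HasDerivAt (fun y => ∫ z, w z * f (s * z + y) ∂stdNormal)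
      (∫ z, w z * f' (s * z + y) ∂stdNormal) y := by
  have hfc : Continuous f := continuous_iff_continuousAt.2 fun x => (hd x).continuousAt
  obtain ⟨A, K, -, hA⟩ := hwg
  refine (hasDerivAt_integral_of_dominated_loc_of_deriv_le (F := fun y z => w z * f (s * z + y))
    (F' := fun y z => w z * f' (s * z + y))
    (bound := fun z => A * C * Real.exp (K * |z|)) (s := Set.univ) Filter.univ_mem
    (.of_forall fun y => by fun_prop) ?_ (by fun_prop) (.of_forall fun z y _ => ?_)
    ((integrable_exp_abs_stdNormal K).const_mul _) (.of_forall fun z y _ => ?_)).2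
  · refine ((integrable_exp_abs_stdNormal K).const_mul (A * C)).mono' (by fun_prop)
      (.of_forall fun z => ?_)
    rw [Real.norm_eq_abs, abs_mul]
    calc _ ≤ A * Real.exp (K * |z|) * C :=
        mul_le_mul (hA z) (hf _) (abs_nonneg _) ((abs_nonneg _).trans (hA z))
      _ = _ := by ring
  · rw [Real.norm_eq_abs, abs_mul]
    calc _ ≤ A * Real.exp (K * |z|) * C :=
        mul_le_mul (hA z) (hf' _) (abs_nonneg _) ((abs_nonneg _).trans (hA z))
      _ = _ := by ring
  · have := (hd (s * z + y)).comp y ((hasDerivAt_id y).const_add (s * z))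
    simpa using this.const_mul (w z)

/-- Differentiation of a Gaussian average along the line `v ↦ N(v / 2 - l, v)`. -/
lemma hasDerivAt_integral_variance {f f' : ℝ → ℝ} (hd : ∀ x, HasDerivAt f (f' x) x)
    (hc : Continuous f') {C : ℝ} (hf : ∀ x, |f x| ≤ C) (hf' : ∀ x, |f' x| ≤ C) (l : ℝ) {v : ℝ}
    (hv : 0 < v) :
    HasDerivAt (fun v => ∫ z, f (√v * z + (v / 2 - l)) ∂stdNormal)
      (∫ z, (z / (2 * √v) + 1 / 2) * f' (√v * z + (v / 2 - l)) ∂stdNormal) v := by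
  have hfc : Continuous f := continuous_iff_continuousAt.2 fun x => (hd x).continuousAt
  have hC : 0 ≤ C := (abs_nonneg _).trans (hf 0)
  have ib : Integrable (fun z : ℝ => C * (|z| / (2 * √(v / 2)) + 1 / 2)) stdNormal := by
    have h1 : Integrable (fun z : ℝ => |z|) stdNormal :=
      (ExpGrowth.id.integrable continuous_id).abs
    exact ((h1.div_const _).add (integrable_const _)).const_mul C
  refine (hasDerivAt_integral_of_dominated_loc_of_deriv_le
    (F := fun v z => f (√v * z + (v / 2 - l)))
    (F' := fun v z => (z / (2 * √v) + 1 / 2) * f' (√v * z + (v / 2 - l)))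
    (bound := fun z => C * (|z| / (2 * √(v / 2)) + 1 / 2)) (s := Set.Ioi (v / 2))
    (Ioi_mem_nhds (by linarith)) (.of_forall fun y => by fun_prop) ?_ (by fun_prop)
    (.of_forall fun z y hy => ?_) ib (.of_forall fun z y hy => ?_)).2
  · exact (ExpGrowth.of_bound fun z => hf _).integrable (by fun_prop)
  · have hy' : v / 2 < y := hy
    have h0 : 0 < √(v / 2) := Real.sqrt_pos.2 (by linarith)
    have h1 : √(v / 2) ≤ √y := Real.sqrt_le_sqrt hy'.le
    have h2 : 0 < √y := h0.trans_le h1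
    rw [Real.norm_eq_abs, abs_mul, mul_comm]
    refine mul_le_mul (hf' _) ((abs_add_le _ _).trans ?_) (abs_nonneg _) hC
    rw [abs_div, abs_of_pos (by positivity : 0 < 2 * √y), abs_of_pos (by norm_num : (0:ℝ) < 1 / 2)]
    gcongr
  · have hy0 : 0 < y := lt_trans (by linarith) hy
    have h1 := ((Real.hasDerivAt_sqrt hy0.ne').mul_const z).add
      (((hasDerivAt_id y).div_const 2).sub_const l)
    have := (hd (√y * z + (y / 2 - l))).comp y h1
    refine this.congr_deriv ?_
    ring

/-- The average of an odd function that is positive on the right half-line, against a Gaussian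
with nonnegative mean, is nonnegative. -/
lemma integral_odd_nonneg {f : ℝ → ℝ} (hc : Continuous f) (hg : ExpGrowth f)
    (hodd : ∀ x, f (-x) = -f x) (hpos : ∀ x, 0 ≤ x → 0 ≤ f x) {s y : ℝ} (hs : 0 < s)
    (hy : 0 ≤ y) : 0 ≤ ∫ z, f (s * z + y) ∂stdNormal := by
  -- The mean is moved into a density `shiftDensity a`; folding `z` with `-z` then weighs the
  -- positive half-line more, because `a ≥ 0`.
  set a := y / s with ha
  have ha0 : 0 ≤ a := by positivity
  have e1 : ∫ z, f (s * z + y) ∂stdNormal = ∫ z, shiftDensity a z * f (s * z) ∂stdNormal := by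
    rw [← integral_comp_add_stdNormal a fun z => f (s * z)]
    refine integral_congr_ae (.of_forall fun z => ?_)
    simp only [ha]
    congr 1
    field_simp
  have e2 := integral_comp_neg_stdNormal fun z => shiftDensity a z * f (s * z)
  have gE : ∀ a : ℝ, ExpGrowth (shiftDensity a) := fun a =>
    ⟨Real.exp (|a| + |a| ^ 2), |a| + |a| ^ 2, by positivity, fun x =>
      (expControlled_shiftDensity (le_refl |a|)).abs_le x⟩
  have gf : ExpGrowth fun z => f (s * z) := by simpa using hg.comp_affine s 0
  have i1 : Integrable (fun z => shiftDensity a z * f (s * z)) stdNormal :=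
    ((gE a).mul gf).integrable (by fun_prop)
  have i2 : Integrable (fun z => shiftDensity a (-z) * f (s * -z)) stdNormal := by
    have h1 := ((gE a).mul gf).comp_affine (-1) 0
    simp only [neg_one_mul, add_zero] at h1
    exact h1.integrable (by fun_prop)
  have e3 : 2 * ∫ z, f (s * z + y) ∂stdNormal
      = ∫ z, (shiftDensity a z * f (s * z) + shiftDensity a (-z) * f (s * -z)) ∂stdNormal := by
    rw [integral_add i1 i2, e2, e1]; ring
  have : 0 ≤ 2 * ∫ z, f (s * z + y) ∂stdNormal := by
    rw [e3]
    refine integral_nonneg fun z => ?_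
    have hE : ∀ t, 0 ≤ t → shiftDensity a (-t) ≤ shiftDensity a t := fun t ht =>
      Real.exp_le_exp.2 (by nlinarith [mul_nonneg ha0 ht])
    simp only [Pi.zero_apply, mul_neg, hodd]
    rcases le_total 0 z with hz | hz
    · have h1 := hE z hz
      have h2 := hpos (s * z) (by positivity)
      nlinarith
    · have h1 := hE (-z) (by linarith)
      rw [neg_neg] at h1
      have h2 := hpos (s * -z) (mul_nonneg hs.le (by linarith))
      rw [mul_neg, hodd] at h2
      nlinarith
  linarith

end ExpGrowth

/-! ### The logistic function and its derivatives. -/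

section Logistic

/-- The derivative of the logistic function. -/
noncomputable def sigmoidDeriv (t : ℝ) : ℝ := t.sigmoid * (1 - t.sigmoid)

/-- The second derivative of the logistic function. -/
noncomputable def sigmoidDeriv₂ (t : ℝ) : ℝ := t.sigmoid * (1 - t.sigmoid) * (1 - 2 * t.sigmoid)

/-- The function `σ (1 - σ)²`, the generator of `v ↦ N(v / 2 - l, v)` applied to the logistic
function. -/
noncomputable def sigmoidGen (t : ℝ) : ℝ := t.sigmoid * (1 - t.sigmoid) ^ 2

/-- The derivative of `sigmoidGen`. -/
noncomputable def sigmoidGenDeriv (t : ℝ) : ℝ := sigmoidGen t * (1 - 3 * t.sigmoid)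

@[fun_prop] lemma continuous_realSigmoid : Continuous Real.sigmoid := continuous_sigmoid

@[fun_prop] lemma continuous_sigmoidDeriv : Continuous sigmoidDeriv := by
  unfold sigmoidDeriv; fun_prop

@[fun_prop] lemma continuous_sigmoidDeriv₂ : Continuous sigmoidDeriv₂ := by
  unfold sigmoidDeriv₂; fun_prop

@[fun_prop] lemma continuous_sigmoidGen : Continuous sigmoidGen := by
  unfold sigmoidGen; fun_prop

@[fun_prop] lemma continuous_sigmoidGenDeriv : Continuous sigmoidGenDeriv := by
  unfold sigmoidGenDeriv; fun_prop

lemma hasDerivAt_realSigmoid (t : ℝ) : HasDerivAt Real.sigmoid (sigmoidDeriv t) t :=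
  Real.hasDerivAt_sigmoid t

lemma hasDerivAt_sigmoidDeriv (t : ℝ) : HasDerivAt sigmoidDeriv (sigmoidDeriv₂ t) t := by
  have h := hasDerivAt_realSigmoid t
  refine (h.mul (h.const_sub 1)).congr_deriv ?_
  simp only [sigmoidDeriv, sigmoidDeriv₂]
  ring

lemma hasDerivAt_sigmoidGen (t : ℝ) : HasDerivAt sigmoidGen (sigmoidGenDeriv t) t := by
  have h := hasDerivAt_realSigmoid t
  refine (h.mul ((h.const_sub 1).pow 2)).congr_deriv ?_
  simp only [sigmoidDeriv, sigmoidGenDeriv, sigmoidGen]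
  norm_num
  ring

lemma abs_sigmoid_le (t : ℝ) : |t.sigmoid| ≤ 1 := by
  rw [abs_of_pos (Real.sigmoid_pos t)]; exact Real.sigmoid_le_one t

lemma sigmoidDeriv_pos (t : ℝ) : 0 < sigmoidDeriv t :=
  mul_pos (Real.sigmoid_pos t) (sub_pos.2 (Real.sigmoid_lt_one t))

lemma abs_sigmoidDeriv_le (t : ℝ) : |sigmoidDeriv t| ≤ 1 := by
  rw [abs_of_pos (sigmoidDeriv_pos t), sigmoidDeriv]
  nlinarith [Real.sigmoid_pos t, Real.sigmoid_lt_one t]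

lemma abs_sigmoidDeriv₂_le (t : ℝ) : |sigmoidDeriv₂ t| ≤ 1 := by
  have h1 := abs_sigmoidDeriv_le t
  have h2 : |1 - 2 * t.sigmoid| ≤ 1 := by
    rw [abs_le]; constructor <;> linarith [Real.sigmoid_pos t, Real.sigmoid_lt_one t]
  rw [sigmoidDeriv₂, abs_mul]
  exact mul_le_one₀ h1 (abs_nonneg _) h2

lemma sigmoidGen_pos (t : ℝ) : 0 < sigmoidGen t :=
  mul_pos (Real.sigmoid_pos t) (pow_pos (sub_pos.2 (Real.sigmoid_lt_one t)) 2)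

lemma sigmoidGen_le_one (t : ℝ) : sigmoidGen t ≤ 1 := by
  have h1 := abs_sigmoidDeriv_le t
  rw [abs_of_pos (sigmoidDeriv_pos t)] at h1
  have h2 := sigmoidDeriv_pos t
  have e : sigmoidGen t = sigmoidDeriv t * (1 - t.sigmoid) := by
    simp only [sigmoidGen, sigmoidDeriv]; ring
  rw [e]
  nlinarith [Real.sigmoid_pos t, Real.sigmoid_lt_one t]

lemma abs_sigmoidGen_le (t : ℝ) : |sigmoidGen t| ≤ 2 := by
  rw [abs_of_pos (sigmoidGen_pos t)]
  linarith [sigmoidGen_le_one t]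

lemma abs_sigmoidGenDeriv_le (t : ℝ) : |sigmoidGenDeriv t| ≤ 2 := by
  have h2 : |1 - 3 * t.sigmoid| ≤ 2 := by
    rw [abs_le]; constructor <;> linarith [Real.sigmoid_pos t, Real.sigmoid_lt_one t]
  rw [sigmoidGenDeriv, abs_mul, abs_of_pos (sigmoidGen_pos t)]
  nlinarith [sigmoidGen_pos t, sigmoidGen_le_one t, abs_nonneg (1 - 3 * t.sigmoid)]

lemma expGrowth_sigmoid : ExpGrowth Real.sigmoid := .of_bound abs_sigmoid_le
lemma expGrowth_sigmoidDeriv : ExpGrowth sigmoidDeriv := .of_bound abs_sigmoidDeriv_le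
lemma expGrowth_sigmoidDeriv₂ : ExpGrowth sigmoidDeriv₂ := .of_bound abs_sigmoidDeriv₂_le
lemma expGrowth_sigmoidGen : ExpGrowth sigmoidGen := .of_bound abs_sigmoidGen_le
lemma expGrowth_sigmoidGenDeriv : ExpGrowth sigmoidGenDeriv := .of_bound abs_sigmoidGenDeriv_le

lemma sigmoidDeriv_neg (t : ℝ) : sigmoidDeriv (-t) = sigmoidDeriv t := by
  simp only [sigmoidDeriv, Real.sigmoid_neg]; ring

lemma sigmoidDeriv₂_neg (t : ℝ) : sigmoidDeriv₂ (-t) = -sigmoidDeriv₂ t := by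
  simp only [sigmoidDeriv₂, Real.sigmoid_neg]; ring

lemma half_le_sigmoid {t : ℝ} (ht : 0 ≤ t) : 1 / 2 ≤ t.sigmoid := by
  have := Real.sigmoid_le ht
  rw [Real.sigmoid_zero] at this
  linarith

lemma sigmoidGen_eq (t : ℝ) : sigmoidGen t = Real.exp t / (1 + Real.exp t) ^ 3 := by
  have h := Real.exp_pos t
  rw [sigmoidGen, Real.sigmoid_def, Real.exp_neg]
  field_simp
  ring

end Logistic

/-! ### Averages of the logistic function over Gaussians. -/

section LogisticNormal

/-- `E σ(s Z + y)` for a standard normal `Z`. -/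
noncomputable def logisticNormal (s y : ℝ) : ℝ := ∫ z, (s * z + y).sigmoid ∂stdNormal

/-- The derivative of `logisticNormal s`. -/
noncomputable def logisticNormalDeriv (s y : ℝ) : ℝ := ∫ z, sigmoidDeriv (s * z + y) ∂stdNormal

/-- The second derivative of `logisticNormal s`. -/
noncomputable def logisticNormalDeriv₂ (s y : ℝ) : ℝ := ∫ z, sigmoidDeriv₂ (s * z + y) ∂stdNormal

variable (s y : ℝ)

lemma hasDerivAt_logisticNormal :
    HasDerivAt (logisticNormal s) (logisticNormalDeriv s y) y := by
  have := hasDerivAt_integral_location hasDerivAt_realSigmoid continuous_sigmoidDeriv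
    abs_sigmoid_le abs_sigmoidDeriv_le (w := fun _ => 1) continuous_const (.const 1) s y
  simp only [one_mul] at this
  exact this

lemma hasDerivAt_logisticNormalDeriv :
    HasDerivAt (logisticNormalDeriv s) (logisticNormalDeriv₂ s y) y := by
  have := hasDerivAt_integral_location hasDerivAt_sigmoidDeriv continuous_sigmoidDeriv₂
    abs_sigmoidDeriv_le abs_sigmoidDeriv₂_le (w := fun _ => 1) continuous_const (.const 1) s y
  simp only [one_mul] at this
  exact this

lemma integrable_sigmoid_affine : Integrable (fun z => (s * z + y).sigmoid) stdNormal :=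
  (expGrowth_sigmoid.comp_affine s y).integrable (by fun_prop)

lemma integrable_sigmoidDeriv_affine : Integrable (fun z => sigmoidDeriv (s * z + y)) stdNormal :=
  (expGrowth_sigmoidDeriv.comp_affine s y).integrable (by fun_prop)

lemma logisticNormal_neg : logisticNormal s (-y) = 1 - logisticNormal s y := by
  rw [logisticNormal, ← integral_comp_neg_stdNormal]
  have e : ∀ z, (s * -z + -y).sigmoid = 1 - (s * z + y).sigmoid := fun z => by
    rw [← Real.sigmoid_neg]; ring_nf
  simp_rw [e]
  rw [integral_sub (integrable_const _) (integrable_sigmoid_affine s y), logisticNormal]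
  simp

lemma logisticNormalDeriv_neg : logisticNormalDeriv s (-y) = logisticNormalDeriv s y := by
  rw [logisticNormalDeriv, ← integral_comp_neg_stdNormal]
  refine integral_congr_ae (.of_forall fun z => ?_)
  simp only
  rw [← sigmoidDeriv_neg]
  ring_nf

lemma logisticNormalDeriv_nonneg : 0 ≤ logisticNormalDeriv s y :=
  integral_nonneg fun _ => (sigmoidDeriv_pos _).le

lemma logisticNormal_mono : Monotone (logisticNormal s) :=
  monotone_of_deriv_nonneg (fun y => (hasDerivAt_logisticNormal s y).differentiableAt) fun y => by
    rw [(hasDerivAt_logisticNormal s y).deriv]; exact logisticNormalDeriv_nonneg s y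

variable {s y}

lemma logisticNormalDeriv₂_nonpos (hs : 0 < s) (hy : 0 ≤ y) : logisticNormalDeriv₂ s y ≤ 0 := by
  have := integral_odd_nonneg (f := fun t => -sigmoidDeriv₂ t) (by fun_prop)
    expGrowth_sigmoidDeriv₂.neg (fun x => by rw [sigmoidDeriv₂_neg]) (fun x hx => by
      have h1 := half_le_sigmoid hx
      have h2 := sigmoidDeriv_pos x
      rw [sigmoidDeriv] at h2
      rw [sigmoidDeriv₂]
      nlinarith) hs hy
  rw [integral_neg] at this
  rw [logisticNormalDeriv₂]
  linarith

lemma logisticNormalDeriv_antitoneOn (hs : 0 < s) :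
    AntitoneOn (logisticNormalDeriv s) (Set.Ici 0) := by
  refine antitoneOn_of_deriv_nonpos (convex_Ici 0)
    (fun y _ => (hasDerivAt_logisticNormalDeriv s y).continuousAt.continuousWithinAt)
    (fun y _ => (hasDerivAt_logisticNormalDeriv s y).differentiableAt.differentiableWithinAt)
    fun y hy => ?_
  rw [interior_Ici] at hy
  rw [(hasDerivAt_logisticNormalDeriv s y).deriv]
  exact logisticNormalDeriv₂_nonpos hs (le_of_lt hy)

lemma logisticNormal_concaveOn (hs : 0 < s) : ConcaveOn ℝ (Set.Ici 0) (logisticNormal s) := by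
  refine AntitoneOn.concaveOn_of_deriv (convex_Ici 0)
    (fun y _ => (hasDerivAt_logisticNormal s y).continuousAt.continuousWithinAt)
    (fun y _ => (hasDerivAt_logisticNormal s y).differentiableAt.differentiableWithinAt) ?_
  have : deriv (logisticNormal s) = logisticNormalDeriv s := by
    ext y; exact (hasDerivAt_logisticNormal s y).deriv
  rw [this]
  exact (logisticNormalDeriv_antitoneOn hs).mono interior_subset

/-- The increments of the logistic-normal density are bounded by those of its integral. -/
lemma logisticNormalDeriv_sub_le {y y' : ℝ} (h : y ≤ y') :
    logisticNormalDeriv s y' - logisticNormalDeriv s y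
      ≤ logisticNormal s y' - logisticNormal s y := by
  -- For the logistic function `σ - σ' = σ ^ 2`, which is increasing.
  have key : ∀ y, logisticNormal s y - logisticNormalDeriv s y
      = ∫ z, (s * z + y).sigmoid ^ 2 ∂stdNormal := by
    intro y
    rw [logisticNormal, logisticNormalDeriv,
      ← integral_sub (integrable_sigmoid_affine s y) (integrable_sigmoidDeriv_affine s y)]
    refine integral_congr_ae (.of_forall fun z => ?_)
    simp only [sigmoidDeriv]
    ring
  have i : ∀ y, Integrable (fun z => (s * z + y).sigmoid ^ 2) stdNormal := fun y =>
    ((integrable_sigmoid_affine s y).sub (integrable_sigmoidDeriv_affine s y)).congr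
      (.of_forall fun z => by simp only [sigmoidDeriv, Pi.sub_apply]; ring)
  have : logisticNormal s y - logisticNormalDeriv s y
      ≤ logisticNormal s y' - logisticNormalDeriv s y' := by
    rw [key, key]
    refine integral_mono (i y) (i y') fun z => ?_
    exact pow_le_pow_left₀ (Real.sigmoid_nonneg _) (Real.sigmoid_le (by linarith)) 2
  linarith

/-- `Δ` is even and nonnegative, so `t * Δ t` has nonnegative mean under `N(L, s²)`. Integration by
parts turns the centered part of `t` into the difference of derivatives on the left. -/
lemma sq_mul_logisticNormalDeriv_sub_le {Y L : ℝ} (hs : 0 < s) (hY : 0 < Y) (hL : 0 ≤ L) :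
    s ^ 2 * (logisticNormalDeriv s (Y / 2 - L) - logisticNormalDeriv s (-Y / 2 - L))
      ≤ L * (logisticNormal s (Y / 2 - L) - logisticNormal s (-Y / 2 - L)) := by
  let Δ : ℝ → ℝ := fun t => (t + Y / 2).sigmoid - (t + -(Y / 2)).sigmoid
  have gΔ : ExpGrowth Δ := by
    have h : ∀ a : ℝ, ExpGrowth fun t : ℝ => (t + a).sigmoid := fun a => by
      simpa only [one_mul] using expGrowth_sigmoid.comp_affine 1 a
    exact (h _).sub (h _)
  have cΔ : Continuous Δ := by simp only [Δ]; fun_prop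
  have even : ∀ t, Δ (-t) = Δ t := fun t => by
    simp only [Δ]
    rw [show -t + Y / 2 = -(t + -(Y / 2)) by ring, show -t + -(Y / 2) = -(t + Y / 2) by ring,
      Real.sigmoid_neg, Real.sigmoid_neg]
    ring
  have nonneg : ∀ t, 0 ≤ Δ t := fun t => sub_nonneg.2 (Real.sigmoid_le (by linarith))
  have hD : ∀ z, HasDerivAt (fun z => Δ (s * z + -L))
      (s * (sigmoidDeriv (s * z + (Y / 2 - L)) - sigmoidDeriv (s * z + (-Y / 2 - L)))) z := by
    intro z
    have h : ∀ a, HasDerivAt (fun z => (s * z + -L + a).sigmoid)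
        (sigmoidDeriv (s * z + -L + a) * (s * 1)) z := fun a =>
      (hasDerivAt_realSigmoid _).comp z ((((hasDerivAt_id z).const_mul s).add_const _).add_const _)
    refine ((h (Y / 2)).sub (h (-(Y / 2)))).congr_deriv ?_
    rw [show s * z + -L + Y / 2 = s * z + (Y / 2 - L) by ring,
      show s * z + -L + -(Y / 2) = s * z + (-Y / 2 - L) by ring]
    ring
  have stein := integral_deriv_stdNormal hD (by fun_prop) (gΔ.comp_affine s (-L))
    ((ExpGrowth.const s).mul ((expGrowth_sigmoidDeriv.comp_affine _ _).sub
      (expGrowth_sigmoidDeriv.comp_affine _ _)))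
  rw [integral_const_mul, integral_sub (integrable_sigmoidDeriv_affine _ _)
    (integrable_sigmoidDeriv_affine _ _)] at stein
  change s * (logisticNormalDeriv s (Y / 2 - L) - logisticNormalDeriv s (-Y / 2 - L)) = _ at stein
  have odd := integral_odd_nonneg (f := fun t => t * Δ t) (by fun_prop) (ExpGrowth.id.mul gΔ)
    (fun t => by rw [even]; ring) (fun t ht => mul_nonneg ht (nonneg t)) hs hL
  rw [← integral_comp_neg_stdNormal] at odd
  have iΔ : Integrable (fun z => Δ (s * z + -L)) stdNormal :=
    (gΔ.comp_affine s (-L)).integrable (by fun_prop)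
  have izΔ : Integrable (fun z => z * Δ (s * z + -L)) stdNormal :=
    (ExpGrowth.id.mul (gΔ.comp_affine s (-L))).integrable (by fun_prop)
  have e : ∀ z, (s * -z + L) * Δ (s * -z + L)
      = L * Δ (s * z + -L) - s * (z * Δ (s * z + -L)) := by
    intro z
    rw [show s * -z + L = -(s * z + -L) by ring, even]
    ring
  simp_rw [e] at odd
  rw [integral_sub (iΔ.const_mul L) (izΔ.const_mul s), integral_const_mul, integral_const_mul,
    ← stein] at odd
  have eΔ : ∫ z, Δ (s * z + -L) ∂stdNormal
      = logisticNormal s (Y / 2 - L) - logisticNormal s (-Y / 2 - L) := by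
    rw [logisticNormal, logisticNormal, ← integral_sub (integrable_sigmoid_affine _ _)
      (integrable_sigmoid_affine _ _)]
    refine integral_congr_ae (.of_forall fun z => ?_)
    simp only [Δ]
    ring_nf
  rw [eΔ] at odd
  nlinarith

/-- Two integrations by parts identify the derivative in `y` with the mean of `z ^ 2 σ'(s z + y)`,
which is nonnegative. -/
lemma monotone_sq_mul_logisticNormalDeriv₂_add (s : ℝ) :
    Monotone fun y => s ^ 2 * logisticNormalDeriv₂ s y + logisticNormal s y := by
  have e : ∀ y, s ^ 2 * logisticNormalDeriv₂ s y + logisticNormal s y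
      = s * (∫ z, z * sigmoidDeriv (s * z + y) ∂stdNormal) + logisticNormal s y := by
    intro y
    have hD : ∀ z, HasDerivAt (fun z => sigmoidDeriv (s * z + y)) (s * sigmoidDeriv₂ (s * z + y)) z :=
      fun z => by
        have := (hasDerivAt_sigmoidDeriv (s * z + y)).comp z
          (((hasDerivAt_id z).const_mul s).add_const y)
        refine this.congr_deriv ?_
        ring
    have := integral_deriv_stdNormal hD (by fun_prop) (expGrowth_sigmoidDeriv.comp_affine s y)
      ((ExpGrowth.const s).mul (expGrowth_sigmoidDeriv₂.comp_affine s y))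
    rw [← this, integral_const_mul, logisticNormalDeriv₂]
    ring
  simp_rw [e]
  have hd : ∀ y, HasDerivAt (fun y => s * (∫ z, z * sigmoidDeriv (s * z + y) ∂stdNormal)
      + logisticNormal s y) (s * (∫ z, z * sigmoidDeriv₂ (s * z + y) ∂stdNormal)
        + logisticNormalDeriv s y) y := fun y =>
    ((hasDerivAt_integral_location hasDerivAt_sigmoidDeriv continuous_sigmoidDeriv₂
      abs_sigmoidDeriv_le abs_sigmoidDeriv₂_le (w := fun z => z) continuous_id .id s y).const_mul
        s).add (hasDerivAt_logisticNormal s y)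
  refine monotone_of_deriv_nonneg (fun y => (hd y).differentiableAt) fun y => ?_
  rw [(hd y).deriv]
  have hD : ∀ z, HasDerivAt (fun z => z * sigmoidDeriv (s * z + y))
      (s * (z * sigmoidDeriv₂ (s * z + y)) + sigmoidDeriv (s * z + y)) z :=
    fun z => by
      have := (hasDerivAt_id z).mul ((hasDerivAt_sigmoidDeriv (s * z + y)).comp z
        (((hasDerivAt_id z).const_mul s).add_const y))
      refine this.congr_deriv ?_
      simp
      ring
  have g1 : ExpGrowth fun z => z * sigmoidDeriv₂ (s * z + y) :=
    ExpGrowth.id.mul (expGrowth_sigmoidDeriv₂.comp_affine s y)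
  have stein := integral_deriv_stdNormal hD (by fun_prop)
    (ExpGrowth.id.mul (expGrowth_sigmoidDeriv.comp_affine s y))
    (((ExpGrowth.const s).mul g1).add (expGrowth_sigmoidDeriv.comp_affine s y))
  rw [integral_add ((g1.integrable (by fun_prop)).const_mul s) (integrable_sigmoidDeriv_affine s y),
    integral_const_mul] at stein
  rw [logisticNormalDeriv, stein]
  exact integral_nonneg fun z => by
    have := (sigmoidDeriv_pos (s * z + y)).le
    simp only [Pi.zero_apply]
    nlinarith [mul_self_nonneg z]

end LogisticNormal

/-! ### A weighted positivity estimate for `sigmoidGen`. -/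

section Generator

lemma exp_neg_mul_sigmoidGen_le {n D : ℝ} (hD : 0 ≤ D) :
    Real.exp (-D) * sigmoidGen n ≤ sigmoidGen (n - D) := by
  rw [sigmoidGen_eq, sigmoidGen_eq, sub_eq_add_neg, Real.exp_add]
  have h1 : Real.exp (-D) ≤ 1 := Real.exp_le_one_iff.2 (by linarith)
  have h2 : Real.exp n * Real.exp (-D) ≤ Real.exp n :=
    mul_le_of_le_one_right (Real.exp_pos n).le h1
  have h3 := Real.exp_pos n
  have h4 := Real.exp_pos (-D)
  rw [← mul_div_assoc, mul_comm (Real.exp (-D))]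
  gcongr

lemma sigmoidGen_le_exp {n D : ℝ} :
    sigmoidGen (n - D) ≤ Real.exp (-D) * (sigmoidGen n * (1 + Real.exp n) ^ 3) := by
  have h3 := Real.exp_pos n
  have e : sigmoidGen n * (1 + Real.exp n) ^ 3 = Real.exp n := by
    rw [sigmoidGen_eq]; field_simp
  rw [e, sigmoidGen_eq, ← Real.exp_add, neg_add_eq_sub]
  refine div_le_self (Real.exp_pos _).le (one_le_pow₀ ?_)
  linarith [Real.exp_pos (n - D)]

/-- Up to bounded factors `sigmoidGen (n - D)` is `exp (-D) * sigmoidGen n`. The factor `n + 3`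
changes sign at `-3`, so the lower estimate of `sigmoidGen (n - D)` serves to the right of `-3` and
the upper estimate to the left, where `exp n` is tiny. -/
lemma deriv_mul_sigmoidGen_le {n D : ℝ} (hD : 0 ≤ D) :
    Real.exp (-D) * (sigmoidGen n + n * sigmoidGenDeriv n) ≤ (n + 3) * sigmoidGen (n - D) := by
  have hw := mul_pos (Real.exp_pos (-D)) (sigmoidGen_pos n)
  have hσ := Real.sigmoid_pos n
  have hσ' : n.sigmoid * (1 + Real.exp (-n)) = 1 := by
    rw [Real.sigmoid_def, inv_mul_cancel₀]
    positivity
  have e : Real.exp (-D) * (sigmoidGen n + n * sigmoidGenDeriv n)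
      = Real.exp (-D) * sigmoidGen n * (1 + n * (1 - 3 * n.sigmoid)) := by
    rw [sigmoidGenDeriv]; ring
  rw [e]
  rcases le_total (-3) n with hn | hn
  · have h1 := mul_le_mul_of_nonneg_left (exp_neg_mul_sigmoidGen_le (n := n) hD)
      (by linarith : 0 ≤ n + 3)
    refine le_trans ?_ h1
    rw [mul_comm (n + 3)]
    refine mul_le_mul_of_nonneg_left ?_ hw.le
    rcases le_total 0 n with h0 | h0
    · nlinarith
    · have h2 : -n * 3 ≤ 2 * (1 + Real.exp (-n)) := by
        have := Real.quadratic_le_exp_of_nonneg (neg_nonneg.2 h0)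
        nlinarith [sq_nonneg (n + 1)]
      have h3 := mul_le_mul_of_nonneg_left h2 hσ.le
      nlinarith
  · set m := -n with hm
    have hm3 : 3 ≤ m := by linarith
    have hexp : 4 * m ≤ Real.exp m := by
      have h1 := Real.pow_div_factorial_le_exp m (by linarith) 3
      have h2 := Real.sum_le_exp_of_nonneg (by linarith : 0 ≤ m) 4
      simp only [Finset.sum_range_succ, Finset.sum_range_zero, Nat.factorial] at h2
      norm_num at h2
      nlinarith [sq_nonneg (m - 3), mul_nonneg (sub_nonneg.2 hm3) (sq_nonneg m)]
    have hprod : Real.exp n * Real.exp m = 1 := by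
      rw [← Real.exp_add, hm, add_neg_cancel, Real.exp_zero]
    set ε := Real.exp n with hε
    have hε0 : 0 < ε := Real.exp_pos n
    have hmε : m * ε ≤ 1 / 4 := by nlinarith
    have hε1 : ε ≤ 1 / 12 := by nlinarith
    have hσε : n.sigmoid ≤ ε := by nlinarith
    have h1 := mul_le_mul_of_nonpos_left (sigmoidGen_le_exp (n := n) (D := D))
      (by linarith : n + 3 ≤ 0)
    refine le_trans ?_ h1
    have e2 : (n + 3) * (Real.exp (-D) * (sigmoidGen n * (1 + ε) ^ 3))
        = Real.exp (-D) * sigmoidGen n * ((n + 3) * (1 + ε) ^ 3) := by ring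
    rw [e2]
    refine mul_le_mul_of_nonneg_left ?_ hw.le
    have hn : n = -m := by rw [hm, neg_neg]
    rw [hn] at hσε ⊢
    have h3 : (1 + ε) ^ 3 ≤ 1 + 4 * ε := by nlinarith [mul_pos hε0 hε0]
    have h4 : m * (-m).sigmoid ≤ m * ε := mul_le_mul_of_nonneg_left hσε (by linarith)
    have h5 := mul_le_mul_of_nonneg_left h3 (by linarith : 0 ≤ m - 3)
    nlinarith

/-- The pointwise lower bound is `exp (-D)` times the derivative of `z * sigmoidGen (s z)`, whose
mean equals that of `z ^ 2 * sigmoidGen (s z)`. -/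
lemma integral_add_three_mul_sigmoidGen_nonneg {s D : ℝ} (hD : 0 ≤ D) :
    0 ≤ ∫ z, (s * z + 3) * sigmoidGen (s * z - D) ∂stdNormal := by
  have c0 : ExpGrowth fun z => sigmoidGen (s * z) := by
    simpa using expGrowth_sigmoidGen.comp_affine s 0
  have c1 : ExpGrowth fun z => sigmoidGenDeriv (s * z) := by
    simpa using expGrowth_sigmoidGenDeriv.comp_affine s 0
  have c2 : ExpGrowth fun z => s * z + 3 := ExpGrowth.id.comp_affine s 3
  have c3 : ExpGrowth fun z => sigmoidGen (s * z - D) := by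
    simpa [sub_eq_add_neg] using expGrowth_sigmoidGen.comp_affine s (-D)
  have hd : ∀ z, HasDerivAt (fun z => z * sigmoidGen (s * z))
      (sigmoidGen (s * z) + s * (z * sigmoidGenDeriv (s * z))) z := fun z => by
    have := (hasDerivAt_id z).mul ((hasDerivAt_sigmoidGen (s * z)).comp z
      ((hasDerivAt_id z).const_mul s))
    refine this.congr_deriv ?_
    simp
    ring
  have c4 := c0.add ((ExpGrowth.const s).mul (ExpGrowth.id.mul c1))
  have stein := integral_deriv_stdNormal hd (by fun_prop) (ExpGrowth.id.mul c0) c4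
  have h1 : 0 ≤ ∫ z, z * (z * sigmoidGen (s * z)) ∂stdNormal := integral_nonneg fun z => by
    have := (sigmoidGen_pos (s * z)).le
    simp only [Pi.zero_apply]
    nlinarith [mul_self_nonneg z]
  rw [← stein] at h1
  refine (mul_nonneg (Real.exp_pos (-D)).le h1).trans ?_
  rw [← integral_const_mul]
  refine integral_mono ((c4.integrable (by fun_prop)).const_mul _)
    ((c2.mul c3).integrable (by fun_prop)) fun z => ?_
  refine le_trans (le_of_eq ?_) (deriv_mul_sigmoidGen_le (n := s * z) hD)
  ring

end Generator

/-! ### The inequality between logistic averages behind the flow. -/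

section LogisticNormalInequality

variable {c Y L : ℝ}

/-- The average of `sigmoidGen` along the line `v ↦ N(v / 2 - l, v)`. -/
noncomputable def generatorNormal (l v : ℝ) : ℝ :=
  ∫ z, sigmoidGen (√v * z + (v / 2 - l)) ∂stdNormal

lemma generatorNormal_nonneg (l v : ℝ) : 0 ≤ generatorNormal l v :=
  integral_nonneg fun _ => (sigmoidGen_pos _).le

/-- Along `N(v / 2 - l, v)` the mean of `f` has derivative the mean of `(f'' + f') / 2`, once the
factor `z` is integrated by parts; for the logistic function this is `σ (1 - σ) ^ 2`. -/
lemma hasDerivAt_logisticNormal_variance (l : ℝ) {v : ℝ} (hv : 0 < v) :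
    HasDerivAt (fun v => logisticNormal √v (v / 2 - l)) (generatorNormal l v) v := by
  refine (hasDerivAt_integral_variance hasDerivAt_realSigmoid continuous_sigmoidDeriv
    abs_sigmoid_le abs_sigmoidDeriv_le l hv).congr_deriv ?_
  have hs : 0 < √v := Real.sqrt_pos.2 hv
  set s := √v
  set m := v / 2 - l
  have hD : ∀ z, HasDerivAt (fun z => sigmoidDeriv (s * z + m)) (s * sigmoidDeriv₂ (s * z + m)) z :=
    fun z => by
      have := (hasDerivAt_sigmoidDeriv (s * z + m)).comp z
        (((hasDerivAt_id z).const_mul s).add_const m)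
      refine this.congr_deriv ?_
      ring
  have g1 := expGrowth_sigmoidDeriv.comp_affine s m
  have g2 := expGrowth_sigmoidDeriv₂.comp_affine s m
  have stein := integral_deriv_stdNormal hD (by fun_prop) g1 ((ExpGrowth.const s).mul g2)
  have i1 : Integrable (fun z => z * sigmoidDeriv (s * z + m)) stdNormal :=
    (ExpGrowth.id.mul g1).integrable (by fun_prop)
  have i2 := g1.integrable (by fun_prop)
  have i3 := g2.integrable (by fun_prop)
  have e : ∀ z, (z / (2 * s) + 1 / 2) * sigmoidDeriv (s * z + m)
      = (2 * s)⁻¹ * (z * sigmoidDeriv (s * z + m)) + 1 / 2 * sigmoidDeriv (s * z + m) := fun z => by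
    ring
  simp_rw [e]
  rw [integral_add (i1.const_mul _) (i2.const_mul _), integral_const_mul, ← stein,
    integral_const_mul, integral_const_mul, ← mul_assoc, show (2 * s)⁻¹ * s = 1 / 2 by field_simp,
    ← integral_const_mul, ← integral_const_mul, ← integral_add (i3.const_mul _) (i2.const_mul _),
    generatorNormal]
  refine integral_congr_ae (.of_forall fun z => ?_)
  simp only [sigmoidDeriv, sigmoidDeriv₂, sigmoidGen]
  ring

/-- With `ρ = generatorNormal l`, the quantity `2 ρ + v ρ'` is the derivative of `ρ + v ρ`'s
weighted part needed to make the slope of the flow function grow. Integration by parts against `s z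
+ v` writes it as half the mean of `(z ^ 2 + s z + 3) * sigmoidGen`. -/
lemma exists_hasDerivAt_generatorNormal {l v : ℝ} (hv : 0 < v) (hl : v / 2 ≤ l) :
    ∃ ρ', HasDerivAt (generatorNormal l) ρ' v ∧ 0 ≤ 2 * generatorNormal l v + v * ρ' := by
  refine ⟨_, hasDerivAt_integral_variance hasDerivAt_sigmoidGen continuous_sigmoidGenDeriv
    abs_sigmoidGen_le abs_sigmoidGenDeriv_le l hv, ?_⟩
  have hs : 0 < √v := Real.sqrt_pos.2 hv
  have hsv : √v ^ 2 = v := Real.sq_sqrt hv.le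
  rw [generatorNormal]
  set s := √v
  set m := v / 2 - l with hm
  have hD : ∀ z, HasDerivAt (fun z => (s * z + v) * sigmoidGen (s * z + m))
      (s * sigmoidGen (s * z + m) + (s * z + v) * (s * sigmoidGenDeriv (s * z + m))) z :=
    fun z => by
      have := (((hasDerivAt_id z).const_mul s).add_const v).mul
        ((hasDerivAt_sigmoidGen (s * z + m)).comp z (((hasDerivAt_id z).const_mul s).add_const m))
      refine this.congr_deriv ?_
      simp only [Function.comp, id, mul_one]
      ring
  have g1 := expGrowth_sigmoidGen.comp_affine s m
  have g2 := expGrowth_sigmoidGenDeriv.comp_affine s m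
  have g3 : ExpGrowth fun z => s * z + v := ExpGrowth.id.comp_affine s v
  have stein := integral_deriv_stdNormal hD (by fun_prop) (g3.mul g1)
    (((ExpGrowth.const s).mul g1).add (g3.mul ((ExpGrowth.const s).mul g2)))
  have i1 : Integrable (fun z => sigmoidGen (s * z + m)) stdNormal := g1.integrable (by fun_prop)
  have i2 : Integrable (fun z => (s * z + v) * (s * sigmoidGenDeriv (s * z + m))) stdNormal :=
    (g3.mul ((ExpGrowth.const s).mul g2)).integrable (by fun_prop)
  have i3 : Integrable (fun z => z * ((s * z + v) * sigmoidGen (s * z + m))) stdNormal :=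
    (ExpGrowth.id.mul (g3.mul g1)).integrable (by fun_prop)
  have i4 : Integrable (fun z => (s * z + 3) * sigmoidGen (s * z + m)) stdNormal :=
    ((ExpGrowth.id.comp_affine s 3).mul g1).integrable (by fun_prop)
  have i5 : Integrable (fun z => z ^ 2 * sigmoidGen (s * z + m)) stdNormal := by
    have := (ExpGrowth.id.mul (ExpGrowth.id.mul g1)).integrable (by fun_prop)
    exact this.congr (.of_forall fun z => by ring)
  have i6 : Integrable (fun z => z ^ 2 * sigmoidGen (s * z + m)
    + (s * z + 3) * sigmoidGen (s * z + m)) stdNormal := i5.add i4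
  rw [integral_add (i1.const_mul s) i2, integral_const_mul] at stein
  have e1 : ∫ z, (z / (2 * s) + 1 / 2) * sigmoidGenDeriv (s * z + m) ∂stdNormal
      = (2 * v * s)⁻¹ * ∫ z, (s * z + v) * (s * sigmoidGenDeriv (s * z + m)) ∂stdNormal := by
    rw [← integral_const_mul]
    refine integral_congr_ae (.of_forall fun z => ?_)
    simp only
    rw [← hsv]
    field_simp
  have e2 : v * ∫ z, (z / (2 * s) + 1 / 2) * sigmoidGenDeriv (s * z + m) ∂stdNormal
      = 1 / 2 * ((s⁻¹ * ∫ z, z * ((s * z + v) * sigmoidGen (s * z + m)) ∂stdNormal)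
        - ∫ z, sigmoidGen (s * z + m) ∂stdNormal) := by
    rw [e1, ← stein]
    field_simp
    ring
  have three := integral_add_three_mul_sigmoidGen_nonneg (s := s) (D := l - v / 2)
    (sub_nonneg.2 hl)
  have e3 : ∀ z, s * z - (l - v / 2) = s * z + m := fun z => by rw [hm]; ring
  simp_rw [e3] at three
  have e4 : s⁻¹ * ∫ z, z * ((s * z + v) * sigmoidGen (s * z + m)) ∂stdNormal
      = ∫ z, z ^ 2 * sigmoidGen (s * z + m) ∂stdNormal
        + ∫ z, (s * z + 3) * sigmoidGen (s * z + m) ∂stdNormal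
        - 3 * ∫ z, sigmoidGen (s * z + m) ∂stdNormal := by
    rw [← integral_const_mul, ← integral_const_mul, ← integral_add i5 i4,
      ← integral_sub i6 (i1.const_mul 3)]
    refine integral_congr_ae (.of_forall fun z => ?_)
    simp only
    rw [← hsv]
    field_simp
    ring
  have h5 : 0 ≤ ∫ z, z ^ 2 * sigmoidGen (s * z + m) ∂stdNormal :=
    integral_nonneg fun z => mul_nonneg (sq_nonneg z) (sigmoidGen_pos _).le
  rw [e2, e4]
  linarith

lemma logisticNormalDeriv₂_le_generatorNormal (l v : ℝ) :
    logisticNormalDeriv₂ √v (v / 2 - l) ≤ generatorNormal l v := by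
  refine integral_mono ((expGrowth_sigmoidDeriv₂.comp_affine _ _).integrable (by fun_prop))
    ((expGrowth_sigmoidGen.comp_affine _ _).integrable (by fun_prop)) fun z => ?_
  set t := √v * z + (v / 2 - l)
  have h := sigmoidDeriv_pos t
  have h2 := Real.sigmoid_pos t
  simp only [sigmoidDeriv₂, sigmoidGen, sigmoidDeriv] at h ⊢
  nlinarith

/-- The slope of `X ↦ Y (c + X) U(X) - X s² D` at `X = Y` is nonnegative. -/
lemma sq_mul_logisticNormalDeriv_sub_le_generator (hY : 0 < Y) (hs : 0 < c + Y) :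
    (c + Y) * (logisticNormalDeriv √(c + Y) (Y / 2 - L) - logisticNormalDeriv √(c + Y) (-Y / 2 - L))
      ≤ Y * (logisticNormal √(c + Y) (Y / 2 - L) - logisticNormal √(c + Y) (-Y / 2 - L)
        + (c + Y) * generatorNormal (c / 2 + L) (c + Y)) := by
  have hsv : √(c + Y) ^ 2 = c + Y := Real.sq_sqrt hs.le
  have hgen := logisticNormalDeriv₂_le_generatorNormal (c / 2 + L) (c + Y)
  rw [show (c + Y) / 2 - (c / 2 + L) = Y / 2 - L by ring] at hgen
  set s := √(c + Y)
  -- The increment of the derivative is `Y` times the second derivative at some `ξ`, and the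
  -- monotone combination moves `ξ` to the right endpoint at the cost of an increment of
  -- `logisticNormal`.
  obtain ⟨ξ, hξ, h⟩ := exists_hasDerivAt_eq_slope (logisticNormalDeriv s) (logisticNormalDeriv₂ s)
    (show -Y / 2 - L < Y / 2 - L by linarith)
    (fun y _ => (hasDerivAt_logisticNormalDeriv s y).continuousAt.continuousWithinAt)
    (fun y _ => hasDerivAt_logisticNormalDeriv s y)
  rw [show Y / 2 - L - (-Y / 2 - L) = Y by ring, eq_div_iff hY.ne'] at h
  rw [← h]
  have h1 := monotone_sq_mul_logisticNormalDeriv₂_add s hξ.2.le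
  have h2 := logisticNormal_mono s hξ.1.le
  simp only at h1
  rw [hsv] at h1
  have h3 := mul_le_mul_of_nonneg_left hgen hs.le
  nlinarith

/-- The planar flow inequality, reduced to averages of the logistic function. -/
theorem logisticNormal_inequality {X : ℝ} (hc : 0 ≤ c) (hY : 0 < Y) (hXY : Y ≤ X) :
    X * (c + Y) * (logisticNormalDeriv √(c + Y) (Y / 2 - L)
        - logisticNormalDeriv √(c + Y) (-Y / 2 - L))
      ≤ Y * (c + X) * (logisticNormal √(c + X) (X / 2 - L)
        - logisticNormal √(c + Y) (-Y / 2 - L)) := by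
  have hcY : 0 < c + Y := by linarith
  have hs : 0 < √(c + Y) := Real.sqrt_pos.2 hcY
  have hsv : √(c + Y) ^ 2 = c + Y := Real.sq_sqrt hcY.le
  have hslope := sq_mul_logisticNormalDeriv_sub_le_generator (L := L) hY hcY
  have hDe := logisticNormalDeriv_sub_le (s := √(c + Y)) (show -Y / 2 - L ≤ Y / 2 - L by linarith)
  have he : 0 ≤ logisticNormal √(c + Y) (Y / 2 - L) - logisticNormal √(c + Y) (-Y / 2 - L) :=
    sub_nonneg.2 (logisticNormal_mono _ (by linarith))
  set S₀ := logisticNormal √(c + Y) (-Y / 2 - L) with hS₀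
  set e := logisticNormal √(c + Y) (Y / 2 - L) - S₀ with he'
  set D := logisticNormalDeriv √(c + Y) (Y / 2 - L) - logisticNormalDeriv √(c + Y) (-Y / 2 - L)
    with hD
  let W : ℝ → ℝ := fun x => logisticNormal √(c + x) (x / 2 - L)
  let l := c / 2 + L
  have hW : ∀ x, 0 < c + x → HasDerivAt W (generatorNormal l (c + x)) x := by
    intro x hx
    have h1 := (hasDerivAt_logisticNormal_variance l hx).comp x ((hasDerivAt_id x).const_add c)
    rw [mul_one] at h1
    refine h1.congr_of_eventuallyEq (.of_forall fun t => ?_)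
    simp only [W, l, Function.comp]
    ring_nf
  have hWmono : MonotoneOn W (Set.Ici Y) := by
    refine monotoneOn_of_deriv_nonneg (convex_Ici Y) (fun x hx => ?_) (fun x hx => ?_)
      fun x hx => ?_
    · have hx' : Y ≤ x := hx
      exact (hW x (by linarith)).continuousAt.continuousWithinAt
    · rw [interior_Ici] at hx
      have hx' : Y < x := hx
      exact (hW x (by linarith)).differentiableAt.differentiableWithinAt
    · rw [interior_Ici] at hx
      have hx' : Y < x := hx
      rw [(hW x (by linarith)).deriv]
      exact generatorNormal_nonneg _ _
  have hWe : e ≤ W X - S₀ := sub_le_sub_right (hWmono Set.self_mem_Ici hXY hXY) _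
  change X * (c + Y) * D ≤ Y * (c + X) * (W X - S₀)
  have hX : 0 < X := by linarith
  -- Dropping the nonnegative term with factor `c` on the right leaves a stronger inequality in
  -- which `X` cancels.
  have big : (c + Y) * D ≤ Y * (W X - S₀) → X * (c + Y) * D ≤ Y * (c + X) * (W X - S₀) := by
    intro h
    have h1 := mul_le_mul_of_nonneg_left h hX.le
    have h2 : 0 ≤ c * (Y * (W X - S₀)) := mul_nonneg hc (mul_nonneg hY.le (he.trans hWe))
    nlinarith
  -- For `L ≤ 0` the left endpoint is no farther from the origin than the right one, and the even
  -- derivative decreases away from it, so `D ≤ 0`.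
  rcases le_total L 0 with hL | hL
  · have hD0 : D ≤ 0 := by
      have h1 : logisticNormalDeriv √(c + Y) (-Y / 2 - L)
          = logisticNormalDeriv √(c + Y) |(-Y / 2 - L)| := by
        rcases abs_choice (-Y / 2 - L) with h | h <;> rw [h]
        rw [logisticNormalDeriv_neg]
      rw [hD, h1]
      refine sub_nonpos.2 (logisticNormalDeriv_antitoneOn hs (Set.mem_Ici.2 (abs_nonneg _))
        (Set.mem_Ici.2 (by linarith)) ?_)
      rw [abs_le]
      constructor <;> linarith
    refine big ((mul_nonpos_of_nonneg_of_nonpos hcY.le hD0).trans ?_)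
    exact mul_nonneg hY.le (he.trans hWe)
  · have hK := sq_mul_logisticNormalDeriv_sub_le hs hY hL
    rw [hsv] at hK
    change (c + Y) * D ≤ L * e at hK
    rcases le_total (2 * L) X with hLX | hLX
    · refine big (hK.trans ?_)
      rcases le_total (2 * L) Y with hLY | hLY
      -- Here `L ≤ Y` already suffices. In the other case `W` at `2 * L` equals `1 / 2`, and
      -- concavity on the positive half-line compares the chord from `0` to `L + Y / 2` with the
      -- value at `L - Y / 2`.
      · exact mul_le_mul (by linarith) hWe he hY.le
      · have h1 : W (2 * L) ≤ W X := hWmono hLY (hLY.trans hLX) hLX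
        have h2 : W (2 * L) = 1 / 2 := by
          have := logisticNormal_neg √(c + 2 * L) 0
          simp only [W]
          rw [show 2 * L / 2 - L = 0 by ring]
          rw [neg_zero] at this
          linarith
        have h3 : S₀ = 1 - logisticNormal √(c + Y) (L + Y / 2) := by
          rw [← logisticNormal_neg, hS₀]
          ring_nf
        have h4 : e = logisticNormal √(c + Y) (L + Y / 2) - logisticNormal √(c + Y) (L - Y / 2) := by
          rw [he', h3, show Y / 2 - L = -(L - Y / 2) by ring, logisticNormal_neg]
          ring
        have h0 : logisticNormal √(c + Y) 0 = 1 / 2 := by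
          have := logisticNormal_neg √(c + Y) 0
          rw [neg_zero] at this
          linarith
        obtain ⟨-, hconc⟩ := logisticNormal_concaveOn hs
        have conc := @hconc 0 Set.self_mem_Ici (L + Y / 2) (Set.mem_Ici.2 (by linarith))
          (Y / (L + Y / 2)) ((L - Y / 2) / (L + Y / 2)) (by positivity)
          (div_nonneg (by linarith) (by linarith)) (by field_simp; ring)
        simp only [smul_eq_mul, mul_zero, zero_add] at conc
        have hb : 0 < L + Y / 2 := by linarith
        rw [div_mul_cancel₀ _ hb.ne', h0, div_mul_eq_mul_div, div_mul_eq_mul_div, ← add_div,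
          div_le_iff₀ hb] at conc
        have h5 : L * e ≤ (L + Y / 2) * e := mul_le_mul_of_nonneg_right (by linarith) he
        refine h5.trans ?_
        have h6 : Y * (1 / 2 - S₀) ≤ Y * (W X - S₀) := by
          refine mul_le_mul_of_nonneg_left ?_ hY.le
          linarith
        refine le_trans ?_ h6
        rw [h4, h3]
        nlinarith
    -- `H` is the derivative of `(c + x) * (W x - S₀)`, and its own derivative is `2 ρ + v ρ'` at `v
    -- = c + x`. The condition `v / 2 ≤ l` is exactly `x ≤ 2 * L`.
    · let H : ℝ → ℝ := fun x => W x - S₀ + (c + x) * generatorNormal l (c + x)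
      have hH : ∀ x ∈ Set.Icc Y (2 * L), ∃ H', HasDerivAt H H' x ∧ 0 ≤ H' := by
        intro x hx
        have hx0 : 0 < c + x := by linarith [hx.1]
        obtain ⟨ρ', h1, h2⟩ := exists_hasDerivAt_generatorNormal (l := l) hx0
          (by simp only [l]; linarith [hx.2])
        have h3 := h1.comp x ((hasDerivAt_id x).const_add c)
        rw [mul_one] at h3
        refine ⟨_, ((hW x hx0).sub_const S₀).add
          (((hasDerivAt_id x).const_add c).mul h3), ?_⟩
        simp only [id]
        linarith
      have hHmono : MonotoneOn H (Set.Icc Y (2 * L)) := by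
        refine monotoneOn_of_deriv_nonneg (convex_Icc _ _) (fun x hx => ?_) (fun x hx => ?_)
          fun x hx => ?_
        · obtain ⟨_, h, _⟩ := hH x hx
          exact h.continuousAt.continuousWithinAt
        · obtain ⟨_, h, _⟩ := hH x (interior_subset hx)
          exact h.differentiableAt.differentiableWithinAt
        · obtain ⟨_, h, h'⟩ := hH x (interior_subset hx)
          rwa [h.deriv]
      -- `G X ≥ 0` is the claim. `G` starts nonnegative at `Y` because `D ≤ e`, its slope there is
      -- nonnegative, and its slope increases with `H`.
      let G : ℝ → ℝ := fun x => Y * ((c + x) * (W x - S₀)) - x * ((c + Y) * D)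
      have hG : ∀ x ∈ Set.Icc Y (2 * L), HasDerivAt G (Y * H x - (c + Y) * D) x := by
        intro x hx
        have hx0 : 0 < c + x := by linarith [hx.1]
        refine ((((((hasDerivAt_id x).const_add c).mul ((hW x hx0).sub_const S₀)).const_mul Y).sub
          ((hasDerivAt_id x).mul_const ((c + Y) * D))).congr_deriv ?_)
        simp only [H, id]
        ring
      have hY2L : Y ≤ 2 * L := hXY.trans hLX
      have hGmono : MonotoneOn G (Set.Icc Y (2 * L)) := by
        refine monotoneOn_of_deriv_nonneg (convex_Icc _ _)
          (fun x hx => (hG x hx).continuousAt.continuousWithinAt)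
          (fun x hx => (hG x (interior_subset hx)).differentiableAt.differentiableWithinAt)
          fun x hx => ?_
        rw [(hG x (interior_subset hx)).deriv]
        have h1 := hHmono ⟨le_rfl, hY2L⟩ (interior_subset hx) (interior_subset hx).1
        have h2 := mul_le_mul_of_nonneg_left h1 hY.le
        have h3 : (c + Y) * D ≤ Y * H Y := hslope
        linarith
      have h1 := hGmono ⟨le_rfl, hY2L⟩ ⟨hXY, hLX⟩ hXY
      have h2 : G Y = Y * (c + Y) * (e - D) := by
        simp only [G]
        change Y * ((c + Y) * e) - _ = _
        ring
      have h3 : 0 ≤ G Y := by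
        rw [h2]
        exact mul_nonneg (mul_nonneg hY.le hcY.le) (sub_nonneg.2 hDe)
      have h4 : 0 ≤ G X := h3.trans h1
      simp only [G] at h4
      linarith

end LogisticNormalInequality

/-- The factor `2` of a sum is absorbed by `exp (1 + ‖x‖) ≥ 2`, at the price of one unit of `L`. -/
lemma ExpControlled.add {X : Type*} [NormedAddCommGroup X] {L : ℝ} {f g : X → ℝ}
    (hf : ExpControlled L f) (hg : ExpControlled L g) :
    ExpControlled (L + 1) fun x => f x + g x := by
  intro x
  have h1 := hf x
  have h2 := hg x
  have h3 := Real.exp_pos (-(L * (1 + ‖x‖)))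
  have h4 := Real.exp_pos (L * (1 + ‖x‖))
  have h5 : (2 : ℝ) ≤ Real.exp (1 + ‖x‖) := by
    linarith [Real.add_one_le_exp (1 + ‖x‖), norm_nonneg x]
  have h6 : Real.exp (-((L + 1) * (1 + ‖x‖))) ≤ Real.exp (-(L * (1 + ‖x‖))) :=
    Real.exp_le_exp.2 (by linarith [norm_nonneg x])
  have h7 : Real.exp ((L + 1) * (1 + ‖x‖)) = Real.exp (L * (1 + ‖x‖)) * Real.exp (1 + ‖x‖) := by
    rw [← Real.exp_add]; ring_nf
  constructor
  · linarith
  · rw [h7]; nlinarith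

/-! ### First variation of the power divergence in the common mean. -/

section FirstVariation

/-- The inner product of the plane. -/
def planarDot (u z : ℝ × ℝ) : ℝ := u.1 * z.1 + u.2 * z.2

/-- The intercept of the tangent of `perspective` at slope parameter `t`. -/
noncomputable def tangentIntercept (α t : ℝ) : ℝ := α * t ^ (α - 1) - (α - 1) * t ^ α

/-- The likelihood ratio of the two mixtures, seen from the common component and displaced. -/
noncomputable def shiftedRatio (k : ℝ) (u v : ℝ × ℝ) (θ₁ θ₂ : ℝ) (z : ℝ × ℝ) : ℝ :=
  (1 + k * planarDensity u z * Real.exp θ₁) / (1 + k * planarDensity v z * Real.exp θ₂)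

lemma expControlled_one_add {k : ℝ} (hk : 0 < k) (u : ℝ × ℝ) :
    ∃ L, ∀ θ : ℝ, |θ| ≤ 1 →
      ExpControlled L fun z => 1 + k * planarDensity u z * Real.exp θ := by
  have h1 := (ExpControlled.const (X := ℝ × ℝ) hk).mul
    (expControlled_planarDensity (norm_fst_le u) (norm_snd_le u))
  refine ⟨|Real.log k| + (‖u‖ + ‖u‖ ^ 2 + (‖u‖ + ‖u‖ ^ 2)) + 1 + 1, fun θ hθ => ?_⟩
  have h2 := h1.mul ((ExpControlled.const (X := ℝ × ℝ) (Real.exp_pos θ)).mono (L' := 1)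
    (by rwa [Real.log_exp]))
  exact (expControlled_one h2.nonneg).add h2

lemma expControlled_shiftedRatio {k : ℝ} (hk : 0 < k) (u v : ℝ × ℝ) :
    ∃ L, ∀ θ₁ θ₂ : ℝ, |θ₁| ≤ 1 → |θ₂| ≤ 1 → ExpControlled L (shiftedRatio k u v θ₁ θ₂) := by
  obtain ⟨L₁, h1⟩ := expControlled_one_add hk u
  obtain ⟨L₂, h2⟩ := expControlled_one_add hk v
  refine ⟨L₁ + |(-1 : ℝ)| * L₂, fun θ₁ θ₂ hθ₁ hθ₂ => ?_⟩
  have := (h1 θ₁ hθ₁).mul ((h2 θ₂ hθ₂).rpow (-1))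
  simp only [Real.rpow_neg_one, ← div_eq_mul_inv] at this
  exact this

lemma shiftedRatio_pos {k : ℝ} (hk : 0 < k) (u v : ℝ × ℝ) (θ₁ θ₂ : ℝ) (z : ℝ × ℝ) :
    0 < shiftedRatio k u v θ₁ θ₂ z := by
  have := planarDensity_pos
  unfold shiftedRatio
  have h1 := mul_pos (mul_pos hk (this u z)) (Real.exp_pos θ₁)
  have h2 := mul_pos (mul_pos hk (this v z)) (Real.exp_pos θ₂)
  positivity

lemma measurable_shiftedRatio (k : ℝ) (u v : ℝ × ℝ) (θ₁ θ₂ : ℝ) :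
    Measurable (shiftedRatio k u v θ₁ θ₂) := by
  unfold shiftedRatio; fun_prop

lemma planarDensity_shift (x w δ z : ℝ × ℝ) :
    planarDensity x (z + (w + δ))
      = planarDensity w (z + (w + δ))
        * (planarDensity (x - w) z * Real.exp (planarDot (x - w) δ)) := by
  simp only [planarDensity, shiftDensity, planarDot, ← Real.exp_add, Prod.fst_add, Prod.snd_add,
    Prod.fst_sub, Prod.snd_sub]
  congr 1
  ring

lemma mixDensity_shift {q : ℝ} (hq : q ∈ Set.Ioo (0 : ℝ) 1) (x w δ z : ℝ × ℝ) :
    mixDensity q x w (z + (w + δ)) = planarDensity w (z + (w + δ)) * (1 - q)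
      * (1 + q / (1 - q) * planarDensity (x - w) z * Real.exp (planarDot (x - w) δ)) := by
  have : 1 - q ≠ 0 := (sub_pos.2 hq.2).ne'
  rw [mixDensity, planarDensity_shift]
  field_simp
  ring

/-- Moving `w` adds the same amount to both mixture densities, so the tangent of the perspective at
the old ratio gains only its intercept. Recentering at the moved mean transfers the displacement
from the Gaussian weight into the ratio, which makes the lower bound smooth in `δ`. -/
lemma planarPower_first_variation {α q : ℝ} (hα : 1 < α) (hq : q ∈ Set.Ioo (0 : ℝ) 1)
    (x₁ x₂ w δ : ℝ × ℝ) :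
    (1 - q) * ((∫ z, tangentIntercept α (shiftedRatio (q / (1 - q)) (x₁ - w) (x₂ - w)
          (planarDot (x₁ - w) δ) (planarDot (x₂ - w) δ) z) ∂stdPlanar)
        - ∫ z, tangentIntercept α (shiftedRatio (q / (1 - q)) (x₁ - w) (x₂ - w) 0 0 z) ∂stdPlanar)
      ≤ planarPower α q x₁ x₂ (w + δ) - planarPower α q x₁ x₂ w := by
  have hq' : q ∈ Set.Icc (0 : ℝ) 1 := ⟨hq.1.le, hq.2.le⟩
  let T : ℝ × ℝ → ℝ := fun z => mixDensity q x₁ w z / mixDensity q x₂ w z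
  have hpos := fun x w z => mixDensity_pos hq' x w z
  have hT : ∀ δ z, T (z + (w + δ)) = shiftedRatio (q / (1 - q)) (x₁ - w) (x₂ - w)
      (planarDot (x₁ - w) δ) (planarDot (x₂ - w) δ) z := by
    intro δ z
    simp only [T]
    rw [mixDensity_shift hq, mixDensity_shift hq, shiftedRatio, mul_div_mul_left]
    exact (mul_pos (planarDensity_pos _ _) (sub_pos.2 hq.2)).ne'
  have hI : ∀ δ, ∫ z, planarDensity (w + δ) z * tangentIntercept α (T z) ∂stdPlanar
      = ∫ z, tangentIntercept α (shiftedRatio (q / (1 - q)) (x₁ - w) (x₂ - w)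
          (planarDot (x₁ - w) δ) (planarDot (x₂ - w) δ) z) ∂stdPlanar := by
    intro δ
    rw [← integral_comp_add_stdPlanar (w + δ) fun z => tangentIntercept α (T z)]
    simp_rw [hT]
  have cT : ∃ L, ExpControlled L T := by
    have h := fun x => expControlled_mixDensity hq' (L := ‖x‖ + ‖w‖) (x := x) (w := w)
      ((norm_fst_le x).trans (le_add_of_nonneg_right (norm_nonneg w)))
      ((norm_snd_le x).trans (le_add_of_nonneg_right (norm_nonneg w)))
      ((norm_fst_le w).trans (le_add_of_nonneg_left (norm_nonneg x)))
      ((norm_snd_le w).trans (le_add_of_nonneg_left (norm_nonneg x)))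
    have := (h x₁).mul ((h x₂).rpow (-1))
    simp only [Real.rpow_neg_one, ← div_eq_mul_inv] at this
    exact ⟨_, this⟩
  obtain ⟨L, cT⟩ := cT
  have mT : Measurable T := by simp only [T]; fun_prop
  have iT : ∀ δ, Integrable (fun z => planarDensity (w + δ) z * tangentIntercept α (T z))
      stdPlanar := by
    intro δ
    have cD := expControlled_planarDensity (norm_fst_le (w + δ)) (norm_snd_le (w + δ))
    have h1 := ((cD.mul (cT.rpow (α - 1))).integrable hasExpMoments_stdPlanar
      (Measurable.aestronglyMeasurable (by fun_prop))).const_mul α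
    have h2 := ((cD.mul (cT.rpow α)).integrable hasExpMoments_stdPlanar
      (Measurable.aestronglyMeasurable (by fun_prop))).const_mul (α - 1)
    refine (h1.sub h2).congr (.of_forall fun z => ?_)
    simp only [tangentIntercept, Pi.sub_apply]
    ring
  have h0 := hI 0
  simp only [planarDot, Prod.fst_zero, Prod.snd_zero, mul_zero, add_zero] at h0
  rw [← hI δ, ← h0, planarPower, planarPower, ← integral_sub (integrable_powerIntegrand α hq' _ _ _)
    (integrable_powerIntegrand α hq' _ _ _), ← integral_sub (iT δ) (by simpa using iT 0),
    ← integral_const_mul]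
  refine integral_mono (((iT δ).sub (by simpa using iT 0)).const_mul _)
    ((integrable_powerIntegrand α hq' _ _ _).sub (integrable_powerIntegrand α hq' _ _ _))
    fun z => ?_
  have tan := tangent_perspective hα (hpos x₁ (w + δ) z).le (hpos x₂ (w + δ) z) (cT.pos z).le
  have eq : α * T z ^ (α - 1) * mixDensity q x₁ w z - (α - 1) * T z ^ α * mixDensity q x₂ w z
      = powerIntegrand α q x₁ x₂ w z := by
    have hQ := hpos x₂ w z
    have e1 : mixDensity q x₁ w z = T z * mixDensity q x₂ w z := by
      simp only [T]; field_simp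
    have e2 : T z ^ (α - 1) * T z = T z ^ α := by
      rw [← Real.rpow_add_one (cT.pos z).ne']; ring_nf
    rw [powerIntegrand, ← div_rpow_mul_self (hpos x₁ w z).le hQ]
    change _ = T z ^ α * _
    rw [e1]
    linear_combination α * mixDensity q x₂ w z * e2
  have e : ∀ x, mixDensity q x (w + δ) z
      = mixDensity q x w z + (1 - q) * (planarDensity (w + δ) z - planarDensity w z) := by
    intro x; simp only [mixDensity]; ring
  rw [e, e] at tan
  have e' : powerIntegrand α q x₁ x₂ (w + δ) z
      = mixDensity q x₁ (w + δ) z ^ α * mixDensity q x₂ (w + δ) z ^ (1 - α) := rfl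
  rw [← e, ← e, ← e'] at tan
  simp only [e] at tan
  simp only [tangentIntercept]
  linarith

/-- Differentiation of the displaced tangent functional along a curve. -/
lemma hasDerivAt_integral_tangentIntercept {α k : ℝ} (hα : 1 < α) (hk : 0 < k) (u v : ℝ × ℝ)
    {θ₁ θ₂ θ₁' θ₂' : ℝ → ℝ} (hd₁ : ∀ t, HasDerivAt θ₁ (θ₁' t) t)
    (hd₂ : ∀ t, HasDerivAt θ₂ (θ₂' t) t) (hc₁ : Continuous θ₁') (hc₂ : Continuous θ₂') {t₀ : ℝ}
    (h₁ : θ₁ t₀ = 0) (h₂ : θ₂ t₀ = 0) :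
    let T := shiftedRatio k u v 0 0
    let F' : ℝ × ℝ → ℝ := fun z => α * (α - 1) * (T z ^ (α - 1) - T z ^ α)
      * (θ₁' t₀ * (k * planarDensity u z / (1 + k * planarDensity u z))
        - θ₂' t₀ * (k * planarDensity v z / (1 + k * planarDensity v z)))
    Integrable F' stdPlanar ∧
    HasDerivAt (fun t => ∫ z, tangentIntercept α (shiftedRatio k u v (θ₁ t) (θ₂ t) z) ∂stdPlanar)
      (∫ z, F' z ∂stdPlanar) t₀ := by
  obtain ⟨L, hL⟩ := expControlled_shiftedRatio hk u v
  set M := |θ₁' t₀| + |θ₂' t₀| + 2 with hM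
  have hM0 : 0 ≤ M := by positivity
  have hθ₁ : Continuous θ₁ := continuous_iff_continuousAt.2 fun t => (hd₁ t).continuousAt
  have hθ₂ : Continuous θ₂ := continuous_iff_continuousAt.2 fun t => (hd₂ t).continuousAt
  -- Near `t₀` the displacements stay below one and the speeds below `M`, which gives one integrable
  -- bound for all derivatives.
  let s : Set ℝ := {t | |θ₁ t| < 1 ∧ |θ₂ t| < 1 ∧ |θ₁' t| + |θ₂' t| < M}
  have hs : s ∈ nhds t₀ := by
    refine IsOpen.mem_nhds ?_ ⟨by simp [h₁], by simp [h₂], by linarith⟩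
    exact (isOpen_lt hθ₁.abs continuous_const).inter ((isOpen_lt hθ₂.abs continuous_const).inter
      (isOpen_lt (hc₁.abs.add hc₂.abs) continuous_const))
  let x : ℝ → ℝ × ℝ → ℝ := fun t z => k * planarDensity u z * Real.exp (θ₁ t)
  let b : ℝ → ℝ × ℝ → ℝ := fun t z => k * planarDensity v z * Real.exp (θ₂ t)
  have hx : ∀ t z, 0 < x t z := fun t z =>
    mul_pos (mul_pos hk (planarDensity_pos _ _)) (Real.exp_pos _)
  have hb : ∀ t z, 0 < b t z := fun t z =>
    mul_pos (mul_pos hk (planarDensity_pos _ _)) (Real.exp_pos _)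
  let T : ℝ → ℝ × ℝ → ℝ := fun t => shiftedRatio k u v (θ₁ t) (θ₂ t)
  have hT : ∀ t z, 0 < T t z := fun t z => shiftedRatio_pos hk _ _ _ _ _
  have mT : ∀ t, Measurable (T t) := fun t => measurable_shiftedRatio _ _ _ _ _
  let F' : ℝ → ℝ × ℝ → ℝ := fun t z => α * (α - 1) * (T t z ^ (α - 1) - T t z ^ α)
      * (θ₁' t * (x t z / (1 + x t z)) - θ₂' t * (b t z / (1 + b t z)))
  let bound : ℝ × ℝ → ℝ := fun z => α * (α - 1) * M
    * (Real.exp (|α - 1| * L) * Real.exp (|α - 1| * L * ‖z‖)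
      + Real.exp (|α| * L) * Real.exp (|α| * L * ‖z‖))
  have key := hasDerivAt_integral_of_dominated_loc_of_deriv_le (μ := stdPlanar)
    (F := fun t z => tangentIntercept α (T t z)) (F' := F') (x₀ := t₀) (s := s) (bound := bound) hs
    (.of_forall fun t => ?_) ?_ ?_ (.of_forall fun z t ht => ?_) ?_ (.of_forall fun z t _ => ?_)
  · have e : F' t₀ = fun z => α * (α - 1) * (shiftedRatio k u v 0 0 z ^ (α - 1)
      - shiftedRatio k u v 0 0 z ^ α)
      * (θ₁' t₀ * (k * planarDensity u z / (1 + k * planarDensity u z))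
        - θ₂' t₀ * (k * planarDensity v z / (1 + k * planarDensity v z))) := by
      ext z
      simp only [F', T, x, b, h₁, h₂, Real.exp_zero, mul_one]
    rw [e] at key
    exact key
  · have := mT t
    unfold tangentIntercept
    exact Measurable.aestronglyMeasurable (by fun_prop)
  · have c : ExpControlled L (T t₀) := hL _ _ (by simp [h₁]) (by simp [h₂])
    have := mT t₀
    unfold tangentIntercept
    exact (((c.rpow (α - 1)).integrable hasExpMoments_stdPlanar
      (Measurable.aestronglyMeasurable (by fun_prop))).const_mul α).sub
      (((c.rpow α).integrable hasExpMoments_stdPlanar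
      (Measurable.aestronglyMeasurable (by fun_prop))).const_mul (α - 1))
  · have := mT t₀
    simp only [F', x, b]
    exact Measurable.aestronglyMeasurable (by fun_prop)
  · obtain ⟨ht1, ht2, ht3⟩ := ht
    have c : ExpControlled L (T t) := hL _ _ ht1.le ht2.le
    have b1 := (c.rpow (α - 1)).abs_le z
    have b2 := (c.rpow α).abs_le z
    have frac : ∀ y : ℝ, 0 < y → |y / (1 + y)| ≤ 1 := fun y hy => by
      rw [abs_of_pos (by positivity), div_le_one (by positivity)]; linarith
    have b3 : |θ₁' t * (x t z / (1 + x t z)) - θ₂' t * (b t z / (1 + b t z))| ≤ M := by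
      refine (abs_sub _ _).trans ?_
      rw [abs_mul, abs_mul]
      have f1 := mul_le_mul_of_nonneg_left (frac _ (hx t z)) (abs_nonneg (θ₁' t))
      have f2 := mul_le_mul_of_nonneg_left (frac _ (hb t z)) (abs_nonneg (θ₂' t))
      linarith
    have b4 : |T t z ^ (α - 1) - T t z ^ α| ≤ _ := (abs_sub _ _).trans (add_le_add b1 b2)
    simp only [F', bound]
    rw [Real.norm_eq_abs, abs_mul, abs_mul, abs_of_pos (by nlinarith : 0 < α * (α - 1))]
    calc _ ≤ α * (α - 1) * _ * M :=
          mul_le_mul (mul_le_mul_of_nonneg_left b4 (by nlinarith)) b3 (abs_nonneg _) (by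
            have : 0 < α * (α - 1) := by nlinarith
            positivity)
      _ = _ := by ring
  · exact (((hasExpMoments_stdPlanar _).const_mul _).add
      ((hasExpMoments_stdPlanar _).const_mul _)).const_mul _
  · have d1 : HasDerivAt (fun t => 1 + x t z) (x t z * θ₁' t) t := by
      have := ((hd₁ t).exp.const_mul (k * planarDensity u z)).const_add 1
      refine this.congr_deriv ?_
      simp only [x]; ring
    have d2 : HasDerivAt (fun t => 1 + b t z) (b t z * θ₂' t) t := by
      have := ((hd₂ t).exp.const_mul (k * planarDensity v z)).const_add 1
      refine this.congr_deriv ?_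
      simp only [b]; ring
    have hN : 0 < 1 + x t z := by linarith [hx t z]
    have hD : 0 < 1 + b t z := by linarith [hb t z]
    have d3 := d1.div d2 hD.ne'
    have d4 : HasDerivAt (fun t => T t z)
        (T t z * (θ₁' t * (x t z / (1 + x t z)) - θ₂' t * (b t z / (1 + b t z)))) t := by
      refine d3.congr_deriv ?_
      have : T t z = (1 + x t z) / (1 + b t z) := rfl
      rw [this]
      field_simp
    have r1 := (d4.rpow_const (p := α - 1) (.inl (hT t z).ne')).const_mul α
    have r2 := (d4.rpow_const (p := α) (.inl (hT t z).ne')).const_mul (α - 1)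
    refine (r1.sub r2).congr_deriv ?_
    have e1 : T t z ^ (α - 1 - 1) * T t z = T t z ^ (α - 1) := by
      rw [← Real.rpow_add_one (hT t z).ne']; ring_nf
    have e2 : T t z ^ (α - 1) * T t z = T t z ^ α := by
      rw [← Real.rpow_add_one (hT t z).ne']; ring_nf
    simp only [F']
    linear_combination (α * (α - 1) * (θ₁' t * (x t z / (1 + x t z))
      - θ₂' t * (b t z / (1 + b t z)))) * (e1 - e2)

end FirstVariation

/-! ### Monotonicity of the power divergence along a circle. -/

section Flow

lemma one_add_mul_planarDensity_inv {k : ℝ} (hk : 0 < k) (v z : ℝ × ℝ) :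
    (1 + k * planarDensity v z)⁻¹
      = (-(Real.log k + planarDot v z - planarDot v v / 2)).sigmoid := by
  rw [Real.sigmoid_def, neg_neg, planarDensity, shiftDensity, shiftDensity, ← Real.exp_add]
  nth_rewrite 1 [← Real.exp_log hk]
  rw [← Real.exp_add]
  simp only [planarDot]
  ring_nf

/-- Under `N(p, I)` the log odds are Gaussian with variance `planarDot v v`, so the planar average
is one-dimensional. -/
lemma integral_planarDensity_mul_logit {f : ℝ → ℝ} (hf : Measurable f) (l : ℝ) (v p : ℝ × ℝ) :
    ∫ z, planarDensity p z * f (-(l + planarDot v z - planarDot v v / 2)) ∂stdPlanar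
      = ∫ z, f (√(planarDot v v) * z + (planarDot v v / 2 - planarDot v p - l)) ∂stdNormal := by
  rw [← integral_comp_add_stdPlanar p fun z => f (-(l + planarDot v z - planarDot v v / 2))]
  have hn : 0 ≤ planarDot v v := add_nonneg (mul_self_nonneg _) (mul_self_nonneg _)
  have h := map_linear_stdPlanar (-v.1) (-v.2) (r := √(planarDot v v)) (by
    rw [Real.sq_sqrt hn, planarDot]; ring)
  set m := planarDot v v / 2 - planarDot v p - l with hm
  have hfm : Measurable fun x => f (x + m) := hf.comp (by fun_prop)
  have e := congrArg (fun μ => ∫ x, f (x + m) ∂μ) h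
  rw [integral_map (by fun_prop) hfm.aestronglyMeasurable,
    integral_map (by fun_prop) hfm.aestronglyMeasurable] at e
  rw [← e]
  refine integral_congr_ae (.of_forall fun z => ?_)
  simp only
  congr 1
  rw [hm]
  simp only [planarDot, Prod.fst_add, Prod.snd_add]
  ring

lemma integrable_planarDensity_mul {f : ℝ × ℝ → ℝ} (p : ℝ × ℝ) (hf : Continuous f) {C : ℝ}
    (hC : ∀ z, |f z| ≤ C) : Integrable (fun z => planarDensity p z * f z) stdPlanar :=
  ((expControlled_planarDensity (norm_fst_le p) (norm_snd_le p)).integrable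
    hasExpMoments_stdPlanar (Continuous.aestronglyMeasurable (by fun_prop))).mul_bdd (c := C)
    hf.aestronglyMeasurable (.of_forall hC)

/-- The weighted sum of the two component derivatives along the flow is nonnegative. -/
lemma integral_shiftedRatio_sub_one_nonneg {k : ℝ} (hk : 0 < k) {u v : ℝ × ℝ}
    (hc : 0 ≤ planarDot u v) (hY : planarDot u v < planarDot v v)
    (hXY : planarDot v v ≤ planarDot u u) :
    let G : ℝ × ℝ → ℝ := fun z => (shiftedRatio k u v 0 0 z - 1)
        * ((planarDot v v - planarDot u v) * planarDot u u
            * (k * planarDensity u z / (1 + k * planarDensity u z))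
          + (planarDot u u - planarDot u v) * planarDot v v
            * (k * planarDensity v z / (1 + k * planarDensity v z)))
    Integrable G stdPlanar ∧ 0 ≤ ∫ z, G z ∂stdPlanar := by
  intro G
  set c := planarDot u v with hcdef
  set nu := planarDot u u with hnu
  set nv := planarDot v v with hnv
  set l := Real.log k
  let σu : ℝ × ℝ → ℝ := fun z => (-(l + planarDot u z - nu / 2)).sigmoid
  let σv : ℝ × ℝ → ℝ := fun z => (-(l + planarDot v z - nv / 2)).sigmoid
  let σv' : ℝ × ℝ → ℝ := fun z => sigmoidDeriv (-(l + planarDot v z - nv / 2))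
  have cu : Continuous σu := by simp only [σu, planarDot]; fun_prop
  have cv : Continuous σv := by simp only [σv, planarDot]; fun_prop
  have cv' : Continuous σv' := by simp only [σv', planarDot]; fun_prop
  have i1 : Integrable (fun z => planarDensity u z * σv z) stdPlanar :=
    integrable_planarDensity_mul u cv fun z => abs_sigmoid_le _
  have i2 : Integrable (fun z => planarDensity u z * σu z) stdPlanar :=
    integrable_planarDensity_mul u cu fun z => abs_sigmoid_le _
  have i3 : Integrable (fun z => planarDensity u z * σv' z) stdPlanar :=
    integrable_planarDensity_mul u cv' fun z => abs_sigmoidDeriv_le _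
  have i4 : Integrable (fun z => planarDensity v z * σv' z) stdPlanar :=
    integrable_planarDensity_mul v cv' fun z => abs_sigmoidDeriv_le _
  -- In terms of the posterior probabilities `σu`, `σv` of the common component, the products with
  -- the likelihood ratio split into densities times logistic values.
  have hG : ∀ z, G z = (nv - c) * nu * k * (planarDensity u z * σv z - planarDensity u z * σu z)
      + (nu - c) * nv * k * (planarDensity u z * σv' z - planarDensity v z * σv' z) := by
    intro z
    have eu : σu z = (1 + k * planarDensity u z)⁻¹ := (one_add_mul_planarDensity_inv hk u z).symm
    have ev : σv z = (1 + k * planarDensity v z)⁻¹ := (one_add_mul_planarDensity_inv hk v z).symm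
    have ev' : σv' z = σv z * (1 - σv z) := rfl
    rw [ev', ev, eu]
    simp only [G, shiftedRatio, Real.exp_zero, mul_one]
    have h1 : 1 + k * planarDensity u z ≠ 0 := by
      have := mul_pos hk (planarDensity_pos u z); positivity
    have h2 : 1 + k * planarDensity v z ≠ 0 := by
      have := mul_pos hk (planarDensity_pos v z); positivity
    field_simp
    ring
  have iG : Integrable G stdPlanar := by
    refine (((i1.sub i2).const_mul ((nv - c) * nu * k)).add
      ((i3.sub i4).const_mul ((nu - c) * nv * k))).congr (.of_forall fun z => ?_)
    rw [hG]
    rfl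
  refine ⟨iG, ?_⟩
  have e1 := integral_planarDensity_mul_logit continuous_realSigmoid.measurable l v u
  have e2 := integral_planarDensity_mul_logit continuous_realSigmoid.measurable l u u
  have e3 := integral_planarDensity_mul_logit continuous_sigmoidDeriv.measurable l v u
  have e4 := integral_planarDensity_mul_logit continuous_sigmoidDeriv.measurable l v v
  have comm : planarDot v u = c := by rw [hcdef]; simp only [planarDot]; ring
  rw [← hnv, comm] at e1 e3
  rw [← hnu] at e2
  rw [← hnv] at e4
  have i12 : Integrable (fun z => planarDensity u z * σv z - planarDensity u z * σu z)
    stdPlanar := i1.sub i2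
  have i34 : Integrable (fun z => planarDensity u z * σv' z - planarDensity v z * σv' z)
    stdPlanar := i3.sub i4
  simp_rw [hG]
  rw [integral_add (i12.const_mul _) (i34.const_mul _), integral_const_mul,
    integral_const_mul, integral_sub i1 i2, integral_sub i3 i4]
  simp only [σu, σv, σv']
  rw [e1, e2, e3, e4]
  change 0 ≤ (nv - c) * nu * k * (logisticNormal √nv (nv / 2 - c - l)
      - logisticNormal √nu (nu / 2 - nu - l))
    + (nu - c) * nv * k * (logisticNormalDeriv √nv (nv / 2 - c - l)
      - logisticNormalDeriv √nv (nv / 2 - nv - l))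
  -- The parameters are `X = nu - c`, `Y = nv - c` and `L = -(l + c / 2)`; the arguments come out
  -- with opposite signs, which the symmetry of the logistic function repairs.
  have main := logisticNormal_inequality (L := -(l + c / 2)) hc (sub_pos.2 hY)
    (sub_le_sub_right hXY c)
  rw [add_sub_cancel, add_sub_cancel] at main
  rw [show (nv - c) / 2 - -(l + c / 2) = -(nv / 2 - nv - l) by ring,
    show -(nv - c) / 2 - -(l + c / 2) = -(nv / 2 - c - l) by ring,
    show (nu - c) / 2 - -(l + c / 2) = -(nu / 2 - nu - l) by ring,
    logisticNormalDeriv_neg, logisticNormalDeriv_neg, logisticNormal_neg, logisticNormal_neg] at main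
  have := mul_le_mul_of_nonneg_left main hk.le
  linarith

/-- A smooth function with nonnegative derivative that supports `F` from below at `x` controls the
right slopes of `F`. The slope criterion for `-F` then applies, so `F` itself need not be
differentiated. -/
lemma mono_of_lower_tangent {F : ℝ → ℝ} {a b m : ℝ} (hab : a ≤ b) (hm : 0 ≤ m)
    (hF : ContinuousOn F (Set.Icc a b))
    (h : ∀ x ∈ Set.Ico a b, ∃ (ψ : ℝ → ℝ) (d : ℝ), HasDerivAt ψ d x ∧ 0 ≤ d ∧
      ∀ t, m * (ψ t - ψ x) ≤ F t - F x) : F a ≤ F b := by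
  have := image_le_of_liminf_slope_right_le_deriv_boundary (f := fun t => -F t)
    (B := fun _ => -F a) (B' := fun _ => 0) hF.neg le_rfl
    continuousOn_const (fun x _ => hasDerivWithinAt_const _ _ _) (fun x hx r hr => ?_)
    (Set.right_mem_Icc.2 hab)
  · simpa using this
  · obtain ⟨ψ, d, hd, hd0, hψ⟩ := h x hx
    have hlim : Filter.Tendsto (slope ψ x) (nhdsWithin x (Set.Ioi x)) (nhds d) :=
      (hasDerivAt_iff_tendsto_slope.1 hd).mono_left
        (nhdsWithin_mono x fun y hy => (ne_of_gt hy : y ≠ x))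
    have hlim2 := (hlim.const_mul (-m))
    have hneg : -m * d < r := by nlinarith [mul_nonneg hm hd0]
    have ev := (hlim2.eventually_lt_const hneg).and self_mem_nhdsWithin
    refine ev.frequently.mono fun t ht => lt_of_le_of_lt ?_ ht.1
    have ht0 : 0 < t - x := sub_pos.2 ht.2
    simp only [slope_def_field]
    rw [mul_div_assoc']
    refine div_le_div_of_nonneg_right ?_ ht0.le
    linarith [hψ t]

lemma continuous_planarPower_comp (α : ℝ) {q : ℝ} (hq : q ∈ Set.Icc (0 : ℝ) 1) (x₁ x₂ : ℝ × ℝ)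
    {w : ℝ → ℝ × ℝ} (hw : Continuous w) {C : ℝ} (hC : ∀ t, ‖w t‖ ≤ C) :
    Continuous fun t => planarPower α q x₁ x₂ (w t) := by
  set L := ‖x₁‖ + ‖x₂‖ + C
  have hC0 : 0 ≤ C := (norm_nonneg _).trans (hC 0)
  have c := fun t => expControlled_powerIntegrand α hq (L := L) (x₁ := x₁) (x₂ := x₂) (w := w t)
    (by simp only [L]; linarith [norm_nonneg x₂]) (by simp only [L]; linarith [norm_nonneg x₁])
    (by simp only [L]; linarith [norm_nonneg x₂, norm_nonneg x₁, hC t])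
  refine continuous_of_dominated (fun t => (integrable_powerIntegrand α hq _ _ _).1)
    (fun t => .of_forall fun z => (c t).abs_le z) ((hasExpMoments_stdPlanar _).const_mul _)
    (.of_forall fun z => ?_)
  exact continuous_const.powerIntegrand α hq continuous_const hw continuous_const

/-- Since `T ^ (α - 1) * (T - 1) ≥ T - 1`, the order `α` disappears from the sign question. -/
lemma sub_one_mul_le_rpow_sub_rpow {α T K p r A B : ℝ} (hα : 1 < α) (hT : 0 < T) (hK : 0 < K)
    (hp : 0 ≤ p) (hr : 0 ≤ r) (hA : 0 ≤ A) (hB : 0 ≤ B) :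
    α * (α - 1) / K * ((T - 1) * (K * p * A + K * r * B))
      ≤ α * (α - 1) * (T ^ (α - 1) - T ^ α) * (-p * A - r * B) := by
  have hα0 : 0 ≤ α * (α - 1) := mul_nonneg (by linarith) (by linarith)
  have hT1 : T - 1 ≤ T ^ α - T ^ (α - 1) := by
    have e : T ^ α = T ^ (α - 1) * T := by rw [← Real.rpow_add_one hT.ne']; ring_nf
    rw [e]
    rcases le_total 1 T with h1 | h1
    · have := Real.one_le_rpow h1 (by linarith : 0 ≤ α - 1)
      nlinarith
    · have := Real.rpow_le_one hT.le h1 (by linarith : 0 ≤ α - 1)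
      nlinarith
  have hAB : 0 ≤ p * A + r * B := add_nonneg (mul_nonneg hp hA) (mul_nonneg hr hB)
  have := mul_le_mul_of_nonneg_left (mul_le_mul_of_nonneg_right hT1 hAB) hα0
  refine le_trans (le_of_eq ?_) (this.trans (le_of_eq ?_))
  · field_simp
  · ring

/-- The circle has center `(0, R cos t)` and radius `R` and passes through both outer means. The
common mean travels to the point opposite to the first mean, where the angle at the second mean is
right. -/
lemma planarPower_flow {α q R s t : ℝ} (hα : 1 < α) (hq : q ∈ Set.Ioo (0 : ℝ) 1) (hR : 0 < R)
    (hs : 0 ≤ s) (hst : s ≤ t) (ht : t ≤ Real.pi / 2) :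
    planarPower α q (R * Real.sin t, 0) (-(R * Real.sin t), 0)
        (-(R * Real.sin s), R * Real.cos t + R * Real.cos s)
      ≤ planarPower α q (R * Real.sin t, 0) (-(R * Real.sin t), 0)
        (-(R * Real.sin t), 2 * (R * Real.cos t)) := by
  have hq' : q ∈ Set.Icc (0 : ℝ) 1 := ⟨hq.1.le, hq.2.le⟩
  set h := R * Real.sin t with hh
  set η := R * Real.cos t with hη
  have hη0 : 0 ≤ η := mul_nonneg hR.le (Real.cos_nonneg_of_mem_Icc ⟨by linarith, ht⟩)
  let w : ℝ → ℝ × ℝ := fun x => (-(R * Real.sin x), η + R * Real.cos x)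
  have hwc : Continuous w := by fun_prop
  have hwb : ∀ x, ‖w x‖ ≤ |R| + |η| := by
    intro x
    have h1 : |R * Real.sin x| ≤ |R| := by
      rw [abs_mul]; exact mul_le_of_le_one_right (abs_nonneg _) (Real.abs_sin_le_one x)
    have h2 : |R * Real.cos x| ≤ |R| := by
      rw [abs_mul]; exact mul_le_of_le_one_right (abs_nonneg _) (Real.abs_cos_le_one x)
    rw [Prod.norm_def, Real.norm_eq_abs, Real.norm_eq_abs]
    refine max_le ?_ ?_
    · simp only [w, abs_neg]; linarith [abs_nonneg η]
    · simp only [w]; linarith [abs_add_le η (R * Real.cos x)]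
  have key : planarPower α q (h, 0) (-h, 0) (w s) ≤ planarPower α q (h, 0) (-h, 0) (w t) := by
    refine mono_of_lower_tangent (F := fun x => planarPower α q (h, 0) (-h, 0) (w x)) (m := 1 - q)
      hst (sub_nonneg.2 hq.2.le) (continuous_planarPower_comp α hq' _ _ hwc hwb).continuousOn
      fun x hx => ?_
    set κ := R * Real.sin x with hκ
    set C := R * Real.cos x with hC
    have hκ0 : 0 ≤ κ := mul_nonneg hR.le (Real.sin_nonneg_of_nonneg_of_le_pi (hs.trans hx.1)
      (by linarith [hx.2, Real.pi_pos]))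
    have hκh : κ < h := mul_lt_mul_of_pos_left
      (Real.sin_lt_sin_of_lt_of_le_pi_div_two (by linarith [hx.1, Real.pi_pos]) ht hx.2) hR
    have hCη : η < C := mul_lt_mul_of_pos_left
      (Real.cos_lt_cos_of_nonneg_of_le_pi (hs.trans hx.1) (by linarith [Real.pi_pos]) hx.2) hR
    have hcirc : κ ^ 2 + C ^ 2 = h ^ 2 + η ^ 2 := by
      have h1 := Real.sin_sq_add_cos_sq x
      have h2 := Real.sin_sq_add_cos_sq t
      rw [hκ, hC, hh, hη]
      linear_combination R ^ 2 * h1 - R ^ 2 * h2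
    set τ := η + C with hτ
    have hτ0 : 0 < τ := by linarith
    have hh0 : 0 < h := by linarith
    set u : ℝ × ℝ := (h, 0) - w x with hu
    set v : ℝ × ℝ := (-h, 0) - w x with hv
    have hu' : u = (h + κ, -τ) := by simp [hu, w, hκ, hτ, hC]
    have hv' : v = (κ - h, -τ) := by
      rw [hv]; simp only [w, hκ, hτ, hC, Prod.mk_sub_mk]; ring_nf
    let θ : ℝ × ℝ → ℝ → ℝ := fun u y => planarDot u (w y - w x)
    let θ' : ℝ × ℝ → ℝ → ℝ := fun u y => u.1 * -(R * Real.cos y) + u.2 * (R * -Real.sin y)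
    have hd : ∀ u y, HasDerivAt (θ u) (θ' u y) y := by
      intro u y
      have d1 := ((((Real.hasDerivAt_sin y).const_mul R).neg).sub_const (w x).1).const_mul u.1
      have d2 := ((((Real.hasDerivAt_cos y).const_mul R).const_add η).sub_const (w x).2).const_mul u.2
      exact d1.add d2
    have hc : ∀ u, Continuous (θ' u) := fun u => by simp only [θ']; fun_prop
    have h0 : ∀ u, θ u x = 0 := fun u => by simp [θ, planarDot]
    set k := q / (1 - q) with hk
    have hk0 : 0 < k := div_pos hq.1 (sub_pos.2 hq.2)
    obtain ⟨iF, dF⟩ := hasDerivAt_integral_tangentIntercept hα hk0 u v (hd u) (hd v) (hc u) (hc v)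
      (h0 u) (h0 v)
    refine ⟨_, _, dF, ?_, fun y => ?_⟩
    · have dotuv : planarDot u v = 2 * η * τ := by
        rw [hu', hv', planarDot]; simp only
        rw [hτ]; linear_combination hcirc
      have dotuu : planarDot u u = 2 * η * τ + 2 * h * (h + κ) := by
        rw [← dotuv, hu', hv']; simp only [planarDot]; ring
      have dotvv : planarDot v v = 2 * η * τ + 2 * h * (h - κ) := by
        rw [← dotuv, hu', hv']; simp only [planarDot]; ring
      have e1 : θ' u x = -(h * C - η * κ) := by
        simp only [θ', hu']; rw [← hC, hτ]; linear_combination (η + C) * hκ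
      have e2 : θ' v x = h * C + η * κ := by
        simp only [θ', hv']; rw [← hC, hτ]; linear_combination (η + C) * hκ
      have hp : 0 ≤ h * C - η * κ := by
        rw [sub_nonneg, mul_comm η]
        exact mul_le_mul hκh.le hCη.le hη0 hh0.le
      have hr : 0 ≤ h * C + η * κ :=
        add_nonneg (mul_nonneg hh0.le (hη0.trans hCη.le)) (mul_nonneg hη0 hκ0)
      obtain ⟨iG, hG⟩ := integral_shiftedRatio_sub_one_nonneg hk0 (u := u) (v := v)
        (by rw [dotuv]; positivity) (by rw [dotuv, dotvv]; linarith [mul_pos hh0 (sub_pos.2 hκh)])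
        (by rw [dotvv, dotuu]; linarith [mul_nonneg hh0.le hκ0])
      -- Up to the common factor `4 * h * τ`, the speeds of the two log-likelihood displacements
      -- are, in absolute value, the weights of `integral_shiftedRatio_sub_one_nonneg`.
      have r1 : (planarDot v v - planarDot u v) * planarDot u u
          = 4 * h * τ * (h * C - η * κ) := by
        rw [dotvv, dotuu, dotuv, hτ]; linear_combination (-4 * h ^ 2) * hcirc
      have r2 : (planarDot u u - planarDot u v) * planarDot v v
          = 4 * h * τ * (h * C + η * κ) := by
        rw [dotvv, dotuu, dotuv, hτ]; linear_combination (-4 * h ^ 2) * hcirc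
      have hpos : 0 < 4 * h * τ := by positivity
      have hα0 : 0 ≤ α * (α - 1) := mul_nonneg (by linarith) (by linarith)
      refine le_trans (mul_nonneg (div_nonneg hα0 hpos.le) hG) ?_
      rw [← integral_const_mul]
      refine integral_mono (iG.const_mul _) iF fun z => ?_
      simp only
      rw [e1, e2, r1, r2]
      have fr : ∀ p, 0 ≤ k * planarDensity p z / (1 + k * planarDensity p z) := fun p => by
        have := mul_pos hk0 (planarDensity_pos p z)
        positivity
      exact sub_one_mul_le_rpow_sub_rpow hα (shiftedRatio_pos hk0 u v 0 0 z) hpos hp hr (fr u) (fr v)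
    · have fv := planarPower_first_variation hα hq (h, 0) (-h, 0) (w x) (w y - w x)
      rw [add_sub_cancel] at fv
      refine le_trans (le_of_eq ?_) fv
      rw [h0 u, h0 v]
  have e : w t = (-h, 2 * η) := by simp only [w, hh, hη]; ring_nf
  rw [e] at key
  exact key

end Flow

/-! ### Triangles in a ball. -/

section Geometry

/-- Acute configurations: the power divergence is bounded through the circumscribed circle. -/
lemma planarPower_acute_le {α q h κ τ R : ℝ} (hα : 1 < α) (hq : q ∈ Set.Ioo (0 : ℝ) 1)
    (hτ : 0 < τ) (hκ : |κ| < h) (hc : h ^ 2 ≤ κ ^ 2 + τ ^ 2) (hR : 0 < R)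
    (hRe : R ^ 2 = h ^ 2 + ((κ ^ 2 + τ ^ 2 - h ^ 2) / (2 * τ)) ^ 2) :
    planarPower α q (h, 0) (-h, 0) (-κ, τ) ≤ gaussianPower α q (2 * R) := by
  have main : ∀ κ : ℝ, 0 ≤ κ → κ < h → h ^ 2 ≤ κ ^ 2 + τ ^ 2 →
      R ^ 2 = h ^ 2 + ((κ ^ 2 + τ ^ 2 - h ^ 2) / (2 * τ)) ^ 2 →
      planarPower α q (h, 0) (-h, 0) (-κ, τ) ≤ gaussianPower α q (2 * R) := by
    intro κ hκ0 hκh hc hRe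
    -- `(0, η)` is the circumcenter; `η ≥ 0` says that the angle at the common mean is not obtuse.
    set η := (κ ^ 2 + τ ^ 2 - h ^ 2) / (2 * τ) with hη
    have hη0 : 0 ≤ η := div_nonneg (by linarith) (by linarith)
    have hητ : 2 * η * τ = κ ^ 2 + τ ^ 2 - h ^ 2 := by rw [hη]; field_simp
    have hτη : 0 ≤ τ - η := by nlinarith
    have hhR : h ≤ R := abs_le_of_sq_le_sq' (by nlinarith [sq_nonneg η]) hR.le |>.2
    have hangle : ∀ y, 0 ≤ y → y ≤ R → R * Real.sin (Real.arcsin (y / R)) = y ∧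
        R * Real.cos (Real.arcsin (y / R)) = √(R ^ 2 - y ^ 2) := by
      intro y hy0 hyR
      have h1 : y / R ≤ 1 := (div_le_one hR).2 hyR
      have h2 : 0 ≤ y / R := div_nonneg hy0 hR.le
      constructor
      · rw [Real.sin_arcsin (by linarith) h1]; field_simp
      · rw [Real.cos_arcsin]
        nth_rewrite 1 [← Real.sqrt_sq hR.le]
        rw [← Real.sqrt_mul (sq_nonneg R)]
        congr 1
        field_simp
    obtain ⟨s1, s2⟩ := hangle κ hκ0 (hκh.le.trans hhR)
    obtain ⟨t1, t2⟩ := hangle h (hκ0.trans hκh.le) hhR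
    have e1 : R ^ 2 - κ ^ 2 = (τ - η) ^ 2 := by rw [hRe]; linear_combination hητ
    have e2 : R ^ 2 - h ^ 2 = η ^ 2 := by rw [hRe]; ring
    rw [e1, Real.sqrt_sq hτη] at s2
    rw [e2, Real.sqrt_sq hη0] at t2
    have flow := planarPower_flow hα hq hR
      (Real.arcsin_nonneg.2 (div_nonneg hκ0 hR.le))
      (Real.monotone_arcsin (div_le_div_of_nonneg_right hκh.le hR.le))
      (Real.arcsin_le_pi_div_two (h / R))
    rw [s1, s2, t1, t2, add_sub_cancel] at flow
    exact flow.trans (planarPower_rightAngle_le hα hq (by rw [mul_pow 2 R, hRe]; ring))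
  rcases le_total 0 κ with h0 | h0
  · exact main κ h0 ((abs_of_nonneg h0) ▸ hκ) hc hRe
  · have h1 := planarPower_swap (τ := τ) hα hq ((abs_nonneg κ).trans hκ.le) (neg_nonneg.2 h0)
    refine h1.trans (main (-κ) (neg_nonneg.2 h0) ((abs_of_nonpos h0) ▸ hκ) ?_ ?_)
    · simpa using hc
    · simpa using hRe

variable {d : ℕ}

lemma norm_sq_smul_add_smul (a b : ℝ) (S T : Emb d) :
    ‖a • S + b • T‖ ^ 2 = a ^ 2 * ‖S‖ ^ 2 + 2 * (a * b * inner ℝ S T) + b ^ 2 * ‖T‖ ^ 2 := by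
  rw [norm_add_sq_real, norm_smul, norm_smul, real_inner_smul_left, real_inner_smul_right,
    mul_pow, mul_pow, Real.norm_eq_abs, Real.norm_eq_abs, sq_abs, sq_abs]
  ring

/-- Among three points of a ball, an acute (or right) triangle has circumradius at most the radius
of the ball. -/
lemma circumradius_sq_le {u v o : Emb d} {ρ : ℝ} (h0 : ‖o‖ ≤ ρ) (hu : ‖u - o‖ ≤ ρ)
    (hv : ‖v - o‖ ≤ ρ) (hc : 0 ≤ inner ℝ u v) (hcu : inner ℝ u v ≤ ‖u‖ ^ 2)
    (hcv : inner ℝ u v ≤ ‖v‖ ^ 2) (hΔ : 0 < ‖u‖ ^ 2 * ‖v‖ ^ 2 - inner ℝ u v ^ 2) :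
    ‖u‖ ^ 2 * ‖v‖ ^ 2 * (‖u‖ ^ 2 + ‖v‖ ^ 2 - 2 * inner ℝ u v)
      ≤ 4 * (‖u‖ ^ 2 * ‖v‖ ^ 2 - inner ℝ u v ^ 2) * ρ ^ 2 := by
  have sq : ∀ {x : Emb d}, ‖x‖ ≤ ρ → ‖x‖ ^ 2 ≤ ρ ^ 2 := fun h =>
    pow_le_pow_left₀ (norm_nonneg _) h 2
  have k0 := sq h0
  have ku := sq hu
  have kv := sq hv
  rw [norm_sub_sq_real] at ku kv
  set c := inner ℝ u v with hcdef
  set U := ‖u‖ ^ 2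
  set V := ‖v‖ ^ 2
  set Δ := U * V - c ^ 2 with hΔdef
  set s := V * (U - c) with hs
  set t := U * (V - c) with ht
  have hU : 0 ≤ U := sq_nonneg _
  have hV : 0 ≤ V := sq_nonneg _
  have hs0 : 0 ≤ s := mul_nonneg hV (by linarith)
  have ht0 : 0 ≤ t := mul_nonneg hU (by linarith)
  have hl0 : 0 ≤ 2 * Δ - s - t := by
    have : 2 * Δ - s - t = c * ((U - c) + (V - c)) := by rw [hΔdef, hs, ht]; ring
    rw [this]
    exact mul_nonneg hc (by linarith)
  -- The circumcenter is `(s u + t v) / (2 Δ)`, with nonnegative barycentric weights `s`, `t`, `2 Δ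
  -- - s - t`. The weighted mean of the squared distances from `o` to the vertices is the squared
  -- circumradius plus the squared distance from `o` to the circumcenter.
  have hsq : 0 ≤ ‖(2 * Δ) • o - (s • u + t • v)‖ ^ 2 := sq_nonneg _
  rw [norm_sub_sq_real, norm_sq_smul_add_smul, inner_add_right, real_inner_smul_left,
    real_inner_smul_left, real_inner_smul_right, real_inner_smul_right, norm_smul, mul_pow,
    Real.norm_eq_abs, sq_abs, real_inner_comm u o, real_inner_comm v o] at hsq
  have a0 := mul_le_mul_of_nonneg_left k0 hl0
  have au := mul_le_mul_of_nonneg_left ku hs0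
  have av := mul_le_mul_of_nonneg_left kv ht0
  have hΔ2 : 0 < 2 * Δ := by linarith
  have total := mul_le_mul_of_nonneg_left (add_le_add (add_le_add a0 au) av) hΔ2.le
  rw [← hcdef] at hsq
  have id : 2 * Δ * (s * U + t * V) - (s ^ 2 * U + 2 * (s * t * c) + t ^ 2 * V)
      = Δ * (U * V * (U + V - 2 * c)) := by
    rw [hs, ht, hΔdef]; ring
  have : Δ * (U * V * (U + V - 2 * c)) ≤ Δ * (4 * Δ * ρ ^ 2) := by
    nlinarith
  exact le_of_mul_le_mul_left this hΔ

/-- The frame of an obtuse configuration contracts. -/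
lemma norm_sq_obtuse_frame_le {s p : Emb d} {l e ε : ℝ} (hl : 0 < l) (he : 0 ≤ e)
    (hε : ε ^ 2 = 1) (hpe : ‖p‖ ^ 2 ≤ e ^ 2) (hle : l ^ 2 = ‖s‖ ^ 2 - (‖p‖ ^ 2 - e ^ 2))
    (hin : inner ℝ s p = ε * (e ^ 2 - ‖p‖ ^ 2)) (x y : ℝ) :
    ‖x • (l⁻¹ • s) + y • (-(e⁻¹ • p))‖ ^ 2 ≤ x ^ 2 + y ^ 2 := by
  rw [norm_sq_smul_add_smul, norm_neg, norm_smul, norm_smul, inner_neg_right,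
    real_inner_smul_left, real_inner_smul_right, hin, mul_pow, mul_pow, norm_inv, norm_inv,
    Real.norm_eq_abs, Real.norm_eq_abs, inv_pow, inv_pow, sq_abs, sq_abs]
  have l0 := hl.ne'
  rcases he.eq_or_lt with rfl | he0
  · have hp : ‖p‖ ^ 2 = 0 := le_antisymm (by simpa using hpe) (sq_nonneg _)
    rw [hp] at hle ⊢
    have hs : ‖s‖ ^ 2 = l ^ 2 := by rw [hle]; ring
    rw [hs, inv_mul_cancel₀ (pow_ne_zero 2 l0)]
    simp only [inv_zero, zero_mul, mul_zero, neg_zero, mul_one, add_zero]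
    linarith [sq_nonneg y]
  · have hD : ‖s‖ ^ 2 = l ^ 2 + (‖p‖ ^ 2 - e ^ 2) := by linarith
    have e0 := he0.ne'
    rw [hD]
    -- This square is exactly the defect `x ^ 2 + y ^ 2` minus the squared norm of the image.
    have key : 0 ≤ (e ^ 2 - ‖p‖ ^ 2) * (x / l + ε * (y / e)) ^ 2 :=
      mul_nonneg (by linarith) (sq_nonneg _)
    have expand : (x / l + ε * (y / e)) ^ 2
        = x ^ 2 / l ^ 2 + 2 * ε * x * y / (l * e) + y ^ 2 / e ^ 2 := by
      have : (x / l + ε * (y / e)) ^ 2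
          = x ^ 2 / l ^ 2 + 2 * ε * x * y / (l * e) + ε ^ 2 * (y ^ 2 / e ^ 2) := by
        field_simp
        ring
      rw [this, hε, one_mul]
    rw [expand] at key
    rw [← sub_nonneg]
    refine key.trans_eq ?_
    field_simp
    ring

lemma smul_neg_inv_smul {p : Emb d} {e : ℝ} (hpe : ‖p‖ ^ 2 ≤ e ^ 2) :
    e • (-(e⁻¹ • p)) = -p := by
  rcases eq_or_ne e 0 with rfl | he
  · have : p = 0 := by
      rw [← norm_eq_zero, ← sq_eq_zero_iff]
      exact le_antisymm (by simpa using hpe) (sq_nonneg _)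
    simp [this]
  · rw [smul_neg, smul_smul, mul_inv_cancel₀ he, one_smul]

lemma norm_sq_orthogonal_frame_le {s g : Emb d} {τ : ℝ} (hs : s ≠ 0) (hτ : 0 < τ)
    (horth : inner ℝ s g = 0) (hg : ‖g‖ ^ 2 ≤ τ ^ 2) (x y : ℝ) :
    ‖x • (‖s‖⁻¹ • s) + y • (τ⁻¹ • g)‖ ^ 2 ≤ x ^ 2 + y ^ 2 := by
  rw [norm_sq_smul_add_smul, real_inner_smul_left, real_inner_smul_right, horth, norm_smul,
    norm_smul, norm_inv, norm_inv, norm_norm, inv_mul_cancel₀ (norm_ne_zero_iff.2 hs),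
    Real.norm_eq_abs, abs_of_pos hτ, mul_pow, inv_pow]
  have : (τ ^ 2)⁻¹ * ‖g‖ ^ 2 ≤ 1 := by
    rw [inv_mul_le_iff₀ (by positivity)]; linarith
  have := mul_le_mul_of_nonneg_left this (sq_nonneg y)
  linarith

/-- Acute position of the two means, in terms of their Gram matrix. -/
lemma planarPower_acute_le_of_gram {α q : ℝ} (hα : 1 < α) (hq : q ∈ Set.Ioo (0 : ℝ) 1)
    {D U V c ρ : ℝ} (hD : 0 < D) (hd2 : D ^ 2 = U + V - 2 * c) (hcv : c < V) (hcu : c < U)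
    (hρ : 0 ≤ ρ) (hDρ : D ≤ 2 * ρ)
    (circ : 0 ≤ c → 0 < U * V - c ^ 2 → U * V * (U + V - 2 * c) ≤ 4 * (U * V - c ^ 2) * ρ ^ 2) :
    ∃ τ, 0 < τ ∧ (D / 2) ^ 2 - ((U - V) / (2 * D)) ^ 2 + c ≤ τ ^ 2 ∧
      planarPower α q (D / 2, 0) (-(D / 2), 0) (-((U - V) / (2 * D)), τ)
        ≤ gaussianPower α q (2 * ρ) := by
  obtain ⟨h, hh⟩ : ∃ h, h = D / 2 := ⟨_, rfl⟩
  obtain ⟨κ, hκ⟩ : ∃ κ, κ = (U - V) / (2 * D) := ⟨_, rfl⟩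
  -- Replacing a negative inner product by `0` raises the common mean until its angle is right; the
  -- true triangle is then a contraction of the planar one.
  obtain ⟨m, hm⟩ : ∃ m, m = max c 0 := ⟨_, rfl⟩
  rw [← hh, ← hκ]
  have hh0 : 0 < h := by rw [hh]; positivity
  have hκD : κ * (2 * D) = U - V := by rw [hκ]; field_simp
  have hκh : |κ| < h := by
    rw [hκ, hh, abs_div, abs_of_pos (by positivity : 0 < 2 * D), div_lt_div_iff₀ (by positivity)
      two_pos]
    have : |U - V| < D ^ 2 := by rw [hd2, abs_lt]; constructor <;> linarith
    linarith
  have hκ2 : κ ^ 2 < h ^ 2 := sq_lt_sq' (by linarith [(abs_lt.1 hκh).1]) (abs_lt.1 hκh).2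
  have hm0 : 0 ≤ m := hm ▸ le_max_right _ _
  have hmc : c ≤ m := hm ▸ le_max_left _ _
  have hτ2 : 0 < h ^ 2 - κ ^ 2 + m := by linarith
  obtain ⟨τ, hτ⟩ : ∃ τ, τ = √(h ^ 2 - κ ^ 2 + m) := ⟨_, rfl⟩
  have hτ0 : 0 < τ := hτ ▸ Real.sqrt_pos.2 hτ2
  have hτsq : τ ^ 2 = h ^ 2 - κ ^ 2 + m := hτ ▸ Real.sq_sqrt hτ2.le
  have hm' : κ ^ 2 + τ ^ 2 - h ^ 2 = m := by rw [hτsq]; ring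
  obtain ⟨R, hR⟩ : ∃ R, R = √(h ^ 2 + (m / (2 * τ)) ^ 2) := ⟨_, rfl⟩
  have hR0 : 0 < R := hR ▸ Real.sqrt_pos.2 (by positivity)
  have hRsq : R ^ 2 = h ^ 2 + (m / (2 * τ)) ^ 2 := hR ▸ Real.sq_sqrt (by positivity)
  have hRρ : R ≤ ρ := by
    refine abs_le_of_sq_le_sq' ?_ hρ |>.2
    rw [hRsq]
    rcases le_total c 0 with hc | hc
    · rw [hm, max_eq_right hc, zero_div, hh]
      nlinarith
    · have hmc' : m = c := hm.trans (max_eq_left hc)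
      have hΔ : D ^ 2 * τ ^ 2 = U * V - c ^ 2 := by
        rw [hτsq, hmc', hh]
        have : κ ^ 2 * D ^ 2 = (U - V) ^ 2 / 4 := by rw [← hκD]; ring
        linear_combination -this + (D ^ 2 + U + V + 2 * c) / 4 * hd2
      have circ := circ hc (by rw [← hΔ]; positivity)
      rw [← hd2, ← hΔ, show U * V = D ^ 2 * τ ^ 2 + c ^ 2 by linarith] at circ
      have hD2 : 0 < D ^ 2 := by positivity
      have := (mul_le_mul_iff_of_pos_left hD2).1
        (show D ^ 2 * (D ^ 2 * τ ^ 2 + c ^ 2) ≤ D ^ 2 * (4 * τ ^ 2 * ρ ^ 2) by linarith)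
      rw [hmc', hh, show (D / 2) ^ 2 + (c / (2 * τ)) ^ 2 = (D ^ 2 * τ ^ 2 + c ^ 2) / (4 * τ ^ 2) by
        field_simp; norm_num, div_le_iff₀ (by positivity)]
      linarith
  exact ⟨τ, hτ0, by linarith,
    (planarPower_acute_le hα hq hτ0 hκh (by linarith) hR0 (by rw [hm', hRsq])).trans
      (gaussianPower_mono hα ⟨hq.1.le, hq.2.le⟩ (by positivity) (by linarith))⟩

lemma isProbabilityMeasure_twoPoint {Ω : Type*} [MeasurableSpace Ω] {q : ℝ}
    (hq : q ∈ Set.Icc (0 : ℝ) 1) (μ ν : Measure Ω) [IsProbabilityMeasure μ]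
    [IsProbabilityMeasure ν] : IsProbabilityMeasure (twoPoint q μ ν) := by
  constructor
  rw [twoPoint, Measure.add_apply, Measure.smul_apply, Measure.smul_apply, measure_univ,
    measure_univ, smul_eq_mul, smul_eq_mul, mul_one, mul_one,
    ← ENNReal.ofReal_add hq.1 (sub_nonneg.2 hq.2)]
  simp

/-- Three Gaussian means in a ball of radius `ρ σ`. -/
lemma powerBound_isoGaussian_of_mem_Ioo {α q : ℝ} (hα : 1 < α) (hq : q ∈ Set.Ioo (0 : ℝ) 1)
    {u v o : Emb d} {ρ : ℝ} (h0 : ‖o‖ ≤ ρ) (hu : ‖u - o‖ ≤ ρ) (hv : ‖v - o‖ ≤ ρ) (a : Emb d)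
    (σ : ℝ) : PowerBound α (gaussianPower α q (2 * ρ))
      (twoPoint q (isoGaussian (a + σ • u) σ) (isoGaussian a σ))
      (twoPoint q (isoGaussian (a + σ • v) σ) (isoGaussian a σ)) := by
  have hq' : q ∈ Set.Icc (0 : ℝ) 1 := ⟨hq.1.le, hq.2.le⟩
  have hρ : 0 ≤ ρ := (norm_nonneg _).trans h0
  have hnu : ‖u‖ ≤ 2 * ρ := by
    have := norm_add_le (u - o) o
    rw [sub_add_cancel] at this; linarith
  have hnv : ‖v‖ ≤ 2 * ρ := by
    have := norm_add_le (v - o) o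
    rw [sub_add_cancel] at this; linarith
  have hnd : ‖u - v‖ ≤ 2 * ρ := by
    have := norm_sub_le (u - o) (v - o)
    rw [sub_sub_sub_cancel_right] at this; linarith
  have hd2 : ‖u - v‖ ^ 2 = ‖u‖ ^ 2 + ‖v‖ ^ 2 - 2 * inner ℝ u v := by
    rw [norm_sub_sq_real]; ring
  rcases eq_or_ne u v with rfl | huv
  · have := isProbabilityMeasure_twoPoint hq' (isoGaussian (a + σ • u) σ) (isoGaussian a σ)
    exact PowerBound.self hα (one_le_gaussianPower hα hq' _) _
  have hs0 : u - v ≠ 0 := sub_ne_zero.2 huv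
  have hdiff : 0 < ‖u - v‖ := norm_pos_iff.2 hs0
  have hd2pos : 0 < ‖u - v‖ ^ 2 := by positivity
  obtain ⟨c, hcdef⟩ : ∃ c, c = (inner ℝ u v : ℝ) := ⟨_, rfl⟩
  rw [← hcdef] at hd2
  rcases le_or_gt (‖v‖ ^ 2) c with hcv | hcv
  · -- obtuse at the second mean
    have hc0 : 0 ≤ c := (sq_nonneg _).trans hcv
    have hsc : √c ^ 2 = c := Real.sq_sqrt hc0
    have hl2 : 0 < ‖u‖ ^ 2 - c := by linarith
    obtain ⟨l, hl⟩ : ∃ l, l = √(‖u‖ ^ 2 - c) := ⟨_, rfl⟩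
    have hl0 : 0 < l := hl ▸ Real.sqrt_pos.2 hl2
    have hl2' : l ^ 2 = ‖u‖ ^ 2 - c := hl ▸ Real.sq_sqrt hl2.le
    -- The right triangle with legs `l` and `√c` has the longest side `‖u‖` as hypotenuse.
    have bound : planarPower α q (l / 2, 0) (-(l / 2), 0) (-(l / 2), √c)
        ≤ gaussianPower α q (2 * ρ) :=
      (planarPower_rightAngle_le (r := ‖u‖) hα hq (by
        rw [mul_div_cancel₀ l two_ne_zero, hl2', hsc]; ring)).trans
        (gaussianPower_mono hα hq' (norm_nonneg u) hnu)
    refine PowerBound.isoGaussian_of_planar hα (powerBound_planar hα hq' bound)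
      (norm_sq_obtuse_frame_le hl0 (Real.sqrt_nonneg c) (by norm_num : (1 : ℝ) ^ 2 = 1) (by rwa [hsc])
        (by rw [hsc, hl2', hd2]; ring) (by
          rw [inner_sub_left, real_inner_self_eq_norm_sq, hsc, ← hcdef]; ring))
      (o := a + σ • v + σ • ((1 / 2 : ℝ) • (u - v))) ?_ ?_ ?_
    · simp only [zero_smul, add_zero, smul_smul, smul_sub]
      rw [show σ * (l / 2 * l⁻¹) = σ * (1 / 2) by field_simp]
      module
    · simp only [zero_smul, add_zero, smul_smul, smul_sub]
      rw [show σ * (-(l / 2) * l⁻¹) = -(σ * (1 / 2)) by field_simp]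
      module
    · dsimp only
      rw [smul_neg_inv_smul (by rwa [hsc]), smul_smul (-(l / 2)), show -(l / 2) * l⁻¹ = -(1 / 2) by field_simp]
      module
  rcases le_or_gt (‖u‖ ^ 2) c with hcu | hcu
  · -- obtuse at the first mean
    have hc0 : 0 ≤ c := (sq_nonneg _).trans hcu
    have hsc : √c ^ 2 = c := Real.sq_sqrt hc0
    have hl2 : 0 < ‖v‖ ^ 2 - c := by linarith
    obtain ⟨l, hl⟩ : ∃ l, l = √(‖v‖ ^ 2 - c) := ⟨_, rfl⟩
    have hl0 : 0 < l := hl ▸ Real.sqrt_pos.2 hl2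
    have hl2' : l ^ 2 = ‖v‖ ^ 2 - c := hl ▸ Real.sq_sqrt hl2.le
    -- The right angle sits at the first mean here; reflection moves it to the second.
    have bound : planarPower α q (l / 2, 0) (-(l / 2), 0) (l / 2, √c)
        ≤ gaussianPower α q (2 * ρ) :=
      (planarPower_swap hα hq (by positivity) (by positivity)).trans
      ((planarPower_rightAngle_le (r := ‖v‖) hα hq (by
        rw [mul_div_cancel₀ l two_ne_zero, hl2', hsc]; ring)).trans
        (gaussianPower_mono hα hq' (norm_nonneg v) hnv))
    refine PowerBound.isoGaussian_of_planar hα (powerBound_planar hα hq' bound)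
      (norm_sq_obtuse_frame_le (ε := -1) hl0 (Real.sqrt_nonneg c) (by norm_num) (by rwa [hsc])
        (by rw [hsc, hl2', hd2]; ring) (by
          rw [inner_sub_left, real_inner_self_eq_norm_sq, hsc, real_inner_comm, ← hcdef]; ring))
      (o := a + σ • v + σ • ((1 / 2 : ℝ) • (u - v))) ?_ ?_ ?_
    · simp only [zero_smul, add_zero, smul_smul, smul_sub]
      rw [show σ * (l / 2 * l⁻¹) = σ * (1 / 2) by field_simp]
      module
    · simp only [zero_smul, add_zero, smul_smul, smul_sub]
      rw [show σ * (-(l / 2) * l⁻¹) = -(σ * (1 / 2)) by field_simp]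
      module
    · dsimp only
      rw [smul_neg_inv_smul (by rwa [hsc]), smul_smul (l / 2), show l / 2 * l⁻¹ = 1 / 2 by field_simp]
      module
  · -- acute at both means
    obtain ⟨τ, hτ0, hτsq, bound⟩ := planarPower_acute_le_of_gram hα hq hdiff hd2 hcv hcu hρ hnd
      (by
        rw [hcdef]
        rw [hcdef] at hcv hcu
        exact fun hc hΔ => circumradius_sq_le h0 hu hv hc hcu.le hcv.le hΔ)
    obtain ⟨D, hD⟩ : ∃ D, D = ‖u - v‖ := ⟨_, rfl⟩
    obtain ⟨κ, hκ⟩ : ∃ κ, κ = (‖u‖ ^ 2 - ‖v‖ ^ 2) / (2 * D) := ⟨_, rfl⟩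
    -- `g` is the altitude vector from the line of the two means to the common mean, which sits at
    -- the origin.
    obtain ⟨g, hg⟩ : ∃ g : Emb d, g = (κ * D⁻¹) • (u - v) - (1 / 2 : ℝ) • (u + v) := ⟨_, rfl⟩
    rw [← hD, ← hκ] at hτsq bound
    rw [← hD] at hdiff hd2
    have hκD : κ * (2 * D) = ‖u‖ ^ 2 - ‖v‖ ^ 2 := by rw [hκ]; field_simp
    have hin : inner ℝ (u + v) (u - v) = ‖u‖ ^ 2 - ‖v‖ ^ 2 := by
      rw [inner_add_left, inner_sub_right, inner_sub_right, real_inner_self_eq_norm_sq,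
        real_inner_self_eq_norm_sq, real_inner_comm]; ring
    have horth : inner ℝ (u - v) g = 0 := by
      rw [hg, inner_sub_right, real_inner_smul_right, real_inner_smul_right,
        real_inner_self_eq_norm_sq, real_inner_comm, hin, ← hD, ← hκD]
      field_simp
      ring
    have hgn : ‖g‖ ^ 2 ≤ τ ^ 2 := by
      have hp : ‖u + v‖ ^ 2 = ‖u‖ ^ 2 + ‖v‖ ^ 2 + 2 * c := by rw [norm_add_sq_real, hcdef]; ring
      have : ‖g‖ ^ 2 = (D / 2) ^ 2 - κ ^ 2 + c := by
        rw [hg, norm_sub_sq_real, norm_smul, norm_smul, real_inner_smul_left,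
          real_inner_smul_right, real_inner_comm, hin, mul_pow, mul_pow, hp, ← hD,
          Real.norm_eq_abs, Real.norm_eq_abs, sq_abs, sq_abs, ← hκD]
        field_simp
        linear_combination (-1 : ℝ) * hd2
      linarith
    refine PowerBound.isoGaussian_of_planar hα (powerBound_planar hα hq' bound)
      (norm_sq_orthogonal_frame_le hs0 hτ0 horth hgn)
      (o := a + σ • ((1 / 2 : ℝ) • (u + v))) ?_ ?_ ?_
    · simp only [smul_smul, ← hD]
      rw [show D / 2 * D⁻¹ = 1 / 2 by field_simp]
      module
    · simp only [smul_smul, ← hD]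
      rw [show -(D / 2) * D⁻¹ = -(1 / 2) by field_simp]
      module
    · simp only [smul_smul, mul_inv_cancel₀ hτ0.ne', one_smul, hg, ← hD]
      module

end Geometry

/-! ### Degenerate weights and rescaling by `σ`. -/

section Core

lemma twoPoint_zero {Ω : Type*} [MeasurableSpace Ω] (μ ν : Measure Ω) : twoPoint 0 μ ν = ν := by
  simp [twoPoint]

lemma twoPoint_one {Ω : Type*} [MeasurableSpace Ω] (μ ν : Measure Ω) : twoPoint 1 μ ν = μ := by
  simp [twoPoint]

lemma planarPower_line (α q r : ℝ) :
    planarPower α q (r, 0) (0, 0) (0, 0) = gaussianPower α q r := by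
  have h : powerIntegrand α q (r, 0) (0, 0) (0, 0)
      = fun z : ℝ × ℝ => (q * shiftDensity r z.1 + (1 - q)) ^ α := by
    funext z
    simp [powerIntegrand, mixDensity, planarDensity, shiftDensity]
  rw [planarPower, h, gaussianPower,
    integral_fun_fst (μ := stdNormal) (ν := stdNormal)
      (fun x => (q * shiftDensity r x + (1 - q)) ^ α)]
  simp

variable {d : ℕ}

lemma powerBound_isoGaussian_of_mem {α q : ℝ} (hα : 1 < α) (hq : q ∈ Set.Icc (0 : ℝ) 1)
    {u v o : Emb d} {ρ : ℝ} (h0 : ‖o‖ ≤ ρ) (hu : ‖u - o‖ ≤ ρ) (hv : ‖v - o‖ ≤ ρ) (a : Emb d)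
    (σ : ℝ) : PowerBound α (gaussianPower α q (2 * ρ))
      (twoPoint q (isoGaussian (a + σ • u) σ) (isoGaussian a σ))
      (twoPoint q (isoGaussian (a + σ • v) σ) (isoGaussian a σ)) := by
  rcases hq.1.eq_or_lt with rfl | hq0
  · rw [twoPoint_zero, twoPoint_zero]
    exact PowerBound.self hα (one_le_gaussianPower hα hq _) _
  rcases hq.2.eq_or_lt with rfl | hq1
  -- For `q = 1` the common component is absent and `q / (1 - q)` is not available; the two pure
  -- Gaussians are compared along the line joining their means.
  · rcases eq_or_ne u v with rfl | huv
    · rw [twoPoint_one]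
      exact PowerBound.self hα (one_le_gaussianPower hα hq _) _
    have hs : ‖u - v‖ ≠ 0 := norm_ne_zero_iff.2 (sub_ne_zero.2 huv)
    have hnd : ‖u - v‖ ≤ 2 * ρ := by
      have := norm_sub_le (u - o) (v - o)
      rw [sub_sub_sub_cancel_right] at this; linarith
    have key := PowerBound.isoGaussian_of_planar hα (powerBound_planar hα hq
      ((planarPower_line α 1 ‖u - v‖).trans_le (gaussianPower_mono hα hq (norm_nonneg _) hnd)))
      (T₁ := ‖u - v‖⁻¹ • (u - v)) (T₂ := 0) (fun x y => by
        rw [smul_zero, add_zero, norm_smul, norm_smul, norm_inv, norm_norm, inv_mul_cancel₀ hs,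
          mul_one, Real.norm_eq_abs, sq_abs]
        exact le_add_of_nonneg_right (sq_nonneg y))
      (o := a + σ • v) (a₀ := a + σ • v) (a₁ := a + σ • u) (a₂ := a + σ • v) (σ := σ)
      (by
        simp only [smul_smul, mul_inv_cancel₀ hs, smul_zero]
        module) (by simp) (by simp)
    simpa only [twoPoint_one] using key
  · exact powerBound_isoGaussian_of_mem_Ioo hα ⟨hq0, hq1⟩ h0 hu hv a σ

lemma powerBound_isoGaussian_of_ball {α q : ℝ} (hα : 1 < α) (hq : q ∈ Set.Icc (0 : ℝ) 1)
    {σ δ : ℝ} (hσ : 0 < σ) {o a₀ a₁ a₂ : Emb d} (h0 : ‖a₀ - o‖ ≤ δ) (h1 : ‖a₁ - o‖ ≤ δ)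
    (h2 : ‖a₂ - o‖ ≤ δ) : PowerBound α (gaussianPower α q (2 * δ / σ))
      (twoPoint q (isoGaussian a₁ σ) (isoGaussian a₀ σ))
      (twoPoint q (isoGaussian a₂ σ) (isoGaussian a₀ σ)) := by
  have hn : ∀ {z : Emb d}, ‖z‖ ≤ δ → ‖σ⁻¹ • z‖ ≤ δ / σ := fun {z} hz => by
    rw [norm_smul, Real.norm_of_nonneg (inv_nonneg.2 hσ.le), div_eq_inv_mul]
    gcongr
  have hcancel : ∀ z : Emb d, a₀ + σ • (σ⁻¹ • (z - a₀)) = z := fun z => by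
    rw [smul_smul, mul_inv_cancel₀ hσ.ne', one_smul, add_sub_cancel]
  have := powerBound_isoGaussian_of_mem hα hq (u := σ⁻¹ • (a₁ - a₀)) (v := σ⁻¹ • (a₂ - a₀))
    (o := σ⁻¹ • (o - a₀)) (ρ := δ / σ) (hn (by rwa [norm_sub_rev]))
    (by rw [← smul_sub, sub_sub_sub_cancel_right]; exact hn h1)
    (by rw [← smul_sub, sub_sub_sub_cancel_right]; exact hn h2) a₀ σ
  rwa [hcancel, hcancel, ← mul_div_assoc] at this

end Core

/-! ### The reference divergence as a one-sided power integral. -/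

section Divergence

lemma map_withDensity_comp {X Y : Type*} [MeasurableSpace X] [MeasurableSpace Y] {g : X → Y}
    (hg : Measurable g) {f : Y → ℝ≥0∞} (hf : Measurable f) (μ : Measure X) :
    (μ.withDensity (f ∘ g)).map g = (μ.map g).withDensity f := by
  ext s hs
  rw [Measure.map_apply hg hs, withDensity_apply _ (hg hs), withDensity_apply _ hs,
    setLIntegral_map hs hf hg]
  rfl

lemma gaussianReal_eq_map_mul {σ : ℝ} (hσ : 0 < σ) (p : ℝ) :
    gaussianReal p (σ ^ 2).toNNReal = (gaussianReal (p / σ) 1).map (σ * ·) := by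
  rw [gaussianReal_map_const_mul, mul_div_cancel₀ p hσ.ne', mul_one]
  congr 1
  ext
  simp [sq_nonneg]

lemma gaussianReal_eq_withDensity_scaled {σ : ℝ} (hσ : 0 < σ) (p : ℝ) :
    gaussianReal p (σ ^ 2).toNNReal = (gaussianReal 0 (σ ^ 2).toNNReal).withDensity
      fun x => ENNReal.ofReal (shiftDensity (p / σ) (x / σ)) := by
  rw [gaussianReal_eq_map_mul hσ p, gaussianReal_eq_map_mul hσ 0, zero_div,
    gaussianReal_eq_withDensity_shiftDensity, ← map_withDensity_comp (by fun_prop)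
      (f := fun x => ENNReal.ofReal (shiftDensity (p / σ) (x / σ)))
      (ENNReal.measurable_ofReal.comp (Continuous.measurable (by fun_prop)))]
  congr 2
  funext x
  simp [hσ.ne']

lemma gaussianMixture_eq_withDensity {q : ℝ} (hq : q ∈ Set.Icc (0 : ℝ) 1) {σ : ℝ} (hσ : 0 < σ)
    (p : ℝ) : gaussianMixture q p σ = (gaussianReal 0 (σ ^ 2).toNNReal).withDensity
      fun x => ENNReal.ofReal (q * shiftDensity (p / σ) (x / σ) + (1 - q)) := by
  have hm : Measurable fun x : ℝ => ENNReal.ofReal (shiftDensity (p / σ) (x / σ)) :=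
    ENNReal.measurable_ofReal.comp (Continuous.measurable (by fun_prop))
  have hd : (fun x => ENNReal.ofReal (q * shiftDensity (p / σ) (x / σ) + (1 - q)))
      = ENNReal.ofReal q • (fun x => ENNReal.ofReal (shiftDensity (p / σ) (x / σ)))
        + fun _ => ENNReal.ofReal (1 - q) := by
    funext x
    have h0 : 0 ≤ shiftDensity (p / σ) (x / σ) := (Real.exp_pos _).le
    rw [ENNReal.ofReal_add (mul_nonneg hq.1 h0) (sub_nonneg.2 hq.2), ENNReal.ofReal_mul hq.1]
    rfl
  rw [gaussianMixture, hd, withDensity_add_right _ measurable_const, withDensity_smul _ hm,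
    ← gaussianReal_eq_withDensity_scaled hσ, withDensity_const]

lemma renyiDiv_gaussianMixture {α q : ℝ} (hα : 1 < α) (hq : q ∈ Set.Icc (0 : ℝ) 1) {σ : ℝ}
    (hσ : 0 < σ) (p : ℝ) :
    renyiDiv α (gaussianMixture q p σ) (gaussianReal 0 (σ ^ 2).toNNReal)
      = (((α - 1)⁻¹ : ℝ) : EReal) * ENNReal.log (ENNReal.ofReal (gaussianPower α q (p / σ))) := by
  have hm : Measurable fun x : ℝ =>
      ENNReal.ofReal (q * shiftDensity (p / σ) (x / σ) + (1 - q)) :=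
    ENNReal.measurable_ofReal.comp (Continuous.measurable (by fun_prop))
  have h0 : ∀ x, 0 ≤ q * shiftDensity (p / σ) x + (1 - q) := fun x =>
    add_nonneg (mul_nonneg hq.1 (Real.exp_pos _).le) (sub_nonneg.2 hq.2)
  rw [gaussianMixture_eq_withDensity hq hσ, renyiDiv,
    if_pos (withDensity_absolutelyContinuous _ _)]
  congr 2
  rw [lintegral_congr_ae ((Measure.rnDeriv_withDensity _ hm).mono fun x hx => by rw [hx]),
    gaussianReal_eq_map_mul hσ 0, zero_div, lintegral_map (hm.pow_const α) (by fun_prop),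
    gaussianPower, ofReal_integral_eq_lintegral_ofReal (integrable_gaussianPower α hq _)
      (.of_forall fun x => Real.rpow_nonneg (h0 x) α)]
  refine lintegral_congr fun x => ?_
  rw [mul_div_cancel_left₀ x hσ.ne', ENNReal.ofReal_rpow_of_nonneg (h0 x) (by linarith)]

end Divergence

/-! ### Assembly of the privacy bound. -/

instance {d m k : ℕ} {Ω : Type*} [MeasurableSpace Ω] (tie : LinearOrder (UnitEmb d))
    (φ : (Fin k → Emb d) × Emb m → Ω) (U : Multiset (UnitEmb d)) (y : Emb d) (σ lam q : ℝ)
    (D : Multiset (UnitEmb d)) : IsFiniteMeasure (dpRDM tie φ U y σ lam q D) := by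
  unfold dpRDM
  infer_instance

theorem mainTheorem1 {d m k : ℕ} {Ω : Type*} [MeasurableSpace Ω] (hk : 1 ≤ k)
    (tie : LinearOrder (UnitEmb d))
    (φ : (Fin k → Emb d) × Emb m → Ω) (hφ : Measurable φ)
    (U : Multiset (UnitEmb d)) (y : Emb d)
    (σ : ℝ) (hσ : 0 < σ) (lam : ℝ) (hlam : lam ∈ Set.Icc (0 : ℝ) 1)
    (q : ℝ) (hq : q ∈ Set.Icc (0 : ℝ) 1) (α : ℝ) (hα : 1 < α) :
    ∃ ε : ℝ, 0 ≤ ε ∧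
      (ε : EReal) =
        renyiDiv α (gaussianMixture q (2 / (k : ℝ)) σ) (gaussianReal 0 (σ ^ 2).toNNReal) ∧
      IsRDP (dpRDM tie φ U y σ lam q) α ε := by
  have hB := one_le_gaussianPower hα hq (2 / (k : ℝ) / σ)
  have hε : (((α - 1)⁻¹ * Real.log (gaussianPower α q (2 / (k : ℝ) / σ)) : ℝ) : EReal)
      = (((α - 1)⁻¹ : ℝ) : EReal)
        * ENNReal.log (ENNReal.ofReal (gaussianPower α q (2 / (k : ℝ) / σ))) := by
    rw [ENNReal.log_ofReal_of_pos (by linarith), EReal.coe_mul]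
  refine ⟨_, mul_nonneg (inv_nonneg.2 (sub_nonneg.2 hα.le)) (Real.log_nonneg hB),
    hε.trans (renyiDiv_gaussianMixture hα hq hσ _).symm, fun D₁ D₂ h => ?_⟩
  rw [hε]
  refine PowerBound.renyiDiv_le hα (powerBound_dpRDM hk tie hφ U y σ lam hq hα ?_ h)
  intro o a₀ a₁ a₂ h0 h1 h2
  -- With `δ = k⁻¹` the distance `2 * δ / σ` is `2 / k / σ`, the shift of the reference mixture in
  -- units of `σ`.
  exact powerBound_isoGaussian_of_ball hα hq hσ h0 h1 h2
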